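/- **Configurations and toppling.** Let $\Omega=\{1,2\}^{\mathbb Z}$ with the product topology, its Borel $\sigma$-algebra and the coordinatewise order, and let $\Omega_f\subset\Omega$ be the countable set of configurations with finitely many $2$'s. For $\eta\in\Omega$, $i\in\mathbb Z$ put $k^+=k^+(i,\eta)=\inf\{j\ge 0:\eta(i+j)=1\}$, $k^-=k^-(i,\eta)=\inf\{j>0:\eta(i-j)=1\}$ ($\inf\emptyset=\infty$), and, if both are finite, $i^\eta=i+k^+-k^-$. Let $T_i\eta=\eta+e_i$ if $\eta(i)=1$; if $\eta(i)=2$, let $T_i\eta=\eta+e_{i+k^+}+e_{i-k^-}-e_{i^\eta}$, where, when exactly one of $k^\pm$ is infinite, only the increment $+e_{i\pm k^\pm}$ belonging to the finite one is kept, and $T_i\eta=\eta$ if both are infinite. Let $Lf(\eta)=\sum_{i}[f(T_i\eta)-f(\eta)]$. For $n\ge 0$ and $f:\Omega_f\to\mathbb R$ let $$L_af(\eta)=\sum_{i:\eta(i)=2}[f(T_i\eta)-f(\eta)],\qquad L^{(n)}f(\eta)=L_af(\eta)+\sum_{|i|\le n,\ \eta(i)=1}[f(T_i\eta)-f(\eta)]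 .$$ **Coupling generators.** For $\eta,\xi\in\Omega_f$ and $\eta(i)=2$ let $\phi=\phi(i,\eta,\xi)=i^\eta+k^+(i^\eta,\xi)-k^-(i^\eta,\xi)$ if $\xi(i^\eta)=2$, and $\phi=\infty$, $T_\infty\xi=\xi$, if $\xi(i^\eta)=1$. On functions on $\Omega_f\times\Omega_f$ let * $L_a^c$ have the transitions $(\eta,\xi)\to(T_i\eta,T_{\phi}\xi)$ at rate $1$ for each $i$ with $\eta(i)=2$; * $L^{c,(n)}$ have in addition, at rate $1$ for each $i\in[-n,n]$, the transition to $(\eta,T_i\xi)$ if $\eta(i)=2,\xi(i)=1$, and to $(T_i\eta,T_i\xi)$ if $\eta(i)=\xi(i)=1$; * $L^{c,n+1,n}$ have in addition to those of $L^{c,(n)}$, at rate $1$ for each $i\in\{-n-1,n+1\}$ with $\eta(i)=\xi(i)=1$, the transition to $(T_i\eta,\xi)$. A Markov process on a countable set $E$ *with generator* $G$ is a family $(P^x)_{x\in E}$ of probability measures on the right-continuous step paths in $E$ with finitely many jumps in bounded time, started at $x$, with the Markov property, and such that $(E^xf(X_t)-f(x))/t\to Gf(x)$ as $t\downarrow0$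 for all $x$ and all bounded $f$. $G$ *defines* a Markov process if there is exactly one such family. **Theorem.** 1. $L_a$, $L_a^c$, and for every $n\ge0$ also $L^{(n)}$, $L^{c,(n)}$, $L^{c,n+1,n}$, define Markov processes. Let $S_a(t),S_n(t)$ be the semigroups on $\Omega_f$ of those with generators $L_a$, $L^{(n)}$. For $\eta\ge\xi$ in $\Omega_f$ the process with generator $L_a^c$ (resp. $L^{c,(n)}$, $L^{c,n+1,n}$) started from $(\eta,\xi)$ is a coupling of the processes with generators $L_a$ and $L_a$ (resp. $L^{(n)}$ and $L^{(n)}$, $L^{(n+1)}$ and $L^{(n)}$) started from $\eta$ and $\xi$, and almost surely $\eta_t\ge\xi_t$ for all $t\ge 0$. Consequently $S_a(t)$ and $S_n(t)$ map bounded monotone functions on $\Omega_f$ to bounded monotone functions, and $S_{n}(t)f\le S_{n+1}(t)f$ on $\Omega_f$ for bounded monotone $f$. 2. Let $\mathcal M$ be the class of bounded monotone (nondecreasing) Borel functions on $\Omega$. For $f\in\mathcal M$, $\eta\in\Omega$, $t\ge0$ the limit $S_n(t)f(\eta)=\lim_{\eta'\in\Omega_f,\,\eta'\uparrow\eta}S_n(t)f(\eta')$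 exists and is the same along every increasing sequence in $\Omega_f$ with limit $\eta$; moreover $S_n(t)f(\eta)\le S_{n+1}(t)f(\eta)$, and the limit $S(t)f(\eta)=\lim_{n\to\infty}S_n(t)f(\eta)$ exists. 3. $S(t)$ is a Markov semigroup on $\mathcal M$, and so is each $S_n(t)$: $S(t)\mathcal M\subset\mathcal M$, $S(t)1=1$, $S(t)f\ge0$ if $f\ge0$, $S(t)f\le S(t)g$ if $f\le g$, $S(t)(af+bg)=aS(t)f+bS(t)g$ for $a,b\ge0$, $S(s+t)f=S(s)S(t)f$, and $S(0)f=f$ for all lower semicontinuous $f\in\mathcal M$ (in particular for continuous and for local $f\in\mathcal M$). 4. There is a unique Markov process on $\Omega$ (a measurable family $(P^\eta)_{\eta\in\Omega}$ of probability measures on $\Omega^{[0,\infty)}$ with $\eta_0=\eta$ $P^\eta$-a.s. and the Markov property), the one-dimensional sandpile process, such that $S(t)f(\eta)=E^\eta f(\eta_t)$ for all $t\ge 0$, $\eta\in\Omega$ and all lower semicontinuous $f\in\mathcal M$. For arbitrary $f\in\mathcal M$ one has $S(t)f(\eta)=E^\eta[(S(0)f)(\eta_t)]$, where $S(0)f(\eta)=\lim_{\eta'\in\Omega_f,\,\eta'\uparrow\eta}f(\eta')$.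 5. Its formal generator is $L$: if $f$ is local (depends on finitely many coordinates) and $\eta$ has infinitely many $1$'s on both sides of the origin, then $Lf(\eta)$ is a finite sum and $Lf(\eta)=\lim_{n\to\infty}\lim_{\eta'\in\Omega_f,\,\eta'\uparrow\eta}L^{(n)}f(\eta')$, where the inner limit is the same along every increasing sequence in $\Omega_f$ with limit $\eta$. -/

import Mathlib

open MeasureTheory Filter Topology
open scoped NNReal

namespace Sandpile

noncomputable section

/-! ### Configurations -/

/-- The possible heights at a site: the two-point set `{1, 2}`. -/
abbrev Height : Type := Set.Icc (1 : ℕ) 2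

def one : Height := ⟨1, by simp⟩

def two : Height := ⟨2, by simp⟩

/-- The state space `Ω = {1,2}^ℤ`, with the product order, the product topology and the product
(equivalently Borel) sigma-algebra. -/
abbrev Config : Type := ℤ → Height

/-- The set of critical sites. -/
def critical (η : Config) : Set ℤ := {x | η x = two}

/-- The space `Ω_f` of configurations with finitely many critical sites. -/
abbrev FinConfig : Type := {η : Config // (critical η).Finite}

/-- Configurations with infinitely many ones to the left and to the right of the origin. -/
def InfinitelyManyOnes (η : Config) : Prop :=
  {i : ℤ | i < 0 ∧ η i = one}.Infinite ∧ {i : ℤ | 0 < i ∧ η i = one}.Infinite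

/-- `f` depends on finitely many coordinates only. -/
def IsLocal (f : Config → ℝ) : Prop :=
  ∃ A : Finset ℤ, ∀ η ξ : Config, (∀ x ∈ A, η x = ξ x) → f η = f ξ

/-- The class of bounded monotone Borel functions on `Ω`. -/
structure MonotoneClass (f : Config → ℝ) : Prop where
  mono : Monotone f
  measurable : Measurable f
  bounded : ∃ C : ℝ, ∀ η, |f η| ≤ C

/-! ### The toppling transformation -/

/-- `inf {j ≥ 0 : η (i + j) = 1}`, with `inf ∅ = ∞`. -/
def kPlus (i : ℤ) (η : Config) : ℕ∞ := ⨅ j ∈ {j : ℕ | η (i + j) = one}, (j : ℕ∞)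

/-- `inf {j > 0 : η (i - j) = 1}`, with `inf ∅ = ∞`. -/
def kMinus (i : ℤ) (η : Config) : ℕ∞ := ⨅ j ∈ {j : ℕ | 0 < j ∧ η (i - j) = one}, (j : ℕ∞)

/-- The site `i + k⁺ - k⁻` (meaningful if `k⁺` and `k⁻` are finite). -/
def reflect (i : ℤ) (η : Config) : ℤ := i + (kPlus i η).toNat - (kMinus i η).toNat

/-- `T_i η`: the configuration after adding one grain at `i` and letting the system relax. -/
def topple (i : ℤ) (η : Config) : Config :=
  if η i = one then Function.update η i two
  else if kPlus i η ≠ ⊤ ∧ kMinus i η ≠ ⊤ then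
    Function.update (Function.update (Function.update η
      (i + (kPlus i η).toNat) two) (i - (kMinus i η).toNat) two) (reflect i η) one
  else if kMinus i η ≠ ⊤ then Function.update η (i - (kMinus i η).toNat) two
  else if kPlus i η ≠ ⊤ then Function.update η (i + (kPlus i η).toNat) two
  else η

lemma critical_update_finite {η : Config} (h : (critical η).Finite) (x : ℤ) (v : Height) :
    (critical (Function.update η x v)).Finite := by
  refine (h.insert x).subset fun y hy => ?_
  by_cases hyx : y = x
  · exact Or.inl hyx
  · right
    simpa [critical, Function.update_of_ne hyx] using hy

lemma critical_topple_finite {η : Config} (h : (critical η).Finite) (i : ℤ) :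
    (critical (topple i η)).Finite := by
  unfold topple
  split_ifs
  · exact critical_update_finite h _ _
  · exact critical_update_finite (critical_update_finite (critical_update_finite h _ _) _ _) _ _
  · exact critical_update_finite h _ _
  · exact critical_update_finite h _ _
  · exact h

/-- `T_i` on `Ω_f`. -/
def toppleFin (i : ℤ) (η : FinConfig) : FinConfig :=
  ⟨topple i η.1, critical_topple_finite η.2 i⟩

/-- `T_j` on `Ω_f` for `j ∈ ℤ ∪ {∞}`, where `T_∞` is the identity. -/
def toppleExt : WithTop ℤ → FinConfig → FinConfig
  | none => id
  | some j => toppleFin j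

/-- The site at which a grain has to be added to `ξ` in order to create a `1` in `ξ` at the same
site at which an avalanche of `η` started at `i` creates a `1`; it is `∞` if `ξ` already has a `1`
there. -/
def partner (i : ℤ) (η ξ : FinConfig) : WithTop ℤ :=
  if ξ.1 (reflect i η.1) = two then ((reflect (reflect i η.1) ξ.1 : ℤ) : WithTop ℤ) else ⊤

/-! ### Generators

All sums over `ℤ` in the generators on `Ω_f` have only finitely many nonzero terms. -/

/-- The formal generator `L` on functions on `Ω`. -/
def formalGen (f : Config → ℝ) (η : Config) : ℝ := ∑' i : ℤ, (f (topple i η) - f η)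

/-- The avalanche generator `L_a`. -/
def genA (f : FinConfig → ℝ) (η : FinConfig) : ℝ :=
  ∑' i : ℤ, if η.1 i = two then f (toppleFin i η) - f η else 0

/-- The generator `L⁽ⁿ⁾`: avalanches, and births in `[-n,n]`. -/
def gen (n : ℕ) (f : FinConfig → ℝ) (η : FinConfig) : ℝ :=
  (∑' i : ℤ, if η.1 i = two then f (toppleFin i η) - f η else 0)
  + ∑ i ∈ Finset.Icc (-(n : ℤ)) n, if η.1 i = one then f (toppleFin i η) - f η else 0

/-- The coupling generator for two copies of the avalanche process. -/
def genAC (f : FinConfig × FinConfig → ℝ) (p : FinConfig × FinConfig) : ℝ :=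
  ∑' i : ℤ, if p.1.1 i = two then
    f (toppleFin i p.1, toppleExt (partner i p.1 p.2) p.2) - f p else 0

/-- The coupling generator for two copies of the process with births in `[-n,n]`. -/
def genC (n : ℕ) (f : FinConfig × FinConfig → ℝ) (p : FinConfig × FinConfig) : ℝ :=
  (∑' i : ℤ, if p.1.1 i = two ∧ p.2.1 (reflect i p.1.1) = two then
    f (toppleFin i p.1, toppleExt (partner i p.1 p.2) p.2) - f p else 0)
  + (∑ i ∈ Finset.Icc (-(n : ℤ)) n, if p.1.1 i = two ∧ p.2.1 i = one then
    f (p.1, toppleFin i p.2) - f p else 0)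
  + (∑ i ∈ Finset.Icc (-(n : ℤ)) n, if p.1.1 i = one ∧ p.2.1 i = one then
    f (toppleFin i p.1, toppleFin i p.2) - f p else 0)
  + ∑' i : ℤ, if p.1.1 i = two ∧ p.2.1 (reflect i p.1.1) = one then
    f (toppleFin i p.1, p.2) - f p else 0

/-- The coupling generator for the processes with births in `[-(n+1),n+1]` and in `[-n,n]`. -/
def genCSucc (n : ℕ) (f : FinConfig × FinConfig → ℝ) (p : FinConfig × FinConfig) : ℝ :=
  (∑' i : ℤ, if p.1.1 i = two ∧ p.2.1 (reflect i p.1.1) = two then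
    f (toppleFin i p.1, toppleExt (partner i p.1 p.2) p.2) - f p else 0)
  + (∑ i ∈ Finset.Icc (-(n : ℤ)) n, if p.1.1 i = two ∧ p.2.1 i = one then
    f (p.1, toppleFin i p.2) - f p else 0)
  + (∑ i ∈ Finset.Icc (-(n : ℤ)) n, if p.1.1 i = one ∧ p.2.1 i = one then
    f (toppleFin i p.1, toppleFin i p.2) - f p else 0)
  + (∑ i ∈ ({-(n : ℤ) - 1, (n : ℤ) + 1} : Finset ℤ), if p.1.1 i = one ∧ p.2.1 i = one then
    f (toppleFin i p.1, p.2) - f p else 0)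
  + ∑' i : ℤ, if p.1.1 i = two ∧ p.2.1 (reflect i p.1.1) = one then
    f (toppleFin i p.1, p.2) - f p else 0

/-! ### Markov processes -/

section Markov

variable {W E F : Type*}

/-- The sigma-algebra generated by the coordinates up to time `s`. -/
@[reducible] def past [MeasurableSpace E] (X : ℝ≥0 → W → E) (s : ℝ≥0) : MeasurableSpace W :=
  ⨆ r : Set.Iic s, MeasurableSpace.comap (X r) inferInstance

/-- The transition semigroup `f ↦ E^x f(X_t)` of a family of laws. -/
def transition [MeasurableSpace W] (X : ℝ≥0 → W → E) (P : E → Measure W) (t : ℝ≥0)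
    (f : E → ℝ) (x : E) : ℝ :=
  ∫ ω, f (X t ω) ∂(P x)

/-- The laws `P x` on the path space `W` with coordinates `X` form a (time-homogeneous) Markov
process: `P x` starts from `x` and `E^x[f(X_{s+t}) | X_r, r ≤ s] = E^{X_s} f(X_t)`. -/
structure IsMarkovFamily [MeasurableSpace W] [MeasurableSpace E] (X : ℝ≥0 → W → E)
    (P : E → Measure W) : Prop where
  measurable : Measurable P
  prob : ∀ x, IsProbabilityMeasure (P x)
  start : ∀ x, ∀ᵐ ω ∂(P x), X 0 ω = x
  markov : ∀ (x : E) (s t : ℝ≥0) (f : E → ℝ), Measurable f → (∃ C, ∀ y, |f y| ≤ C) →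
    (P x)[fun ω => f (X (s + t) ω) | past X s] =ᵐ[P x] fun ω => transition X P t f (X s ω)

/-- Right-continuous paths with left limits in the discrete set `E`, that is, right-continuous
step functions with finitely many jumps in every bounded time interval. -/
def StepPath (E : Type*) : Type _ :=
  {ω : ℝ≥0 → E // (∀ t, ∀ᶠ s in 𝓝[>] t, ω s = ω t) ∧
    ∀ t, 0 < t → ∃ y, ∀ᶠ s in 𝓝[<] t, ω s = y}

/-- The coordinate process on `StepPath E`. -/
def StepPath.eval (t : ℝ≥0) (ω : StepPath E) : E := ω.1 t

/-- The sigma-algebra generated by the coordinates. -/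
instance [MeasurableSpace E] : MeasurableSpace (StepPath E) :=
  MeasurableSpace.comap (fun ω : StepPath E => ω.1) MeasurableSpace.pi

/-- The image of a step path under a map. -/
def StepPath.map (g : E → F) (ω : StepPath E) : StepPath F :=
  ⟨fun t => g (ω.1 t), fun t => (ω.2.1 t).mono fun _ hs => congrArg g hs, fun t ht =>
    let ⟨y, hy⟩ := ω.2.2 t ht
    ⟨g y, hy.mono fun _ hs => congrArg g hs⟩⟩

/-- The laws `P x` form a Markov process on the countable set `E` with generator `G`: a Markov
family on step paths whose semigroup `S(t)` satisfies `(S(t)f(x) - f(x)) / t → G f(x)` as `t ↓ 0`,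
for all bounded `f` and all `x`. -/
structure IsChainWithGenerator [MeasurableSpace E] (G : (E → ℝ) → E → ℝ)
    (P : E → Measure (StepPath E)) : Prop where
  family : IsMarkovFamily StepPath.eval P
  generator : ∀ f : E → ℝ, (∃ C, ∀ y, |f y| ≤ C) → ∀ x,
    Tendsto (fun t : ℝ≥0 => (transition StepPath.eval P t f x - f x) / (t : ℝ)) (𝓝[>] 0)
      (𝓝 (G f x))

/-- `G` defines a Markov process, namely `P`: this is the one and only Markov process with
generator `G`. -/
def Generates [MeasurableSpace E] (G : (E → ℝ) → E → ℝ) (P : E → Measure (StepPath E)) : Prop :=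
  IsChainWithGenerator G P ∧ ∀ P', IsChainWithGenerator G P' → P' = P

end Markov

/-- From ordered starting points `η ≥ ξ`, the pair process `P` is a coupling of the path measures
`P₁ η` and `P₂ ξ` which preserves the order for all times. -/
def IsOrderedCoupling (P : FinConfig × FinConfig → Measure (StepPath (FinConfig × FinConfig)))
    (P₁ P₂ : FinConfig → Measure (StepPath FinConfig)) : Prop :=
  ∀ η ξ : FinConfig, ξ ≤ η →
    (P (η, ξ)).map (StepPath.map Prod.fst) = P₁ η ∧
    (P (η, ξ)).map (StepPath.map Prod.snd) = P₂ ξ ∧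
    ∀ᵐ ω ∂(P (η, ξ)), ∀ t, (ω.eval t).2 ≤ (ω.eval t).1

/-- The semigroup of the process maps bounded monotone functions on `Ω_f` to such functions. -/
def IsMonotoneProcess (P : FinConfig → Measure (StepPath FinConfig)) : Prop :=
  ∀ (t : ℝ≥0) (f : FinConfig → ℝ), Monotone f → (∃ C, ∀ η, |f η| ≤ C) →
    Monotone (transition StepPath.eval P t f) ∧
      ∃ C, ∀ η, |transition StepPath.eval P t f η| ≤ C

/-- The sequence `u` in `Ω_f` increases to `η ∈ Ω`. -/
def IncreasesTo (u : ℕ → FinConfig) (η : Config) : Prop :=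
  Monotone u ∧ Tendsto (fun k => (u k).1) atTop (𝓝 η)

/-- `S` is a Markov semigroup on the class of bounded monotone Borel functions. Functions in this
class need not be determined by their values on `Ω_f`, so `S 0 f = f` is required for lower
semicontinuous `f` only (for monotone `f`: `f η = lim f η'` as `η' ↑ η`, `η' ∈ Ω_f`). -/
structure IsMarkovSemigroup (S : ℝ≥0 → (Config → ℝ) → Config → ℝ) : Prop where
  maps : ∀ t f, MonotoneClass f → MonotoneClass (S t f)
  zero : ∀ f, MonotoneClass f → LowerSemicontinuous f → S 0 f = f
  unit : ∀ t, S t (fun _ => 1) = fun _ => 1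
  nonneg : ∀ t f, MonotoneClass f → (∀ η, 0 ≤ f η) → ∀ η, 0 ≤ S t f η
  order : ∀ t f g, MonotoneClass f → MonotoneClass g → (∀ η, f η ≤ g η) →
    ∀ η, S t f η ≤ S t g η
  linear : ∀ t f g, MonotoneClass f → MonotoneClass g → ∀ a b : ℝ, 0 ≤ a → 0 ≤ b →
    S t (fun η => a * f η + b * g η) = fun η => a * S t f η + b * S t g η
  semigroup : ∀ s t f, MonotoneClass f → S (s + t) f = S s (S t f)

/-- The coordinate process on `Ω^[0,∞)`. -/
def coord (t : ℝ≥0) (ω : ℝ≥0 → Config) : Config := ω t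

/-- `Q` is a Markov process on `Ω` (given by its laws on `Ω^[0,∞)`) with semigroup `S`. -/
structure IsProcessWithSemigroup (S : ℝ≥0 → (Config → ℝ) → Config → ℝ)
    (Q : Config → Measure (ℝ≥0 → Config)) : Prop where
  family : IsMarkovFamily coord Q
  expectation : ∀ f, MonotoneClass f → LowerSemicontinuous f → ∀ t η,
    S t f η = transition coord Q t f η

end

end Sandpile

open Sandpile

/-! An avalanche started at `i` inside a maximal run of critical sites fills the two ends of the run
and leaves a single `1` at the mirror image of `i`. Toppling `η ≥ ξ` at the same site can therefore
destroy the order, because the new `1` of `η` may appear where `ξ` is still critical. The coupling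
matches avalanches by the hole they create and not by their starting point. Reflection in a gap is
an involution, so the avalanches of `η` whose hole hits a critical site of `ξ` correspond one to one
to all avalanches of `ξ` (`FinConfig.sum_partner`), and both marginals have the right rates. The gap
of `ξ` around the hole is contained in the gap of `η`, so the order survives
(`FinConfig.toppleFin_reflect_le`).

On `Ω_f` the processes are Markov chains with unbounded rates. Take for `V` the number of critical
sites plus a constant. Then `V` dominates the total rate and grows by at most `1` per jump, so the
`n`-th jump occurs before time `t` with probability at most `exp t * V / (V + n)`, as for a Yule
process. This bound is used in two forms. For laws built from exponential clocks it excludes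
explosion and yields the Markov property (`eq_zero_of_le_lintegral`, `ae_nonExplosive`,
`integral_noise_markov`). For the backward equation it gives uniqueness among bounded solutions
(`eq_zero_of_backward`), hence uniqueness of the chain, the identification of the marginals of a
coupling, and the invariance of the set of ordered pairs (`IsChainWithGenerator.map_eq`,
`IsChainWithGenerator.ae_mem`).

The couplings make expectations of increasing path functionals increase in the starting point and in
`n` (`IsMonotoneFamily`). All limits are then suprema over configurations in `Ω_f` and over `n`.
These suprema commute, and an array which increases in both indices may be evaluated on its
diagonal; the semigroup property passes to the limit for this reason.

The process on `Ω` is found as a limit of laws on `Ω^[0,∞)`. Cylinder sets over a finite alphabet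
are compact, so an ultrafilter limit of the laws is automatically countably additive. On increasing
local functionals it is the honest monotone limit (`IsLimitLaw`), and increasing cylinder events
form a generating π-system, so the Markov property, measurability and uniqueness need to be checked
there only. These indicators are lower semicontinuous, so they are recovered from their values on
`Ω_f`. For the formal generator, ones of `η` on both sides of the dependence set of a local `f`
block all avalanches from outside, which leaves finitely many terms. -/

set_option linter.unusedSectionVars false

namespace Sandpile

/-! ### Markov families -/

section MarkovFamily

open ProbabilityTheory

variable {W E : Type*} [MeasurableSpace W] [MeasurableSpace E] {X : ℝ≥0 → W → E} {P : E → Measure W}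

lemma past_le (hX : ∀ t, Measurable (X t)) (s : ℝ≥0) : past X s ≤ ‹MeasurableSpace W› :=
  iSup_le fun r => (hX r).comap_le

lemma measurable_past {s r : ℝ≥0} (h : r ≤ s) : Measurable[past X s] (X r) := by
  refine measurable_iff_comap_le.2 ?_
  exact le_iSup (fun r : Set.Iic s => MeasurableSpace.comap (X r) inferInstance) ⟨r, h⟩

lemma integrable_of_abs_le {μ : Measure W} [IsFiniteMeasure μ] {f : W → ℝ} (hf : Measurable f)
    (hb : ∃ C, ∀ y, |f y| ≤ C) : Integrable f μ := by
  obtain ⟨C, hC⟩ := hb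
  exact Integrable.of_bound hf.aestronglyMeasurable C (Eventually.of_forall hC)

lemma abs_integral_le_of_abs_le {μ : Measure W} [IsProbabilityMeasure μ] {f : W → ℝ} {C : ℝ}
    (hb : ∀ y, |f y| ≤ C) : |∫ ω, f ω ∂μ| ≤ C := by
  simpa using norm_integral_le_of_norm_le_const (μ := μ) (f := f) (C := C) (Eventually.of_forall hb)

lemma measurable_transition (hP : Measurable P) (hX : ∀ t, Measurable (X t)) (t : ℝ≥0) {f : E → ℝ}
    (hf : Measurable f) : Measurable (transition X P t f) :=
  (StronglyMeasurable.integral_kernel (κ := (⟨P, hP⟩ : Kernel E W))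
    (hf.comp (hX t)).stronglyMeasurable).measurable

lemma abs_transition_le (hP : ∀ x, IsProbabilityMeasure (P x)) (t : ℝ≥0) {f : E → ℝ} {C : ℝ}
    (hb : ∀ y, |f y| ≤ C) (x : E) : |transition X P t f x| ≤ C :=
  have := hP x
  abs_integral_le_of_abs_le fun ω => hb (X t ω)

namespace IsMarkovFamily

/-- The Markov property in integrated form: a bounded factor measurable with respect to the past is
pulled out of the conditional expectation. -/
lemma integral_mul_eq (h : IsMarkovFamily X P) (hX : ∀ t, Measurable (X t)) (x : E) (s t : ℝ≥0)
    {Φ : W → ℝ} (hΦ : Measurable[past X s] Φ) (hΦb : ∃ C, ∀ ω, |Φ ω| ≤ C) {f : E → ℝ}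
    (hf : Measurable f) (hfb : ∃ C, ∀ y, |f y| ≤ C) :
    ∫ ω, Φ ω * f (X (s + t) ω) ∂(P x) = ∫ ω, Φ ω * transition X P t f (X s ω) ∂(P x) := by
  have := h.prob x
  have hm := past_le hX s
  obtain ⟨C, hC⟩ := hΦb
  obtain ⟨D, hD⟩ := hfb
  have hg : Integrable (fun ω => f (X (s + t) ω)) (P x) :=
    integrable_of_abs_le (hf.comp (hX _)) ⟨D, fun ω => hD _⟩
  have hfg : Integrable (Φ * fun ω => f (X (s + t) ω)) (P x) := by
    refine integrable_of_abs_le ((hΦ.mono hm le_rfl).mul (hf.comp (hX _))) ⟨C * D, fun ω => ?_⟩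
    simp only [Pi.mul_apply, abs_mul]
    exact mul_le_mul (hC _) (hD _) (abs_nonneg _) ((abs_nonneg _).trans (hC ω))
  have h1 := condExp_mul_of_stronglyMeasurable_left (m := past X s) (μ := P x)
    hΦ.stronglyMeasurable hfg hg
  have h2 := h.markov x s t f hf ⟨D, hD⟩
  calc ∫ ω, Φ ω * f (X (s + t) ω) ∂(P x)
      = ∫ ω, ((P x)[Φ * fun ω => f (X (s + t) ω) | past X s]) ω ∂(P x) :=
        (integral_condExp hm).symm
    _ = _ := by
        refine integral_congr_ae ?_
        filter_upwards [h1, h2] with ω h1 h2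
        rw [h1, Pi.mul_apply, h2]

/-- Chapman–Kolmogorov, from the integrated Markov property with the trivial factor `Φ = 1`. -/
lemma transition_add (h : IsMarkovFamily X P) (hX : ∀ t, Measurable (X t)) (s t : ℝ≥0)
    {f : E → ℝ} (hf : Measurable f) (hfb : ∃ C, ∀ y, |f y| ≤ C) (x : E) :
    transition X P (s + t) f x = transition X P s (transition X P t f) x := by
  simpa [transition] using h.integral_mul_eq hX x s t (Φ := fun _ => 1) measurable_const
    ⟨1, by simp⟩ hf hfb

lemma transition_zero (h : IsMarkovFamily X P) (f : E → ℝ) (x : E) :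
    transition X P 0 f x = f x := by
  have := h.prob x
  have h0 : (fun ω => f (X 0 ω)) =ᵐ[P x] fun _ => f x := by
    filter_upwards [h.start x] with ω hω
    rw [hω]
  simp [transition, integral_congr_ae h0]

variable {W' E' : Type*} [MeasurableSpace W'] [MeasurableSpace E'] {X' : ℝ≥0 → W' → E'}
  {P' : E' → Measure W'}

/-- If the transition functions of two Markov families agree along a map `π`, on a set which the
first process does not leave, then so do the finite-dimensional distributions. -/
theorem integral_prod_eq (h : IsMarkovFamily X P) (hX : ∀ t, Measurable (X t))
    (h' : IsMarkovFamily X' P') (hX' : ∀ t, Measurable (X' t)) {π : E → E'} (hπ : Measurable π)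
    {D : Set E} (hD : ∀ x ∈ D, ∀ t, ∀ᵐ ω ∂(P x), X t ω ∈ D)
    (htr : ∀ t f, Measurable f → (∃ C, ∀ y, |f y| ≤ C) → ∀ x ∈ D,
      transition X P t (f ∘ π) x = transition X' P' t f (π x)) (I : Finset ℝ≥0) :
    ∀ (g : ℝ≥0 → E' → ℝ), (∀ t, Measurable (g t)) → (∀ t, ∃ C, ∀ y, |g t y| ≤ C) → ∀ x ∈ D,
      ∫ ω, ∏ t ∈ I, g t (π (X t ω)) ∂(P x) = ∫ ω, ∏ t ∈ I, g t (X' t ω) ∂(P' (π x)) := by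
  induction I using Finset.induction_on_max with
  | empty =>
    intro g _ _ x _
    have := h.prob x
    have := h'.prob (π x)
    simp
  | insert a s has ih =>
    intro g hg hgb x hx
    have ha : a ∉ s := fun h => lt_irrefl _ (has a h)
    simp_rw [Finset.prod_insert ha]
    rcases s.eq_empty_or_nonempty with rfl | hs
    · simpa [transition] using htr a (g a) (hg a) (hgb a) x hx
    -- The last time is `m + b`, with `m` the latest of the others. Conditioning on the past up to
    -- `m` turns the last factor into a function of the state at time `m`; it is absorbed into the
    -- factor at `m`, which gives `g'` and allows the induction hypothesis for `s`.
    set m := s.max' hs with hm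
    have hms : m ∈ s := s.max'_mem hs
    obtain ⟨b, rfl⟩ : ∃ b, a = m + b := ⟨a - m, (add_tsub_cancel_of_le (has m hms).le).symm⟩
    obtain ⟨C, hC⟩ := hgb (m + b)
    let g' : ℝ≥0 → E' → ℝ := fun t y =>
      if t = m then g t y * transition X' P' b (g (m + b)) y else g t y
    have hκm := measurable_transition h'.measurable hX' b (hg (m + b))
    have hκb := abs_transition_le (X := X') h'.prob b hC
    have hg' : ∀ t, Measurable (g' t) := by
      intro t
      by_cases htm : t = m
      · simp only [g', htm, if_true]
        exact (hg m).mul hκm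
      · simpa [g', htm] using hg t
    have hgb' : ∀ t, ∃ C, ∀ y, |g' t y| ≤ C := by
      intro t
      obtain ⟨B, hB⟩ := hgb t
      by_cases htm : t = m
      · refine ⟨B * C, fun y => ?_⟩
        simp only [g', htm, if_true, abs_mul]
        exact mul_le_mul (htm ▸ hB y) (hκb y) (abs_nonneg _) ((abs_nonneg _).trans (hB y))
      · exact ⟨B, fun y => by simpa [g', htm] using hB y⟩
    have hprod : ∀ (z : ℝ≥0 → E'), ∏ t ∈ s, g' t (z t)
        = (∏ t ∈ s, g t (z t)) * transition X' P' b (g (m + b)) (z m) := by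
      intro z
      rw [← Finset.mul_prod_erase s _ hms, ← Finset.mul_prod_erase s (fun t => g t (z t)) hms]
      have : ∏ t ∈ s.erase m, g' t (z t) = ∏ t ∈ s.erase m, g t (z t) :=
        Finset.prod_congr rfl fun t ht => by simp [g', Finset.ne_of_mem_erase ht]
      rw [this]
      simp only [g', if_true]
      ring
    have hle : ∀ t ∈ s, t ≤ m := fun t ht => s.le_max' t ht
    have hbd : ∀ z : ℝ≥0 → E', |∏ t ∈ s, g t (z t)| ≤ ∏ t ∈ s, (hgb t).choose := by
      intro z
      rw [Finset.abs_prod]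
      exact Finset.prod_le_prod (fun _ _ => abs_nonneg _) fun t _ => (hgb t).choose_spec _
    have key := ih g' hg' hgb' x hx
    simp_rw [hprod (fun t => X' t _)] at key
    have e1 := h.integral_mul_eq hX x m b (Φ := fun ω => ∏ t ∈ s, g t (π (X t ω)))
      (Finset.measurable_prod s fun t ht => ((hg t).comp hπ).comp (measurable_past (hle t ht)))
      ⟨_, fun ω => hbd fun t => π (X t ω)⟩ (f := g (m + b) ∘ π) ((hg _).comp hπ)
      ⟨C, fun y => hC _⟩
    have e2 := h'.integral_mul_eq hX' (π x) m b (Φ := fun ω => ∏ t ∈ s, g t (X' t ω))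
      (Finset.measurable_prod s fun t ht => (hg t).comp (measurable_past (hle t ht)))
      ⟨_, fun ω => hbd fun t => X' t ω⟩ (hg (m + b)) ⟨C, hC⟩
    simp_rw [mul_comm (g (m + b) _)]
    rw [e2, ← key]
    refine Eq.trans e1 (integral_congr_ae ?_)
    -- The first process produces its own transition function at time `m`; since `X m` almost surely
    -- lies in `D`, it may be exchanged for that of the second process.
    filter_upwards [hD x hx m] with ω hω
    rw [htr b _ (hg _) ⟨C, hC⟩ _ hω, ← hprod (fun t => π (X t ω))]

lemma generateFrom_coord {C : Set (Set E)}
    (hC : ‹MeasurableSpace E› = MeasurableSpace.generateFrom C) (S : Set ℝ≥0) (X : ℝ≥0 → W → E) :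
    MeasurableSpace.generateFrom
      (piiUnionInter (fun t => {A | ∃ B ∈ C, X t ⁻¹' B = A}) S)
      = ⨆ t ∈ S, MeasurableSpace.comap (X t) inferInstance := by
  have hcomap : ∀ t, MeasurableSpace.comap (X t) ‹MeasurableSpace E›
      = MeasurableSpace.generateFrom {A | ∃ B ∈ C, X t ⁻¹' B = A} := by
    intro t
    rw [hC, MeasurableSpace.comap_generateFrom]
    rfl
  refine le_antisymm ?_ (iSup₂_le fun t ht => ?_)
  · refine MeasurableSpace.generateFrom_le ?_
    rintro _ ⟨I, hI, A, hA, rfl⟩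
    refine Finset.measurableSet_biInter I fun t ht => ?_
    refine (le_iSup₂_of_le (f := fun t (_ : t ∈ S) => MeasurableSpace.comap (X t) inferInstance)
      t (hI ht) le_rfl) _ ?_
    rw [hcomap t]
    exact MeasurableSpace.measurableSet_generateFrom (hA t ht)
  · rw [hcomap t]
    exact MeasurableSpace.generateFrom_mono (subset_piiUnionInter
      (π := fun t => {A | ∃ B ∈ C, X t ⁻¹' B = A}) ht)

lemma isPiSystem_coord {C : Set (Set E)} (hC : IsPiSystem C) (S : Set ℝ≥0) (X : ℝ≥0 → W → E) :
    IsPiSystem (piiUnionInter (fun t => {A | ∃ B ∈ C, X t ⁻¹' B = A}) S) :=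
  isPiSystem_piiUnionInter _ (fun _ => hC.comap _) S

/-- The coordinates generate the path space, so two probability measures agree if they agree on
finite-dimensional rectangles. These are handled by `integral_prod_eq` with indicator functions as
factors. -/
theorem map_eq (h : IsMarkovFamily X P) (hX : ∀ t, Measurable (X t))
    (h' : IsMarkovFamily X' P') (hX' : ∀ t, Measurable (X' t)) {π : E → E'} (hπ : Measurable π)
    {D : Set E} (hD : ∀ x ∈ D, ∀ t, ∀ᵐ ω ∂(P x), X t ω ∈ D)
    (htr : ∀ t f, Measurable f → (∃ C, ∀ y, |f y| ≤ C) → ∀ x ∈ D,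
      transition X P t (f ∘ π) x = transition X' P' t f (π x))
    (hgen : ‹MeasurableSpace W'› = ⨆ t, MeasurableSpace.comap (X' t) inferInstance)
    {Z : W → W'} (hZ : Measurable Z) (hXZ : ∀ t ω, X' t (Z ω) = π (X t ω)) {x : E} (hx : x ∈ D) :
    (P x).map Z = P' (π x) := by
  have := h.prob x
  have := h'.prob (π x)
  have : IsProbabilityMeasure ((P x).map Z) := Measure.isProbabilityMeasure_map hZ.aemeasurable
  refine ext_of_generate_finite _ ?_ (isPiSystem_coord MeasurableSpace.isPiSystem_measurableSet
    Set.univ X') ?_ (by simp)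
  · rw [generateFrom_coord MeasurableSpace.generateFrom_measurableSet.symm, hgen]
    simp
  · rintro _ ⟨I, -, A, hA, rfl⟩
    choose! B hB hBA using hA
    have hms : MeasurableSet (⋂ t ∈ I, A t) :=
      Finset.measurableSet_biInter I fun t ht => hBA t ht ▸ hX' t (hB t ht)
    let g : ℝ≥0 → E' → ℝ := fun t => if t ∈ I then (B t).indicator 1 else 0
    have key := h.integral_prod_eq hX h' hX' hπ hD htr I g (fun t => by
      by_cases ht : t ∈ I
      · simpa [g, ht] using measurable_one.indicator (hB t ht)
      · simp only [g, ht, if_false]; exact measurable_zero) (fun t => ⟨1, fun y => by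
        by_cases ht : t ∈ I
        · by_cases hy : y ∈ B t <;> simp [g, ht, hy]
        · simp [g, ht]⟩) x hx
    classical
    have hind : ∀ ω', ∏ t ∈ I, g t (X' t ω') = (⋂ t ∈ I, A t).indicator 1 ω' := by
      intro ω'
      rw [Set.indicator_apply]
      split_ifs with hω
      · refine Finset.prod_eq_one fun t ht => ?_
        have : X' t ω' ∈ B t := by
          have := Set.mem_iInter₂.1 hω t ht
          rwa [← hBA t ht] at this
        simp [g, ht, this]
      · simp only [Set.mem_iInter, not_forall] at hω
        obtain ⟨t, ht, hω⟩ := hω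
        refine Finset.prod_eq_zero ht ?_
        have : X' t ω' ∉ B t := by
          rw [← hBA t ht] at hω
          exact hω
        simp [g, ht, this]
    have hind' : ∀ ω, ∏ t ∈ I, g t (π (X t ω)) = (Z ⁻¹' ⋂ t ∈ I, A t).indicator 1 ω := by
      intro ω
      simp_rw [← hXZ, hind]
      rfl
    simp_rw [hind, hind'] at key
    rw [integral_indicator_one hms, integral_indicator_one (hZ hms)] at key
    rw [Measure.map_apply hZ hms]
    exact (measureReal_eq_measureReal_iff).1 key

/-- The Markov property has to be checked on a π-system only. -/
theorem of_isPiSystem (hX : ∀ t, Measurable (X t)) (hP : Measurable P)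
    (hprob : ∀ x, IsProbabilityMeasure (P x)) (hstart : ∀ x, ∀ᵐ ω ∂(P x), X 0 ω = x)
    {C : Set (Set E)} (hC : IsPiSystem C)
    (hgen : ‹MeasurableSpace E› = MeasurableSpace.generateFrom C) (huniv : Set.univ ∈ C)
    (hmk : ∀ (x : E) (s t : ℝ≥0) (I : Finset ℝ≥0) (B : ℝ≥0 → Set E) (B₀ : Set E),
      (∀ r ∈ I, r ≤ s) → (∀ r ∈ I, B r ∈ C) → B₀ ∈ C →
      P x ((⋂ r ∈ I, X r ⁻¹' B r) ∩ X (s + t) ⁻¹' B₀)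
        = ∫⁻ ω in ⋂ r ∈ I, X r ⁻¹' B r, P (X s ω) (X t ⁻¹' B₀) ∂(P x)) :
    IsMarkovFamily X P where
  measurable := hP
  prob := hprob
  start := hstart
  markov := by
    intro x s t f hf hfb
    have := hprob x
    have hm := past_le hX s
    have hCm : ∀ B ∈ C, MeasurableSet B := fun B hB => by
      rw [hgen]; exact MeasurableSpace.measurableSet_generateFrom hB
    have hpast : past X s = MeasurableSpace.generateFrom
        (piiUnionInter (fun t => {A | ∃ B ∈ C, X t ⁻¹' B = A}) (Set.Iic s)) := by
      rw [generateFrom_coord hgen, past, iSup_subtype]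
    have hker : ∀ B, MeasurableSet B → Measurable fun y => P y (X t ⁻¹' B) := fun B hB =>
      (Measure.measurable_coe (hX t hB)).comp hP
    -- First extension: for a fixed target `B₀`, both sides are finite measures in the past event
    -- `A`. They agree on the π-system of rectangles, hence on the whole past.
    have step1 : ∀ B₀ ∈ C, ∀ A, MeasurableSet[past X s] A → P x (A ∩ X (s + t) ⁻¹' B₀)
        = ∫⁻ ω in A, P (X s ω) (X t ⁻¹' B₀) ∂(P x) := by
      intro B₀ hB₀ A hA
      have hB := hCm B₀ hB₀
      have hbasic : ∀ A ∈ piiUnionInter (fun t => {A | ∃ B ∈ C, X t ⁻¹' B = A}) (Set.Iic s),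
          P x (A ∩ X (s + t) ⁻¹' B₀) = ∫⁻ ω in A, P (X s ω) (X t ⁻¹' B₀) ∂(P x) := by
        rintro _ ⟨I, hI, A, hA, rfl⟩
        choose! B hB hBA using hA
        have : ⋂ r ∈ I, A r = ⋂ r ∈ I, X r ⁻¹' B r :=
          Set.iInter₂_congr fun r hr => (hBA r hr).symm
        rw [this]
        exact hmk x s t I B B₀ (fun r hr => hI hr) hB hB₀
      let μ₁ := ((P x).restrict (X (s + t) ⁻¹' B₀)).trim hm
      let μ₂ := ((P x).withDensity fun ω => P (X s ω) (X t ⁻¹' B₀)).trim hm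
      have e1 : ∀ A, MeasurableSet[past X s] A → μ₁ A = P x (A ∩ X (s + t) ⁻¹' B₀) := by
        intro A hA
        rw [trim_measurableSet_eq hm hA, Measure.restrict_apply (hm A hA)]
      have e2 : ∀ A, MeasurableSet[past X s] A →
          μ₂ A = ∫⁻ ω in A, P (X s ω) (X t ⁻¹' B₀) ∂(P x) := by
        intro A hA
        rw [trim_measurableSet_eq hm hA, withDensity_apply _ (hm A hA)]
      have e3 : ∀ A ∈ piiUnionInter (fun t => {A | ∃ B ∈ C, X t ⁻¹' B = A}) (Set.Iic s),
          μ₁ A = μ₂ A := by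
        intro A hA
        have hA' : MeasurableSet[past X s] A := by
          rw [hpast]; exact MeasurableSpace.measurableSet_generateFrom hA
        rw [e1 A hA', e2 A hA', hbasic A hA]
      have : μ₁ = μ₂ := by
        refine @ext_of_generate_finite W (past X s) μ₁ μ₂ _ hpast
          (isPiSystem_coord hC _ X) inferInstance e3 (e3 _ ⟨∅, by simp, fun _ => ∅, by simp, by simp⟩)
      rw [← e1 A hA, ← e2 A hA, this]
    refine (ae_eq_condExp_of_forall_setIntegral_eq hm
      (integrable_of_abs_le (hf.comp (hX _)) (hfb.imp fun C h ω => h _)) ?_ ?_ ?_).symm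
    · intro A _ _
      obtain ⟨K, hK⟩ := hfb
      exact (integrable_of_abs_le ((measurable_transition hP hX t hf).comp (hX s))
        ⟨K, fun ω => abs_transition_le hprob t hK _⟩).integrableOn
    · intro A hA _
      -- Second extension: for a fixed past event `A`, both sides are finite measures in the target
      -- set, namely the law of `X (s + t)` on `A` and the law of `X s` on `A` followed by the
      -- transition kernel. They agree on `C`, hence everywhere, and `f` can be integrated.
      let η : Kernel E E := ⟨fun y => (P y).map (X t), (Measure.measurable_map _ (hX t)).comp hP⟩
      have : IsMarkovKernel η := ⟨fun y => Measure.isProbabilityMeasure_map (hX t).aemeasurable⟩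
      let κ : Kernel Unit E := Kernel.const Unit (((P x).restrict A).map (X s))
      have hν : ((P x).restrict A).map (X (s + t)) = (η ∘ₖ κ) () := by
        have happ : ∀ B, MeasurableSet B → (η ∘ₖ κ) () B
            = ∫⁻ ω in A, P (X s ω) (X t ⁻¹' B) ∂(P x) := by
          intro B hB
          rw [Kernel.comp_apply' _ _ _ hB, Kernel.const_apply,
            lintegral_map (Kernel.measurable_coe _ hB) (hX s)]
          refine lintegral_congr fun ω => ?_
          exact Measure.map_apply (hX t) hB
        have e3 : ∀ B ∈ C, ((P x).restrict A).map (X (s + t)) B = (η ∘ₖ κ) () B := by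
          intro B hB
          rw [happ B (hCm B hB), Measure.map_apply (hX _) (hCm B hB),
            Measure.restrict_apply (hX _ (hCm B hB)), Set.inter_comm, step1 B hB A hA]
        exact ext_of_generate_finite C hgen hC e3 (e3 _ huniv)
      have e1 : ∫ ω in A, f (X (s + t) ω) ∂(P x) = ∫ y, f y ∂(η ∘ₖ κ) () := by
        rw [← hν, integral_map (hX _).aemeasurable hf.aestronglyMeasurable]
      refine Eq.symm (e1.trans ?_)
      rw [Kernel.integral_comp (integrable_of_abs_le hf hfb), Kernel.const_apply, integral_map
        (hX _).aemeasurable (StronglyMeasurable.integral_kernel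
          hf.stronglyMeasurable).aestronglyMeasurable]
      refine integral_congr_ae (Eventually.of_forall fun ω => ?_)
      exact integral_map (hX t).aemeasurable hf.aestronglyMeasurable
    · exact ((measurable_transition hP hX t hf).comp
        (measurable_past le_rfl)).stronglyMeasurable.aestronglyMeasurable

end IsMarkovFamily

end MarkovFamily

end Sandpile

namespace Sandpile

/-! ### Markov chains: the backward equation -/

section StepPath

variable {E F : Type*} [MeasurableSpace E] [MeasurableSpace F]

lemma measurableSpace_stepPath : (inferInstance : MeasurableSpace (StepPath E))
    = ⨆ t, MeasurableSpace.comap (StepPath.eval t) inferInstance := by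
  change MeasurableSpace.comap _ (⨆ t, _) = _
  rw [MeasurableSpace.comap_iSup]
  refine iSup_congr fun t => ?_
  rw [MeasurableSpace.comap_comp]
  rfl

lemma measurable_eval (t : ℝ≥0) : Measurable (StepPath.eval t : StepPath E → E) :=
  (measurable_pi_apply t).comp (comap_measurable _)

lemma measurable_stepPath_iff {W : Type*} [MeasurableSpace W] {f : W → StepPath E} :
    Measurable f ↔ ∀ t, Measurable fun w => (f w).eval t := by
  refine ⟨fun h t => (measurable_eval t).comp h, fun h => ?_⟩
  exact measurable_comap_iff.2 (measurable_pi_iff.2 h)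

lemma measurable_stepPath_map {g : E → F} (hg : Measurable g) : Measurable (StepPath.map g) :=
  measurable_stepPath_iff.2 fun t => hg.comp (measurable_eval t)

end StepPath

/-! ### Uniqueness of bounded solutions of the backward equation -/

section Backward

variable {E : Type*} [MeasurableSpace E] [DiscreteMeasurableSpace E]
  {J : E → Measure E} [∀ x, IsFiniteMeasure (J x)] {V : E → ℝ}

/-- The profile `v / (v + n)` increases in `v`, so a bound of this form at the new state may be
evaluated at `V x + 1`. It serves both `eq_zero_of_backward` and `eq_zero_of_le_lintegral`. -/
lemma div_add_le_div_add {a b : ℝ} (n : ℕ) (ha : 0 < a) (hab : a ≤ b) :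
    a / (a + n) ≤ b / (b + n) := by
  have hn : (0 : ℝ) ≤ n := n.cast_nonneg
  rw [div_le_div_iff₀ (by linarith) (by linarith)]
  nlinarith

lemma integrable_discrete {μ : Measure E} [IsFiniteMeasure μ] {f : E → ℝ}
    (hb : ∃ C, ∀ y, |f y| ≤ C) : Integrable f μ :=
  integrable_of_abs_le Measurable.of_discrete hb

/-- Bounded solutions of the backward equation with initial value `0` vanish. -/
theorem eq_zero_of_backward (hV : ∀ x, 0 < V x) (hJV : ∀ x, (J x).real Set.univ ≤ V x)
    (hstep : ∀ x, ∀ᵐ y ∂(J x), V y ≤ V x + 1) {D : Set E} (hD : ∀ x ∈ D, ∀ᵐ y ∂(J x), y ∈ D)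
    {w : ℝ → E → ℝ} {C : ℝ} (hw : ∀ t x, |w t x| ≤ C)
    (hc : ∀ x ∈ D, ContinuousOn (fun t => w t x) (Set.Ici 0)) (h0 : ∀ x ∈ D, w 0 x = 0)
    (hd : ∀ x ∈ D, ∀ t, 0 ≤ t → HasDerivWithinAt (fun s => w s x)
      (∫ y, (w t y - w t x) ∂(J x)) (Set.Ici t) t) :
    ∀ x ∈ D, ∀ t, 0 ≤ t → w t x = 0 := by
  -- After `k` jumps the rate is at most `V x + k`, so the Laplace transform at `1` of the time of
  -- the `n`-th jump is at most the product over `k < n` of `(V x + k) / (V x + k + 1)`, which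
  -- telescopes to `V x / (V x + n)`. Each induction step produces one factor.
  have key : ∀ n : ℕ, ∀ x ∈ D, ∀ t, 0 ≤ t → |w t x| ≤ C * Real.exp t * (V x / (V x + n)) := by
    intro n
    induction n with
    | zero =>
      intro x _ t ht
      have hC : 0 ≤ C := (abs_nonneg _).trans (hw 0 x)
      rw [Nat.cast_zero, add_zero, div_self (hV x).ne', mul_one]
      exact (hw t x).trans (le_mul_of_one_le_right hC (Real.one_le_exp ht))
    | succ n ih =>
      intro x hx T hT
      have hC : 0 ≤ C := (abs_nonneg _).trans (hw 0 x)
      have hn : (0 : ℝ) ≤ n := n.cast_nonneg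
      have hVx := hV x
      set q := (J x).real Set.univ with hq
      have hq0 : 0 ≤ q := measureReal_nonneg
      set K := C * ((V x + 1) / (V x + 1 + n)) with hK
      have hK0 : 0 ≤ K := by positivity
      -- The integrating factor `exp (q s)` cancels the loss term `-q w`. What remains is the gain
      -- term, an integral over the states after one jump, to which the induction hypothesis
      -- applies.
      have hderiv : ∀ t ∈ Set.Ico 0 T, HasDerivWithinAt (fun s => Real.exp (q * s) * w s x)
          (Real.exp (q * t) * ∫ y, w t y ∂(J x)) (Set.Ici t) t := by
        intro t ht
        have h1 : HasDerivWithinAt (fun s => Real.exp (q * s)) (Real.exp (q * t) * (q * 1))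
          (Set.Ici t) t := (((hasDerivAt_id t).const_mul q).exp).hasDerivWithinAt
        have h2 := h1.mul (hd x hx t ht.1)
        rw [integral_sub (integrable_discrete ⟨C, hw t⟩) (integrable_const _)] at h2
        refine h2.congr_deriv ?_
        simp only [integral_const, smul_eq_mul]
        ring
      have hbound : ∀ t ∈ Set.Ico 0 T, ‖Real.exp (q * t) * ∫ y, w t y ∂(J x)‖
          ≤ K * q * Real.exp ((q + 1) * t) := by
        intro t ht
        have h1 : ‖∫ y, w t y ∂(J x)‖ ≤ K * Real.exp t * q := by
          refine norm_integral_le_of_norm_le_const ?_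
          filter_upwards [hD x hx, hstep x] with y hy hVy
          refine (ih y hy t ht.1).trans ?_
          have := div_add_le_div_add n (hV y) hVy
          calc C * Real.exp t * (V y / (V y + n))
              ≤ C * Real.exp t * ((V x + 1) / (V x + 1 + n)) := by gcongr
            _ = K * Real.exp t := by rw [hK]; ring
        rw [norm_mul, Real.norm_eq_abs, abs_of_pos (Real.exp_pos _)]
        calc Real.exp (q * t) * ‖∫ y, w t y ∂(J x)‖
            ≤ Real.exp (q * t) * (K * Real.exp t * q) := by gcongr
          _ = K * q * Real.exp ((q + 1) * t) := by
            rw [show (q + 1) * t = q * t + t by ring, Real.exp_add]; ring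
      have hB : ∀ t, HasDerivAt (fun s => K * q / (q + 1) * Real.exp ((q + 1) * s))
          (K * q * Real.exp ((q + 1) * t)) t := by
        intro t
        have := (((hasDerivAt_id t).const_mul (q + 1)).exp).const_mul (K * q / (q + 1))
        refine this.congr_deriv ?_
        simp only [id_eq, mul_one]
        field_simp
      have hcont : ContinuousOn (fun s => Real.exp (q * s) * w s x) (Set.Icc 0 T) :=
        ContinuousOn.mul (by fun_prop) ((hc x hx).mono Set.Icc_subset_Ici_self)
      have hmain := image_norm_le_of_norm_deriv_right_le_deriv_boundary hcont hderiv
        (by simp only [h0 x hx, mul_zero, norm_zero]; positivity) hB hbound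
        (Set.right_mem_Icc.2 hT)
      rw [norm_mul, Real.norm_eq_abs, Real.norm_eq_abs, abs_of_pos (Real.exp_pos _),
        show (q + 1) * T = q * T + T by ring, Real.exp_add] at hmain
      have h1 : |w T x| ≤ K * q / (q + 1) * Real.exp T := by
        have hpos := Real.exp_pos (q * T)
        refine le_of_mul_le_mul_left (hmain.trans_eq ?_) hpos
        ring
      have h2 : q / (q + 1) ≤ V x / (V x + 1) := by
        rw [div_le_div_iff₀ (by positivity) (by positivity)]
        nlinarith [hJV x]
      calc |w T x| ≤ K * q / (q + 1) * Real.exp T := h1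
        _ = K * Real.exp T * (q / (q + 1)) := by ring
        _ ≤ K * Real.exp T * (V x / (V x + 1)) := by gcongr
        _ = C * Real.exp T * (V x / (V x + (n + 1 : ℕ))) := by
          rw [hK]; push_cast
          have : V x + 1 + n ≠ 0 := by positivity
          have : V x + 1 ≠ 0 := by positivity
          have : V x + (n + 1) ≠ 0 := by positivity
          field_simp
          ring
  intro x hx t ht
  have hlim : Tendsto (fun n : ℕ => C * Real.exp t * (V x / (V x + n))) atTop
      (𝓝 (C * Real.exp t * 0)) := by
    refine Tendsto.const_mul _ (tendsto_const_nhds.div_atTop ?_)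
    exact tendsto_atTop_add_const_left _ _ tendsto_natCast_atTop_atTop
  have := ge_of_tendsto' hlim fun n => key n x hx t ht
  rw [mul_zero] at this
  exact abs_eq_zero.1 (le_antisymm this (abs_nonneg _))

/-! ### The semigroup of a chain: regularity in time, intertwining, uniqueness -/

namespace IsChainWithGenerator

variable {G : (E → ℝ) → E → ℝ} {P : E → Measure (StepPath E)}

/-- By Chapman–Kolmogorov the right difference quotient at `t` is the one at `0` for the bounded
function `S(t)f`. Only a right derivative results, so the comparison argument also needs the
continuity proved next. -/
lemma transition_hasDerivWithinAt (h : IsChainWithGenerator G P) {f : E → ℝ}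
    (hf : ∃ C, ∀ y, |f y| ≤ C) (x : E) {t : ℝ} (ht : 0 ≤ t) :
    HasDerivWithinAt (fun s : ℝ => transition StepPath.eval P s.toNNReal f x)
      (G (transition StepPath.eval P t.toNNReal f) x) (Set.Ici t) t := by
  obtain ⟨C, hC⟩ := hf
  have hP : ∃ C, ∀ y, |transition StepPath.eval P t.toNNReal f y| ≤ C :=
    ⟨C, abs_transition_le h.family.prob _ hC⟩
  rw [← hasDerivWithinAt_Ioi_iff_Ici, hasDerivWithinAt_iff_tendsto_slope' (by simp)]
  have hlim : Tendsto (fun s : ℝ => (s - t).toNNReal) (𝓝[>] t) (𝓝[>] 0) := by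
    refine tendsto_nhdsWithin_iff.2 ⟨?_, ?_⟩
    · have : ContinuousWithinAt (fun s : ℝ => (s - t).toNNReal) (Set.Ioi t) t := by fun_prop
      simpa [ContinuousWithinAt] using this
    · filter_upwards [self_mem_nhdsWithin] with s hs
      simpa using hs
  refine ((h.generator _ hP x).comp hlim).congr' ?_
  filter_upwards [self_mem_nhdsWithin] with s (hs : t < s)
  have e : s.toNNReal = (s - t).toNNReal + t.toNNReal := by
    rw [← Real.toNNReal_add (by linarith) ht, sub_add_cancel]
  rw [Function.comp_apply, slope_def_field, e, h.family.transition_add measurable_eval _ _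
    Measurable.of_discrete ⟨C, hC⟩, Real.coe_toNNReal _ (by linarith)]

/-- The generator applied to the indicator of `{x}` shows that the probability `φ t` of being away
from `x` at time `t` tends to `0`. The expectation of a function bounded by `C` then changes by at
most `2 * C * φ t`, and applying this to `S(s)f` gives a modulus of continuity at every time `s`. -/
lemma transition_continuous (h : IsChainWithGenerator G P) {f : E → ℝ}
    (hf : ∃ C, ∀ y, |f y| ≤ C) (x : E) :
    Continuous fun t : ℝ≥0 => transition StepPath.eval P t f x := by
  classical
  obtain ⟨C, hC⟩ := hf
  have hC0 : 0 ≤ C := (abs_nonneg _).trans (hC x)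
  let φ : ℝ≥0 → ℝ := fun t => 1 - transition StepPath.eval P t (Set.indicator {x} 1) x
  have hφ0 : φ 0 = 0 := by simp [φ, h.family.transition_zero]
  have hφ : Tendsto φ (𝓝 0) (𝓝 0) := by
    have h1 := h.generator (Set.indicator {x} 1) ⟨1, fun y => by
      by_cases hy : y = x <;> simp [Set.indicator, hy]⟩ x
    have h2 : Tendsto (fun t : ℝ≥0 => (t : ℝ)) (𝓝[>] 0) (𝓝 0) :=
      (NNReal.continuous_coe.tendsto' 0 0 rfl).mono_left nhdsWithin_le_nhds
    have h3 : Tendsto φ (𝓝[>] 0) (𝓝 0) := by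
      have := (h1.mul h2).neg
      rw [mul_zero, neg_zero] at this
      refine this.congr' ?_
      filter_upwards [self_mem_nhdsWithin] with t ht
      have : (t : ℝ) ≠ 0 := by simpa using (ne_of_gt ht)
      simp [φ, div_mul_cancel₀ _ this]
    have h4 : (𝓝 (0 : ℝ≥0)) = 𝓝[>] 0 ⊔ pure 0 := by
      rw [← nhdsWithin_singleton, ← nhdsWithin_union]
      rw [show Set.Ioi (0 : ℝ≥0) ∪ {0} = Set.univ from ?_, nhdsWithin_univ]
      ext y
      simp
    rw [h4, tendsto_sup]
    exact ⟨h3, by rw [tendsto_pure_left, hφ0]; exact fun s hs => mem_of_mem_nhds hs⟩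
  have hbound : ∀ (g : E → ℝ), (∀ y, |g y| ≤ C) → ∀ t,
      |transition StepPath.eval P t g x - g x| ≤ 2 * C * φ t := by
    intro g hg t
    have := h.family.prob x
    have hi : ∀ (u : E → ℝ), (∃ C, ∀ y, |u y| ≤ C) →
        Integrable (fun ω : StepPath E => u (ω.eval t)) (P x) := fun u hu =>
      integrable_of_abs_le (Measurable.of_discrete.comp (measurable_eval t))
        (hu.imp fun C h ω => h _)
    have hb1 : ∃ C, ∀ y, |({x} : Set E).indicator (1 : E → ℝ) y| ≤ C := ⟨1, fun y => by
      by_cases hy : y = x <;> simp [Set.indicator, hy]⟩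
    have e1 : transition StepPath.eval P t g x - g x
        = ∫ ω, (g (ω.eval t) - g x) ∂(P x) := by
      rw [integral_sub (hi g ⟨C, hg⟩) (integrable_const _)]
      simp [transition]
    have e2 : 2 * C * φ t
        = ∫ ω : StepPath E, 2 * C * (1 - ({x} : Set E).indicator 1 (ω.eval t)) ∂(P x) := by
      rw [integral_const_mul, integral_sub (integrable_const _) (hi _ hb1)]
      simp [transition, φ]
    rw [e1, e2, ← Real.norm_eq_abs]
    refine norm_integral_le_of_norm_le (((integrable_const _).sub (hi _ hb1)).const_mul _)
      (Eventually.of_forall fun ω => ?_)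
    by_cases hω : ω.eval t = x
    · simp [hω]
    · simp only [Real.norm_eq_abs, Set.indicator, Set.mem_singleton_iff, hω, if_false]
      have := abs_sub (g (ω.eval t)) (g x)
      linarith [hg (ω.eval t), hg x]
  have hbound2 : ∀ s t : ℝ≥0, s ≤ t → |transition StepPath.eval P t f x
      - transition StepPath.eval P s f x| ≤ 2 * C * φ (nndist t s) := by
    intro s t hst
    have e : t = nndist t s + s := by
      rw [NNReal.nndist_eq, tsub_eq_zero_of_le hst, max_eq_left zero_le, tsub_add_cancel_of_le hst]
    conv_lhs => rw [e]
    rw [h.family.transition_add measurable_eval _ _ Measurable.of_discrete ⟨C, hC⟩]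
    exact hbound _ (abs_transition_le h.family.prob _ hC) _
  have hbound3 : ∀ s t : ℝ≥0, |transition StepPath.eval P t f x
      - transition StepPath.eval P s f x| ≤ 2 * C * φ (nndist t s) := by
    intro s t
    rcases le_total s t with hst | hst
    · exact hbound2 s t hst
    · rw [abs_sub_comm, nndist_comm]
      exact hbound2 t s hst
  refine continuous_iff_continuousAt.2 fun s => ?_
  rw [ContinuousAt, tendsto_iff_dist_tendsto_zero]
  refine squeeze_zero (fun _ => dist_nonneg) (fun t => hbound3 s t) ?_
  have h1 : Tendsto (fun t : ℝ≥0 => nndist t s) (𝓝 s) (𝓝 0) :=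
    (continuous_id.nndist continuous_const).tendsto' s 0 (nndist_self s)
  simpa using (hφ.comp h1).const_mul (2 * C)

variable {E' : Type*} [MeasurableSpace E'] [DiscreteMeasurableSpace E']
  {G' : (E' → ℝ) → E' → ℝ} {P' : E' → Measure (StepPath E')}

/-- The difference of the two sides is bounded, continuous in time and zero at time `0`. Since both
generators are given on `D` by the same jump measure, it solves the backward equation on `D`. -/
theorem transition_comp_eq (h : IsChainWithGenerator G P) (h' : IsChainWithGenerator G' P')
    (hV : ∀ x, 0 < V x) (hJV : ∀ x, (J x).real Set.univ ≤ V x)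
    (hstep : ∀ x, ∀ᵐ y ∂(J x), V y ≤ V x + 1) {D : Set E} (hD : ∀ x ∈ D, ∀ᵐ y ∂(J x), y ∈ D)
    (hG : ∀ f, (∃ C, ∀ y, |f y| ≤ C) → ∀ x ∈ D, G f x = ∫ y, (f y - f x) ∂(J x))
    {π : E → E'} (hG' : ∀ f, (∃ C, ∀ y, |f y| ≤ C) → ∀ x ∈ D,
      G' f (π x) = ∫ y, (f (π y) - f (π x)) ∂(J x))
    (t : ℝ≥0) {f : E' → ℝ} (hf : ∃ C, ∀ y, |f y| ≤ C) {x : E} (hx : x ∈ D) :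
    transition StepPath.eval P t (f ∘ π) x = transition StepPath.eval P' t f (π x) := by
  obtain ⟨C, hC⟩ := hf
  have hC' : ∀ y, |(f ∘ π) y| ≤ C := fun y => hC _
  let w : ℝ → E → ℝ := fun t x => transition StepPath.eval P t.toNNReal (f ∘ π) x
    - transition StepPath.eval P' t.toNNReal f (π x)
  have b1 := fun t x => abs_transition_le (X := StepPath.eval) h.family.prob t hC' x
  have b2 := fun t x => abs_transition_le (X := StepPath.eval) h'.family.prob t hC x
  have key := eq_zero_of_backward (w := w) (C := C + C) hV hJV hstep hD ?_ ?_ ?_ ?_ x hx t t.2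
  · simpa [w, sub_eq_zero] using key
  · intro t x
    refine (abs_sub _ _).trans (add_le_add (b1 _ _) (b2 _ _))
  · intro x _
    refine Continuous.continuousOn (Continuous.sub ?_ ?_)
    · exact (h.transition_continuous ⟨C, hC'⟩ x).comp continuous_real_toNNReal
    · exact (h'.transition_continuous ⟨C, hC⟩ (π x)).comp continuous_real_toNNReal
  · intro x _
    simp [w, h.family.transition_zero, h'.family.transition_zero]
  · intro x hx t ht
    have h1 := (h.transition_hasDerivWithinAt ⟨C, hC'⟩ x ht).sub
      (h'.transition_hasDerivWithinAt ⟨C, hC⟩ (π x) ht)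
    rw [hG _ ⟨C, b1 _⟩ x hx, hG' _ ⟨C, b2 _⟩ x hx, ← integral_sub] at h1
    · refine h1.congr_deriv ?_
      refine integral_congr_ae (Eventually.of_forall fun y => ?_)
      simp only [w]
      ring
    · exact (integrable_discrete ⟨C, b1 _⟩).sub (integrable_const _)
    · exact (integrable_discrete ⟨C, fun y => b2 _ (π y)⟩).sub (integrable_const _)

/-- For `D` closed under jumps, `S(t)1_D - 1` solves the backward equation on `D` with initial value
`0`. -/
theorem ae_mem (h : IsChainWithGenerator G P)
    (hV : ∀ x, 0 < V x) (hJV : ∀ x, (J x).real Set.univ ≤ V x)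
    (hstep : ∀ x, ∀ᵐ y ∂(J x), V y ≤ V x + 1) {D : Set E} (hD : ∀ x ∈ D, ∀ᵐ y ∂(J x), y ∈ D)
    (hG : ∀ f, (∃ C, ∀ y, |f y| ≤ C) → ∀ x ∈ D, G f x = ∫ y, (f y - f x) ∂(J x))
    {x : E} (hx : x ∈ D) (t : ℝ≥0) : ∀ᵐ ω ∂(P x), ω.eval t ∈ D := by
  classical
  have := h.family.prob x
  let f : E → ℝ := D.indicator 1
  have hC : ∀ y, |f y| ≤ 1 := fun y => by by_cases hy : y ∈ D <;> simp [f, hy]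
  let w : ℝ → E → ℝ := fun t x => transition StepPath.eval P t.toNNReal f x - 1
  have b1 := fun t x => abs_transition_le (X := StepPath.eval) h.family.prob t hC x
  have key := eq_zero_of_backward (w := w) (C := 1 + 1) hV hJV hstep hD ?_ ?_ ?_ ?_ x hx t t.2
  · have h1 : ∫ ω : StepPath E, f (ω.eval t) ∂(P x) = 1 := by
      simpa [w, sub_eq_zero, transition] using key
    have hm : MeasurableSet (StepPath.eval t ⁻¹' D : Set (StepPath E)) :=
      measurable_eval t (MeasurableSet.of_discrete)
    have h2 : (P x).real (StepPath.eval t ⁻¹' D : Set (StepPath E)) = 1 := by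
      rw [← integral_indicator_one hm, ← h1]
      rfl
    have h3 : P x (StepPath.eval t ⁻¹' D : Set (StepPath E)) = 1 := by
      rw [measureReal_def, ENNReal.toReal_eq_one_iff] at h2
      exact h2
    exact (prob_compl_eq_zero_iff hm).2 h3
  · intro t x
    refine (abs_sub _ _).trans (add_le_add (b1 _ _) (by simp))
  · intro x _
    refine Continuous.continuousOn (Continuous.sub ?_ continuous_const)
    exact (h.transition_continuous ⟨1, hC⟩ x).comp continuous_real_toNNReal
  · intro x hx
    simp [w, h.family.transition_zero, f, hx]
  · intro x hx t ht
    have h1 := (h.transition_hasDerivWithinAt ⟨1, hC⟩ x ht).sub_const 1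
    rw [hG _ ⟨1, b1 _⟩ x hx] at h1
    refine h1.congr_deriv ?_
    refine integral_congr_ae (Eventually.of_forall fun y => ?_)
    simp only [w]
    ring

/-- A chain is mapped to a chain by `π` if the generators are intertwined by `π` on a closed
set. -/
theorem map_eq (h : IsChainWithGenerator G P) (h' : IsChainWithGenerator G' P')
    (hV : ∀ x, 0 < V x) (hJV : ∀ x, (J x).real Set.univ ≤ V x)
    (hstep : ∀ x, ∀ᵐ y ∂(J x), V y ≤ V x + 1) {D : Set E} (hD : ∀ x ∈ D, ∀ᵐ y ∂(J x), y ∈ D)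
    (hG : ∀ f, (∃ C, ∀ y, |f y| ≤ C) → ∀ x ∈ D, G f x = ∫ y, (f y - f x) ∂(J x))
    {π : E → E'} (hG' : ∀ f, (∃ C, ∀ y, |f y| ≤ C) → ∀ x ∈ D,
      G' f (π x) = ∫ y, (f (π y) - f (π x)) ∂(J x)) {x : E} (hx : x ∈ D) :
    (P x).map (StepPath.map π) = P' (π x) :=
  h.family.map_eq measurable_eval h'.family measurable_eval Measurable.of_discrete
    (fun _ hx t => h.ae_mem hV hJV hstep hD hG hx t)
    (fun t _ _ hf _ hx => h.transition_comp_eq h' hV hJV hstep hD hG hG' t hf hx)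
    measurableSpace_stepPath (measurable_stepPath_map Measurable.of_discrete) (fun _ _ => rfl) hx

/-- This is `map_eq` for the identity map and the full state space. -/
theorem unique {P₁ P₂ : E → Measure (StepPath E)} (h₁ : IsChainWithGenerator G P₁)
    (h₂ : IsChainWithGenerator G P₂)
    (hV : ∀ x, 0 < V x) (hJV : ∀ x, (J x).real Set.univ ≤ V x)
    (hstep : ∀ x, ∀ᵐ y ∂(J x), V y ≤ V x + 1)
    (hG : ∀ f, (∃ C, ∀ y, |f y| ≤ C) → ∀ x, G f x = ∫ y, (f y - f x) ∂(J x)) : P₁ = P₂ := by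
  funext x
  have := h₁.map_eq h₂ hV hJV hstep (D := Set.univ) (by simp) (fun f hf x _ => hG f hf x)
    (π := id) (fun f hf x _ => hG f hf x) (Set.mem_univ x)
  rwa [show (StepPath.map id : StepPath E → StepPath E) = id from rfl, Measure.map_id] at this

end IsChainWithGenerator

end Backward

end Sandpile

namespace Sandpile

/-! ### Exponential waiting times -/

section Exponential

open ProbabilityTheory

/-- The exponential distribution with rate `q` as a law on `[0,∞)`. -/
noncomputable def expLaw (q : ℝ) : Measure ℝ≥0 := (expMeasure q).map Real.toNNReal

lemma isProbabilityMeasure_expLaw {q : ℝ} (hq : 0 < q) : IsProbabilityMeasure (expLaw q) :=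
  have := isProbabilityMeasure_expMeasure hq
  Measure.isProbabilityMeasure_map measurable_real_toNNReal.aemeasurable

lemma expLaw_Ioi {q : ℝ} (hq : 0 < q) (t : ℝ≥0) :
    expLaw q (Set.Ioi t) = ENNReal.ofReal (Real.exp (-(q * t))) := by
  have := isProbabilityMeasure_expMeasure hq
  have h1 : Real.toNNReal ⁻¹' Set.Ioi t = (Set.Iic (t : ℝ))ᶜ := by
    ext x
    simp [Real.lt_toNNReal_iff_coe_lt]
  have h2 := cdf_expMeasure_eq hq t
  rw [if_pos t.coe_nonneg, cdf_eq_real] at h2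
  rw [expLaw, Measure.map_apply measurable_real_toNNReal measurableSet_Ioi, h1,
    ← ofReal_measureReal, probReal_compl_eq_one_sub measurableSet_Iic, h2]
  congr 1
  ring

/-- Tilting by `exp (-t)` turns the density of rate `q` into `q / (q + 1)` times the density of rate
`q + 1`. -/
lemma lintegral_exp_neg_expLaw {q : ℝ} (hq : 0 < q) :
    ∫⁻ t, ENNReal.ofReal (Real.exp (-(t : ℝ))) ∂(expLaw q) = ENNReal.ofReal (q / (q + 1)) := by
  rw [expLaw, lintegral_map (by fun_prop) measurable_real_toNNReal, expMeasure, gammaMeasure,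
    lintegral_withDensity_eq_lintegral_mul _ (f := gammaPDF 1 q)
      (measurable_gammaPDFReal 1 q).ennreal_ofReal (by fun_prop)]
  have : ∀ x : ℝ, (gammaPDF 1 q * fun a : ℝ => ENNReal.ofReal (Real.exp (-(a.toNNReal : ℝ)))) x
      = ENNReal.ofReal (q / (q + 1)) * exponentialPDF (q + 1) x := by
    intro x
    change exponentialPDF q x * _ = _
    rw [exponentialPDF_eq, exponentialPDF_eq, ← ENNReal.ofReal_mul (by split_ifs <;> positivity),
      ← ENNReal.ofReal_mul (by positivity)]
    congr 1
    split_ifs with hx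
    · rw [Real.coe_toNNReal _ hx, mul_assoc, ← Real.exp_add]
      field_simp
      congr 1
      ring
    · simp
  simp_rw [this]
  rw [lintegral_const_mul _ (show Measurable (exponentialPDF (q + 1)) from
      (measurable_exponentialPDFReal _).ennreal_ofReal),
    lintegral_exponentialPDF_eq_one (by linarith), mul_one]

/-- The exponential law has no memory. -/
lemma expLaw_restrict_map {q : ℝ} (hq : 0 < q) (s : ℝ≥0) :
    ((expLaw q).restrict (Set.Ioi s)).map (fun t => t - s)
      = ENNReal.ofReal (Real.exp (-(q * s))) • expLaw q := by
  have := isProbabilityMeasure_expLaw hq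
  have hm : Measurable fun t : ℝ≥0 => t - s := by fun_prop
  have key : ∀ t : ℝ≥0, ((expLaw q).restrict (Set.Ioi s)).map (fun t => t - s) (Set.Ioi t)
      = (ENNReal.ofReal (Real.exp (-(q * s))) • expLaw q) (Set.Ioi t) := by
    intro t
    rw [Measure.map_apply hm measurableSet_Ioi, Measure.restrict_apply (hm measurableSet_Ioi)]
    have : (fun t : ℝ≥0 => t - s) ⁻¹' Set.Ioi t ∩ Set.Ioi s = Set.Ioi (t + s) := by
      ext x
      simp only [Set.mem_inter_iff, Set.mem_preimage, Set.mem_Ioi, lt_tsub_iff_right]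
      exact ⟨fun h => h.1, fun h => ⟨h, lt_of_le_of_lt le_add_self h⟩⟩
    rw [this, Measure.smul_apply, expLaw_Ioi hq, expLaw_Ioi hq, smul_eq_mul,
      ← ENNReal.ofReal_mul (Real.exp_pos _).le, ← Real.exp_add]
    congr 2
    push_cast
    ring
  have huniv : ((expLaw q).restrict (Set.Ioi s)).map (fun t => t - s) Set.univ
      = (ENNReal.ofReal (Real.exp (-(q * s))) • expLaw q) Set.univ := by
    rw [Measure.map_apply hm MeasurableSet.univ, Set.preimage_univ, Measure.restrict_apply_univ,
      expLaw_Ioi hq]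
    simp
  refine ext_of_generate_finite (Set.range Set.Ioi) ?_ ?_ ?_ huniv
  · exact (BorelSpace.measurable_eq).trans (borel_eq_generateFrom_Ioi ℝ≥0)
  · rw [← Set.image_univ]
    exact isPiSystem_image_Ioi Set.univ
  · rintro _ ⟨t, rfl⟩
    exact key t

end Exponential

/-! ### A sequence of independent identically distributed random variables -/

/-- Prepending an independent sample to an i.i.d. sequence reproduces its law, as is checked on
boxes; splitting off the head inverts prepending. -/
lemma infinitePi_map_head_tail {S : Type*} [MeasurableSpace S] (μ : Measure S)
    [IsProbabilityMeasure μ] :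
    (Measure.infinitePi fun _ : ℕ => μ).map (fun u => (u 0, fun k => u (k + 1)))
      = μ.prod (Measure.infinitePi fun _ : ℕ => μ) := by
  set ν := Measure.infinitePi fun _ : ℕ => μ
  let c : S × (ℕ → S) → ℕ → S := fun p n => Nat.casesOn n p.1 p.2
  have hc : Measurable c := by
    refine measurable_pi_iff.2 fun n => ?_
    cases n with
    | zero => exact measurable_fst
    | succ n => exact (measurable_pi_apply n).comp measurable_snd
  have hcν : (μ.prod ν).map c = ν := by
    refine Measure.eq_infinitePi _ fun s t ht => ?_
    classical
    -- Padding with the full space outside `s` lets the box be indexed by an initial segment of the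
    -- integers, whose first factor can be separated from the shifted rest.
    let t' : ℕ → Set S := fun n => if n ∈ s then t n else Set.univ
    have ht' : ∀ n, MeasurableSet (t' n) := fun n => by
      by_cases h : n ∈ s <;> simp [t', h, ht]
    obtain ⟨N, hN⟩ : ∃ N, s ⊆ Finset.range (N + 1) := by
      obtain ⟨N, hN⟩ := s.exists_nat_subset_range
      exact ⟨N, hN.trans (Finset.range_mono N.le_succ)⟩
    have h1 : c ⁻¹' (Set.pi s t) = t' 0 ×ˢ (Set.pi (Finset.range N) fun n => t' (n + 1)) := by
      ext p
      simp only [Set.mem_preimage, Set.mem_pi, Set.mem_prod, Finset.mem_coe, Finset.mem_range]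
      constructor
      · intro h
        refine ⟨?_, fun n _ => ?_⟩
        · by_cases h0 : 0 ∈ s
          · simpa [t', h0, c] using h 0 h0
          · simp [t', h0]
        · by_cases h0 : n + 1 ∈ s
          · simpa [t', h0] using h (n + 1) h0
          · simp [t', h0]
      · rintro ⟨h0, h⟩ n hn
        cases n with
        | zero => simpa [t', hn, c] using h0
        | succ n =>
          have := h n (by simpa using hN hn)
          simpa [t', hn] using this
    rw [Measure.map_apply hc (MeasurableSet.pi s.countable_toSet fun i _ => ht i), h1,
      Measure.prod_prod, Measure.infinitePi_pi _ (fun i _ => ht' _)]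
    have h2 : ∏ i ∈ s, μ (t i) = ∏ i ∈ Finset.range (N + 1), μ (t' i) := by
      rw [← Finset.prod_subset hN (f := fun i => μ (t' i))]
      · exact Finset.prod_congr rfl fun i hi => by simp [t', hi]
      · intro i _ hi
        simp [t', hi]
    rw [h2, Finset.prod_range_succ']
    exact mul_comm _ _
  have hs : Measurable fun u : ℕ → S => (u 0, fun k => u (k + 1)) := by fun_prop
  conv_lhs => rw [← hcν]
  rw [Measure.map_map hs hc]
  exact Measure.map_id

end Sandpile

namespace Sandpile

/-! ### Construction of Markov chains from exponential waiting times -/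

section Construction

variable {E : Type*}

/-- The noise: for every step and every state a waiting time and a target. -/
abbrev Noise (E : Type*) : Type _ := ℕ → E → ℝ≥0 × E

/-- The noise without its first step. -/
def Noise.tail (u : Noise E) : Noise E := fun k => u (k + 1)

/-- The time of the `n`-th jump. -/
def jumpTime : ℕ → E → Noise E → ℝ≥0
  | 0, _, _ => 0
  | n + 1, x, u => (u 0 x).1 + jumpTime n (u 0 x).2 u.tail

/-- The path with only the first `n` jumps. -/
noncomputable def truncPath : ℕ → E → Noise E → ℝ≥0 → E
  | 0, x, _, _ => x
  | n + 1, x, u, t =>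
    if t < (u 0 x).1 then x else truncPath n (u 0 x).2 u.tail (t - (u 0 x).1)

/-- Jumps after the `n`-th do not affect the path before it, so `noisePath` does not depend on the
number of jumps at which it is cut off. -/
lemma truncPath_eq {m n : ℕ} (hmn : n ≤ m) : ∀ {x : E} {u : Noise E} {t : ℝ≥0},
    t < jumpTime n x u → truncPath m x u t = truncPath n x u t := by
  induction n generalizing m with
  | zero => intro x u t h; exact absurd h (by simp [jumpTime])
  | succ n ih =>
    intro x u t h
    obtain ⟨m, rfl⟩ : ∃ m', m = m' + 1 := ⟨m - 1, by omega⟩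
    rw [truncPath, truncPath]
    split_ifs with ht
    · rfl
    · refine ih (by omega) ?_
      rw [jumpTime] at h
      rwa [tsub_lt_iff_left (not_lt.1 ht)]

lemma truncPath_rightCont (n : ℕ) : ∀ (x : E) (u : Noise E) (t : ℝ≥0),
    ∀ᶠ s in 𝓝[>] t, truncPath n x u s = truncPath n x u t := by
  induction n with
  | zero => intro x u t; exact Eventually.of_forall fun _ => rfl
  | succ n ih =>
    intro x u t
    by_cases ht : t < (u 0 x).1
    · filter_upwards [nhdsWithin_le_nhds (Iio_mem_nhds ht)] with s (hs : s < _)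
      rw [truncPath, truncPath, if_pos ht, if_pos hs]
    · have hlim : Tendsto (fun s : ℝ≥0 => s - (u 0 x).1) (𝓝[>] t) (𝓝[>] (t - (u 0 x).1)) := by
        refine tendsto_nhdsWithin_iff.2 ⟨?_, ?_⟩
        · exact ((by fun_prop : Continuous fun s : ℝ≥0 => s - (u 0 x).1).tendsto t).mono_left
            nhdsWithin_le_nhds
        · filter_upwards [self_mem_nhdsWithin] with s (hs : t < s)
          exact tsub_lt_tsub_right_of_le (not_lt.1 ht) hs
      filter_upwards [hlim.eventually (ih (u 0 x).2 u.tail (t - (u 0 x).1)),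
        self_mem_nhdsWithin] with s hs (hts : t < s)
      rw [truncPath, truncPath, if_neg ht, if_neg fun h => ht (hts.trans h), hs]

lemma truncPath_leftLim (n : ℕ) : ∀ (x : E) (u : Noise E) (t : ℝ≥0),
    ∃ y, ∀ᶠ s in 𝓝[<] t, truncPath n x u s = y := by
  induction n with
  | zero => intro x u t; exact ⟨x, Eventually.of_forall fun _ => rfl⟩
  | succ n ih =>
    intro x u t
    by_cases ht : t ≤ (u 0 x).1
    · refine ⟨x, ?_⟩
      filter_upwards [self_mem_nhdsWithin] with s (hs : s < t)
      rw [truncPath, if_pos (hs.trans_le ht)]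
    · obtain ⟨y, hy⟩ := ih (u 0 x).2 u.tail (t - (u 0 x).1)
      refine ⟨y, ?_⟩
      push Not at ht
      have hlim : Tendsto (fun s : ℝ≥0 => s - (u 0 x).1) (𝓝[<] t) (𝓝[<] (t - (u 0 x).1)) := by
        refine tendsto_nhdsWithin_iff.2 ⟨?_, ?_⟩
        · exact ((by fun_prop : Continuous fun s : ℝ≥0 => s - (u 0 x).1).tendsto t).mono_left
            nhdsWithin_le_nhds
        · filter_upwards [self_mem_nhdsWithin, nhdsWithin_le_nhds (Ioi_mem_nhds ht)]
            with s (hs : s < t) (hs' : (u 0 x).1 < s)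
          exact tsub_lt_tsub_right_of_le hs'.le hs
      filter_upwards [hlim.eventually hy, nhdsWithin_le_nhds (Ioi_mem_nhds ht)]
        with s hs (hs' : (u 0 x).1 < s)
      rw [truncPath, if_neg (not_lt.2 hs'.le), hs]

open Classical in
/-- The path with waiting times and targets given by the noise. -/
noncomputable def noisePath (x : E) (u : Noise E) (t : ℝ≥0) : E :=
  if h : ∃ n, t < jumpTime n x u then truncPath (Nat.find h) x u t else x

/-- There are finitely many jumps in bounded time. -/
def NonExplosive (x : E) (u : Noise E) : Prop := ∀ t : ℝ≥0, ∃ n, t < jumpTime n x u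

lemma noisePath_eq {x : E} {u : Noise E} {t : ℝ≥0} {n : ℕ} (h : t < jumpTime n x u) :
    noisePath x u t = truncPath n x u t := by
  classical
  have h' : ∃ n, t < jumpTime n x u := ⟨n, h⟩
  rw [noisePath, dif_pos h']
  exact (truncPath_eq (Nat.find_min' h' h) (Nat.find_spec h')).symm

/-- The path after the first jump, as a function of the first jump `p` and the remaining noise. -/
noncomputable def afterJump (x : E) (p : ℝ≥0 × E) (u : Noise E) (t : ℝ≥0) : E :=
  if t < p.1 then x else noisePath p.2 u (t - p.1)

lemma noisePath_eq_afterJump {x : E} {u : Noise E} (hu : NonExplosive x u) (t : ℝ≥0) :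
    noisePath x u t = afterJump x (u 0 x) u.tail t := by
  obtain ⟨n, hn⟩ := hu t
  cases n with
  | zero => exact absurd hn (by simp [jumpTime])
  | succ n =>
    rw [noisePath_eq hn, truncPath, afterJump]
    split_ifs with ht
    · rfl
    · rw [noisePath_eq (n := n)]
      rw [jumpTime] at hn
      rwa [tsub_lt_iff_left (not_lt.1 ht)]

open Classical in
/-- The random step path. -/
noncomputable def noiseStepPath (x : E) (u : Noise E) : StepPath E :=
  -- Explosive noise gets the constant path as a default value, which makes the map total;
  -- `ae_nonExplosive` shows that this case has probability zero.
  ⟨if NonExplosive x u then noisePath x u else fun _ => x, by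
    split_ifs with h
    · refine ⟨fun t => ?_, fun t _ => ?_⟩
      · obtain ⟨n, hn⟩ := h t
        filter_upwards [truncPath_rightCont n x u t, nhdsWithin_le_nhds (Iio_mem_nhds hn)]
          with s hs (hs' : s < _)
        rw [noisePath_eq hn, noisePath_eq hs', hs]
      · obtain ⟨n, hn⟩ := h t
        obtain ⟨y, hy⟩ := truncPath_leftLim n x u t
        refine ⟨y, ?_⟩
        filter_upwards [hy, self_mem_nhdsWithin] with s hs (hs' : s < t)
        rw [noisePath_eq (hs'.trans hn), hs]
    · exact ⟨fun _ => Eventually.of_forall fun _ => rfl,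
        fun _ _ => ⟨x, Eventually.of_forall fun _ => rfl⟩⟩⟩

open Classical in
lemma eval_noiseStepPath (x : E) (u : Noise E) (t : ℝ≥0) :
    (noiseStepPath x u).eval t = if NonExplosive x u then noisePath x u t else x := by
  by_cases h : NonExplosive x u <;> simp [noiseStepPath, StepPath.eval, h]

/-! ### Measurability of the path in the noise -/

variable [MeasurableSpace E] [DiscreteMeasurableSpace E] [Countable E]

lemma measurable_tail : Measurable (Noise.tail : Noise E → Noise E) :=
  measurable_pi_iff.2 fun n => measurable_pi_apply (n + 1)

lemma measurable_head : Measurable fun p : E × Noise E => p.2 0 p.1 :=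
  measurable_from_prod_countable_right fun x =>
    (measurable_pi_apply x).comp (measurable_pi_apply 0)

lemma measurable_jumpTime (n : ℕ) : Measurable fun p : E × Noise E => jumpTime n p.1 p.2 := by
  induction n with
  | zero => exact measurable_const
  | succ n ih =>
    refine measurable_head.fst.add ?_
    exact ih.comp (measurable_head.snd.prodMk (measurable_tail.comp measurable_snd))

lemma measurable_truncPath (n : ℕ) :
    Measurable fun p : E × Noise E × ℝ≥0 => truncPath n p.1 p.2.1 p.2.2 := by
  induction n with
  | zero => exact measurable_fst
  | succ n ih =>
    have hh : Measurable fun p : E × Noise E × ℝ≥0 => p.2.1 0 p.1 :=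
      measurable_head.comp (measurable_fst.prodMk measurable_snd.fst)
    refine Measurable.ite (measurableSet_lt measurable_snd.snd hh.fst) measurable_fst ?_
    exact ih.comp (hh.snd.prodMk ((measurable_tail.comp measurable_snd.fst).prodMk
      (measurable_snd.snd.sub hh.fst)))

/-- The state space is countable, so fibres suffice. On the event that `t` precedes the `n`-th jump
the path is `truncPath n`; where no `n` works it has the default value, the starting point. -/
lemma measurable_noisePath : Measurable fun p : E × Noise E × ℝ≥0 => noisePath p.1 p.2.1 p.2.2 := by
  refine measurable_to_countable' fun z => ?_
  have hT : ∀ n, Measurable fun p : E × Noise E × ℝ≥0 => jumpTime n p.1 p.2.1 := fun n =>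
    (measurable_jumpTime n).comp (measurable_fst.prodMk measurable_snd.fst)
  have : (fun p : E × Noise E × ℝ≥0 => noisePath p.1 p.2.1 p.2.2) ⁻¹' {z}
      = (⋃ n, {p | p.2.2 < jumpTime n p.1 p.2.1} ∩ {p | truncPath n p.1 p.2.1 p.2.2 = z})
        ∪ ((⋂ n, {p | jumpTime n p.1 p.2.1 ≤ p.2.2}) ∩ {p | p.1 = z}) := by
    ext p
    simp only [Set.mem_preimage, Set.mem_singleton_iff, Set.mem_union, Set.mem_iUnion,
      Set.mem_inter_iff, Set.mem_ofPred_eq, Set.mem_iInter]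
    by_cases h : ∃ n, p.2.2 < jumpTime n p.1 p.2.1
    · obtain ⟨n, hn⟩ := h
      constructor
      · intro hz
        exact Or.inl ⟨n, hn, by rw [← noisePath_eq hn, hz]⟩
      · rintro (⟨m, hm, hz⟩ | ⟨hm, -⟩)
        · rw [noisePath_eq hm, hz]
        · exact absurd hn (not_lt.2 (hm n))
    · rw [noisePath, dif_neg h]
      push Not at h
      constructor
      · exact fun hz => Or.inr ⟨h, hz⟩
      · rintro (⟨m, hm, hz⟩ | ⟨-, hz⟩)
        · exact absurd hm (not_lt.2 (h m))
        · exact hz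
  rw [this]
  refine MeasurableSet.union (MeasurableSet.iUnion fun n => ?_) (MeasurableSet.inter
    (MeasurableSet.iInter fun n => ?_) ?_)
  · exact (measurableSet_lt measurable_snd.snd (hT n)).inter
      (measurable_truncPath n (measurableSet_singleton z))
  · exact measurableSet_le (hT n) measurable_snd.snd
  · exact measurable_fst (measurableSet_singleton z)

lemma measurable_afterJump (x : E) (t : ℝ≥0) :
    Measurable fun p : (ℝ≥0 × E) × Noise E => afterJump x p.1 p.2 t := by
  refine Measurable.ite (measurableSet_lt measurable_const measurable_fst.fst) measurable_const ?_
  exact measurable_noisePath.comp (measurable_fst.snd.prodMk (measurable_snd.prodMk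
    (measurable_const.sub measurable_fst.fst)))

lemma measurableSet_nonExplosive (x : E) : MeasurableSet {u : Noise E | NonExplosive x u} := by
  have : {u : Noise E | NonExplosive x u} = ⋂ k : ℕ, ⋃ n, {u | (k : ℝ≥0) < jumpTime n x u} := by
    ext u
    simp only [NonExplosive, Set.mem_ofPred_eq, Set.mem_iInter, Set.mem_iUnion]
    refine ⟨fun h k => h k, fun h t => ?_⟩
    obtain ⟨k, hk⟩ := exists_nat_gt t
    exact (h k).imp fun n hn => hk.trans hn
  rw [this]
  exact MeasurableSet.iInter fun k => MeasurableSet.iUnion fun n =>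
    measurableSet_lt measurable_const ((measurable_jumpTime n).comp measurable_prodMk_left)

lemma measurable_noiseStepPath (x : E) : Measurable (noiseStepPath x : Noise E → StepPath E) := by
  classical
  refine measurable_stepPath_iff.2 fun t => ?_
  simp_rw [eval_noiseStepPath]
  exact Measurable.ite (measurableSet_nonExplosive x)
    (measurable_noisePath.comp (measurable_const.prodMk (measurable_id.prodMk measurable_const)))
    measurable_const

/-! ### Law of the noise and absence of explosion -/

variable (J : E → Measure E) [∀ x, IsFiniteMeasure (J x)]

/-- The joint law of the waiting time in `x` and the state after it. -/
noncomputable def jumpLaw (x : E) : Measure (ℝ≥0 × E) :=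
  (expLaw ((J x).real Set.univ)).prod ((J x Set.univ)⁻¹ • J x)

/-- The law of the noise. -/
noncomputable def noiseLaw : Measure (Noise E) :=
  Measure.infinitePi fun _ : ℕ => Measure.infinitePi (jumpLaw J)

variable [hJ : ∀ x, NeZero (J x)]

lemma rate_pos (x : E) : 0 < (J x).real Set.univ := by
  rw [measureReal_def]
  exact ENNReal.toReal_pos (by simpa using (hJ x).out) (measure_ne_top _ _)

instance isProbabilityMeasure_jumpTarget (x : E) :
    IsProbabilityMeasure ((J x Set.univ)⁻¹ • J x) :=
  isProbabilityMeasureSMul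

instance isProbabilityMeasure_jumpLaw (x : E) : IsProbabilityMeasure (jumpLaw J x) := by
  have := isProbabilityMeasure_expLaw (rate_pos J x)
  unfold jumpLaw
  infer_instance

instance isProbabilityMeasure_noiseLaw : IsProbabilityMeasure (noiseLaw J) := by
  unfold noiseLaw
  infer_instance

/-- Renewal at the first jump: of the first row only the entry at the current state is used. It is
independent of the remaining rows, which have the law of the whole noise. -/
lemma noiseLaw_map (x : E) :
    (noiseLaw J).map (fun u => (u 0 x, u.tail)) = (jumpLaw J x).prod (noiseLaw J) := by
  have h1 := infinitePi_map_head_tail (Measure.infinitePi (jumpLaw J))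
  have h2 : (fun u : Noise E => (u 0 x, u.tail))
      = Prod.map (fun v : E → ℝ≥0 × E => v x) id ∘ fun u => (u 0, fun k => u (k + 1)) := rfl
  rw [h2, ← Measure.map_map (by fun_prop) (by fun_prop), noiseLaw, h1,
    ← Measure.map_prod_map _ _ (by fun_prop) measurable_id, Measure.map_id,
    Measure.infinitePi_map_eval]

lemma measurable_head_tail (x : E) : Measurable fun u : Noise E => (u 0 x, u.tail) :=
  ((measurable_pi_apply x).comp (measurable_pi_apply 0)).prodMk measurable_tail

lemma integral_noiseLaw_eq (x : E) {F : (ℝ≥0 × E) × Noise E → ℝ} (hF : Measurable F)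
    (hb : ∃ C, ∀ p, |F p| ≤ C) :
    ∫ u, F (u 0 x, u.tail) ∂(noiseLaw J) = ∫ p, ∫ u, F (p, u) ∂(noiseLaw J) ∂(jumpLaw J x) := by
  rw [← integral_prod _ (integrable_of_abs_le hF hb), ← noiseLaw_map,
    integral_map (measurable_head_tail x).aemeasurable hF.aestronglyMeasurable]

lemma measure_noiseLaw_eq (x : E) {A : Set ((ℝ≥0 × E) × Noise E)} (hA : MeasurableSet A) :
    noiseLaw J {u | (u 0 x, u.tail) ∈ A}
      = ∫⁻ p, noiseLaw J {u | (p, u) ∈ A} ∂(jumpLaw J x) := by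
  have := Measure.prod_apply (μ := jumpLaw J x) (ν := noiseLaw J) hA
  rw [← noiseLaw_map, Measure.map_apply (measurable_head_tail x) hA] at this
  exact this

lemma jumpLaw_ae_snd (x : E) {p : E → Prop} (h : ∀ᵐ y ∂(J x), p y) :
    ∀ᵐ z ∂(jumpLaw J x), p z.2 := by
  have := isProbabilityMeasure_expLaw (rate_pos J x)
  have h2 : ∀ᵐ y ∂((J x Set.univ)⁻¹ • J x), p y := Measure.ae_smul_measure h _
  exact Measure.quasiMeasurePreserving_snd.ae h2

/-- Memorylessness of the waiting time, carried over to the pair because the target is independent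
of the waiting time. -/
lemma jumpLaw_map_sub (x : E) (s : ℝ≥0) :
    ((jumpLaw J x).restrict {p | s < p.1}).map (fun p => (p.1 - s, p.2))
      = ENNReal.ofReal (Real.exp (-((J x).real Set.univ * s))) • jumpLaw J x := by
  have := isProbabilityMeasure_expLaw (rate_pos J x)
  have h1 : {p : ℝ≥0 × E | s < p.1} = Set.Ioi s ×ˢ Set.univ := by ext; simp
  rw [h1, jumpLaw, ← Measure.restrict_prod_eq_prod_univ]
  have h2 := Measure.map_prod_map ((expLaw ((J x).real Set.univ)).restrict (Set.Ioi s))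
    ((J x Set.univ)⁻¹ • J x) (f := fun t => t - s) (g := id) (by fun_prop) measurable_id
  rw [Measure.map_id] at h2
  refine h2.symm.trans ?_
  rw [expLaw_restrict_map (rate_pos J x), Measure.prod_smul_left]

variable {J} {V : E → ℝ}

/-- A bounded function which is dominated by its expectation after the first jump, before time
`t`, vanishes. -/
lemma eq_zero_of_le_lintegral (hV : ∀ x, 0 < V x) (hJV : ∀ x, (J x).real Set.univ ≤ V x)
    (hstep : ∀ x, ∀ᵐ y ∂(J x), V y ≤ V x + 1) {b : ℝ≥0 → E → ENNReal} {C : ℝ} (hC : 0 ≤ C)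
    (hb : ∀ t x, b t x ≤ ENNReal.ofReal C)
    (hrec : ∀ t x, b t x ≤ ∫⁻ p in {p | p.1 ≤ t}, b (t - p.1) p.2 ∂(jumpLaw J x))
    (t : ℝ≥0) (x : E) : b t x = 0 := by
  -- The telescoping bound of `eq_zero_of_backward` in integral form: the factor `q / (q + 1)` is
  -- now the Laplace transform of the first waiting time.
  have key : ∀ n : ℕ, ∀ t x, b t x ≤ ENNReal.ofReal (C * Real.exp t * (V x / (V x + n))) := by
    intro n
    induction n with
    | zero =>
      intro t x
      rw [Nat.cast_zero, add_zero, div_self (hV x).ne', mul_one]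
      refine (hb t x).trans (ENNReal.ofReal_le_ofReal ?_)
      exact le_mul_of_one_le_right hC (Real.one_le_exp t.2)
    | succ n ih =>
      intro t x
      have hVx := hV x
      have hq := rate_pos J x
      have := isProbabilityMeasure_expLaw hq
      set q := (J x).real Set.univ with hqdef
      have hn : (0 : ℝ) ≤ n := n.cast_nonneg
      set K := C * Real.exp t * ((V x + 1) / (V x + 1 + n)) with hK
      have hK0 : 0 ≤ K := by positivity
      calc b t x ≤ ∫⁻ p in {p | p.1 ≤ t}, b (t - p.1) p.2 ∂(jumpLaw J x) := hrec t x
        _ ≤ ∫⁻ p in {p | p.1 ≤ t}, ENNReal.ofReal K * ENNReal.ofReal (Real.exp (-(p.1 : ℝ)))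
              ∂(jumpLaw J x) := by
          refine setLIntegral_mono_ae (by fun_prop) ?_
          filter_upwards [jumpLaw_ae_snd J x (hstep x)] with p hp hpt
          refine (ih _ _).trans ?_
          rw [← ENNReal.ofReal_mul hK0]
          refine ENNReal.ofReal_le_ofReal ?_
          have h1 := div_add_le_div_add n (hV p.2) hp
          have h2 : Real.exp ((t - p.1 : ℝ≥0) : ℝ) = Real.exp t * Real.exp (-(p.1 : ℝ)) := by
            rw [NNReal.coe_sub hpt, ← Real.exp_add, sub_eq_add_neg]
          rw [h2]
          calc C * (Real.exp t * Real.exp (-(p.1 : ℝ))) * (V p.2 / (V p.2 + n))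
              ≤ C * (Real.exp t * Real.exp (-(p.1 : ℝ))) * ((V x + 1) / (V x + 1 + n)) := by
                gcongr
            _ = K * Real.exp (-(p.1 : ℝ)) := by rw [hK]; ring
        _ ≤ ∫⁻ p, ENNReal.ofReal K * ENNReal.ofReal (Real.exp (-(p.1 : ℝ))) ∂(jumpLaw J x) :=
          setLIntegral_le_lintegral _ _
        _ = ENNReal.ofReal K * ENNReal.ofReal (q / (q + 1)) := by
          rw [lintegral_const_mul _ (by fun_prop), ← lintegral_exp_neg_expLaw hq]
          congr 1
          have h1 : Measure.map Prod.fst (jumpLaw J x) = expLaw q := by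
            rw [jumpLaw, Measure.map_fst_prod, measure_univ, one_smul]
          rw [← h1, lintegral_map (by fun_prop) measurable_fst]
        _ ≤ _ := by
          rw [← ENNReal.ofReal_mul hK0]
          refine ENNReal.ofReal_le_ofReal ?_
          have h2 : q / (q + 1) ≤ V x / (V x + 1) := by
            rw [div_le_div_iff₀ (by positivity) (by positivity)]
            nlinarith [hJV x]
          calc K * (q / (q + 1)) ≤ K * (V x / (V x + 1)) := by gcongr
            _ = C * Real.exp t * (V x / (V x + (n + 1 : ℕ))) := by
              rw [hK]; push_cast
              have : V x + 1 + n ≠ 0 := by positivity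
              have : V x + 1 ≠ 0 := by positivity
              have : V x + (n + 1) ≠ 0 := by positivity
              field_simp
              ring
  have hlim : Tendsto (fun n : ℕ => ENNReal.ofReal (C * Real.exp t * (V x / (V x + n)))) atTop
      (𝓝 (ENNReal.ofReal (C * Real.exp t * 0))) := by
    refine ENNReal.tendsto_ofReal (Tendsto.const_mul _ (tendsto_const_nhds.div_atTop ?_))
    exact tendsto_atTop_add_const_left _ _ tendsto_natCast_atTop_atTop
  have := ge_of_tendsto' hlim fun n => key n t x
  simpa using this

/-- Infinitely many jumps up to time `t` require a first jump by time `t` and then infinitely many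
jumps from the new state in the remaining time. The probability of this event thus satisfies the
recursive inequality of `eq_zero_of_le_lintegral`. -/
lemma ae_nonExplosive (hV : ∀ x, 0 < V x) (hJV : ∀ x, (J x).real Set.univ ≤ V x)
    (hstep : ∀ x, ∀ᵐ y ∂(J x), V y ≤ V x + 1) (x : E) :
    ∀ᵐ u ∂(noiseLaw J), NonExplosive x u := by
  have key : ∀ (t : ℝ≥0) (x : E), noiseLaw J {u | ∀ n, jumpTime n x u ≤ t} = 0 := by
    intro t x
    refine eq_zero_of_le_lintegral hV hJV hstep (C := 1) zero_le_one
      (b := fun t x => noiseLaw J {u | ∀ n, jumpTime n x u ≤ t}) ?_ ?_ t x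
    · intro t x
      simpa using prob_le_one
    · intro t x
      let A : Set ((ℝ≥0 × E) × Noise E) :=
        {p | p.1.1 ≤ t} ∩ ⋂ n, {p | jumpTime n p.1.2 p.2 ≤ t - p.1.1}
      have hA : MeasurableSet A := by
        refine (measurableSet_le measurable_fst.fst measurable_const).inter
          (MeasurableSet.iInter fun n => measurableSet_le ?_ (by fun_prop))
        exact (measurable_jumpTime n).comp (measurable_fst.snd.prodMk measurable_snd)
      have h1 : {u : Noise E | ∀ n, jumpTime n x u ≤ t} = {u | (u 0 x, u.tail) ∈ A} := by
        ext u
        simp only [Set.mem_ofPred_eq, A, Set.mem_inter_iff, Set.mem_iInter]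
        constructor
        · intro h
          have h0 : (u 0 x).1 ≤ t := le_trans le_self_add (h 1)
          refine ⟨h0, fun n => ?_⟩
          exact (le_tsub_iff_left h0).2 (h (n + 1))
        · rintro ⟨h0, h⟩ n
          cases n with
          | zero => exact zero_le
          | succ n => exact (le_tsub_iff_left h0).1 (h n)
      have h2 : MeasurableSet {p : ℝ≥0 × E | p.1 ≤ t} :=
        measurableSet_le measurable_fst measurable_const
      change noiseLaw J {u : Noise E | ∀ n, jumpTime n x u ≤ t} ≤ _
      rw [h1, measure_noiseLaw_eq J x hA, ← lintegral_indicator h2]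
      refine lintegral_mono fun p => ?_
      by_cases hp : p.1 ≤ t
      · rw [Set.indicator_of_mem (by exact hp)]
        refine measure_mono fun u hu => ?_
        exact fun n => Set.mem_iInter.1 hu.2 n
      · have : {u : Noise E | (p, u) ∈ A} = ∅ := by
          ext u
          simp [A, hp]
        simp [this]
  have h : ∀ᵐ u ∂(noiseLaw J), ∀ k : ℕ, ¬ ∀ n, jumpTime n x u ≤ (k : ℝ≥0) :=
    ae_all_iff.2 fun k => by
      rw [ae_iff]
      simpa using key k x
  filter_upwards [h] with u hu t
  obtain ⟨k, hk⟩ := exists_nat_gt t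
  have := hu k
  push Not at this
  exact this.imp fun n hn => hk.trans hn

end Construction

end Sandpile

namespace Sandpile

/-! ### The law of the chain: Markov property and generator -/

section ChainLaw

variable {E : Type*} [MeasurableSpace E] [DiscreteMeasurableSpace E] [Countable E]
  (J : E → Measure E) [∀ x, IsFiniteMeasure (J x)] [hJ : ∀ x, NeZero (J x)]

/-- The law of the chain which starts in `x` and jumps according to `J`. -/
noncomputable def chainLaw (x : E) : Measure (StepPath E) := (noiseLaw J).map (noiseStepPath x)

instance isProbabilityMeasure_chainLaw (x : E) : IsProbabilityMeasure (chainLaw J x) :=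
  Measure.isProbabilityMeasure_map (measurable_noiseStepPath x).aemeasurable

lemma jumpLaw_ae_pos (x : E) : ∀ᵐ p ∂(jumpLaw J x), 0 < p.1 := by
  have := isProbabilityMeasure_expLaw (rate_pos J x)
  have h : ∀ᵐ τ ∂(expLaw ((J x).real Set.univ)), 0 < τ := by
    have h1 := expLaw_Ioi (rate_pos J x) 0
    simp only [NNReal.coe_zero, mul_zero, neg_zero, Real.exp_zero, ENNReal.ofReal_one] at h1
    exact (prob_compl_eq_zero_iff measurableSet_Ioi).2 h1
  exact Measure.quasiMeasurePreserving_fst.ae h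

lemma jumpLaw_real_lt (x : E) (t : ℝ≥0) :
    (jumpLaw J x).real {p | t < p.1} = Real.exp (-((J x).real Set.univ * t)) := by
  have := isProbabilityMeasure_expLaw (rate_pos J x)
  have h1 : {p : ℝ≥0 × E | t < p.1} = Set.Ioi t ×ˢ Set.univ := by ext; simp
  rw [h1, jumpLaw, measureReal_prod_prod, measureReal_def, expLaw_Ioi (rate_pos J x),
    ENNReal.toReal_ofReal (Real.exp_pos _).le]
  simp

lemma measurableSet_jump_le (t : ℝ≥0) : MeasurableSet {p : ℝ≥0 × E | p.1 ≤ t} :=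
  measurableSet_le measurable_fst measurable_const

lemma measurableSet_lt_jump (t : ℝ≥0) : MeasurableSet {p : ℝ≥0 × E | t < p.1} :=
  measurableSet_lt measurable_const measurable_fst

lemma jumpLaw_real_le (x : E) (t : ℝ≥0) :
    (jumpLaw J x).real {p | p.1 ≤ t} = 1 - Real.exp (-((J x).real Set.univ * t)) := by
  rw [← jumpLaw_real_lt, ← probReal_compl_eq_one_sub (measurableSet_lt_jump t)]
  congr 1
  ext p
  simp

variable {J} {V : E → ℝ} (hV : ∀ x, 0 < V x) (hJV : ∀ x, (J x).real Set.univ ≤ V x)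
  (hstep : ∀ x, ∀ᵐ y ∂(J x), V y ≤ V x + 1)

include hV hJV hstep

/-- Expectations under the path law become expectations over the noise, where the exceptional
explosive case may be ignored. -/
lemma integral_chainLaw (x : E) {Φ : StepPath E → ℝ} (hΦ : Measurable Φ) {Ψ : Noise E → ℝ}
    (h : ∀ u, (∀ t, (noiseStepPath x u).eval t = noisePath x u t) →
      Φ (noiseStepPath x u) = Ψ u) : ∫ ω, Φ ω ∂(chainLaw J x) = ∫ u, Ψ u ∂(noiseLaw J) := by
  rw [chainLaw, integral_map (measurable_noiseStepPath x).aemeasurable hΦ.aestronglyMeasurable]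
  refine integral_congr_ae ?_
  filter_upwards [ae_nonExplosive hV hJV hstep x] with u hu
  exact h u fun t => by rw [eval_noiseStepPath, if_pos hu]

lemma transition_chainLaw (t : ℝ≥0) (f : E → ℝ) (x : E) :
    transition StepPath.eval (chainLaw J) t f x = ∫ u, f (noisePath x u t) ∂(noiseLaw J) :=
  integral_chainLaw hV hJV hstep x (Measurable.of_discrete.comp (measurable_eval t))
    fun u hu => by rw [Function.comp_apply, hu]

lemma integral_afterJump {t : ℝ≥0} {p : ℝ≥0 × E} (h : p.1 ≤ t) (f : E → ℝ) (x : E) :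
    ∫ u, f (afterJump x p u t) ∂(noiseLaw J)
      = transition StepPath.eval (chainLaw J) (t - p.1) f p.2 := by
  rw [transition_chainLaw hV hJV hstep]
  simp_rw [afterJump, if_neg (not_lt.2 h)]

lemma transition_eq_afterJump (t : ℝ≥0) {f : E → ℝ} (hf : ∃ C, ∀ y, |f y| ≤ C) (x : E) :
    transition StepPath.eval (chainLaw J) t f x
      = ∫ p, ∫ u, f (afterJump x p u t) ∂(noiseLaw J) ∂(jumpLaw J x) := by
  rw [transition_chainLaw hV hJV hstep, ← integral_noiseLaw_eq J x
    (F := fun p => f (afterJump x p.1 p.2 t))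
    (Measurable.of_discrete.comp (measurable_afterJump x t)) (hf.imp fun C h p => h _)]
  refine integral_congr_ae ?_
  filter_upwards [ae_nonExplosive hV hJV hstep x] with u hu
  rw [noisePath_eq_afterJump hu]

/-- The defect in the Markov property is decomposed at the first jump. A jump after `s` leaves all
past factors constant, and memorylessness makes its contribution vanish. A jump by time `s` leaves
constants of modulus at most `1` times a defect of the same kind, with shifted times, from the new
state. The supremum of all defects therefore satisfies the recursion of `eq_zero_of_le_lintegral`.
-/
lemma integral_noise_markov {ι : Type*} {g : ι → E → ℝ} (hg : ∀ i y, |g i y| ≤ 1) {f : E → ℝ}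
    (hf : ∃ C, ∀ y, |f y| ≤ C) (t : ℝ≥0) (I : Finset ι) (r : ι → ℝ≥0) (s : ℝ≥0)
    (hr : ∀ i ∈ I, r i ≤ s) (x : E) :
    ∫ u, (∏ i ∈ I, g i (noisePath x u (r i))) * (f (noisePath x u (s + t))
      - transition StepPath.eval (chainLaw J) t f (noisePath x u s)) ∂(noiseLaw J) = 0 := by
  classical
  obtain ⟨C, hC⟩ := hf
  have hC0 : 0 ≤ C := (abs_nonneg _).trans (hC x)
  set p := transition StepPath.eval (chainLaw J) t f with hp
  have hpC : ∀ y, |p y| ≤ C := abs_transition_le inferInstance t hC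
  let d : Finset ι → (ι → ℝ≥0) → ℝ≥0 → E → ℝ := fun I r s x =>
    ∫ u, (∏ i ∈ I, g i (noisePath x u (r i))) * (f (noisePath x u (s + t))
      - p (noisePath x u s)) ∂(noiseLaw J)
  have hprod : ∀ (I : Finset ι) (z : ι → E), |∏ i ∈ I, g i (z i)| ≤ 1 := fun I z => by
    rw [Finset.abs_prod]
    exact Finset.prod_le_one (fun _ _ => abs_nonneg _) fun i _ => hg i _
  have hbd : ∀ (I : Finset ι) (z : ι → E) (y y' : E),
      |(∏ i ∈ I, g i (z i)) * (f y - p y')| ≤ 2 * C := fun I z y y' => by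
    rw [abs_mul]
    calc |∏ i ∈ I, g i (z i)| * |f y - p y'| ≤ 1 * (C + C) :=
          mul_le_mul (hprod I z) ((abs_sub _ _).trans (add_le_add (hC _) (hpC _)))
            (abs_nonneg _) zero_le_one
      _ = 2 * C := by ring
  -- The first jump discards some indices and shifts the times of the others, so the supremum is
  -- over index sets and times. The functions `g i` stay the same, which is why they are indexed by
  -- `ι` and not by time.
  let b : ℝ≥0 → E → ENNReal := fun s x => ⨆ (I : Finset ι) (r : ι → ℝ≥0)
    (_ : ∀ i ∈ I, r i ≤ s), ‖d I r s x‖ₑ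
  have key : b s x = 0 := by
    refine eq_zero_of_le_lintegral hV hJV hstep (C := 2 * C) (by positivity) ?_ ?_ s x
    · intro s x
      refine iSup_le fun I => iSup_le fun r => iSup_le fun _ => ?_
      rw [← ofReal_norm]
      exact ENNReal.ofReal_le_ofReal (abs_integral_le_of_abs_le fun u =>
        hbd I (fun i => noisePath x u (r i)) _ _)
    · intro s x
      refine iSup_le fun I => iSup_le fun r => iSup_le fun hr => ?_
      let F : (ℝ≥0 × E) × Noise E → ℝ := fun z => (∏ i ∈ I, g i (afterJump x z.1 z.2 (r i)))
        * (f (afterJump x z.1 z.2 (s + t)) - p (afterJump x z.1 z.2 s))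
      have hFm : Measurable F := by
        have h1 : ∀ (h : E → ℝ) (t : ℝ≥0),
            Measurable fun z : (ℝ≥0 × E) × Noise E => h (afterJump x z.1 z.2 t) := fun h t =>
          Measurable.of_discrete.comp (measurable_afterJump x t)
        exact (Finset.measurable_prod I fun i _ => h1 (g i) _).mul ((h1 f _).sub (h1 p _))
      have hFb : ∀ z, |F z| ≤ 2 * C := fun z => hbd I (fun i => afterJump x z.1 z.2 (r i)) _ _
      let inner : ℝ≥0 × E → ℝ := fun q => ∫ u, F (q, u) ∂(noiseLaw J)
      have hinner : Measurable inner :=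
        (StronglyMeasurable.integral_prod_right' hFm.stronglyMeasurable).measurable
      have hinnerb : ∀ q, |inner q| ≤ 2 * C := fun q => abs_integral_le_of_abs_le fun u => hFb _
      have hd : d I r s x = ∫ q, inner q ∂(jumpLaw J x) := by
        rw [← integral_noiseLaw_eq J x hFm ⟨_, hFb⟩]
        refine integral_congr_ae ?_
        filter_upwards [ae_nonExplosive hV hJV hstep x] with u hu
        simp only [F, noisePath_eq_afterJump hu]
      -- Shifting the first jump by `s` restores the jump law up to a factor. The integral is then a
      -- multiple of `S(t)f(x) - p x`, which is zero.
      have hlate : ∫ q in {q | s < q.1}, inner q ∂(jumpLaw J x) = 0 := by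
        let H : ℝ≥0 × E → ℝ := fun q => ∫ u, f (afterJump x q u t) ∂(noiseLaw J)
        have hHm : Measurable H := (StronglyMeasurable.integral_prod_right
          (f := fun q u => f (afterJump x q u t)) (Measurable.of_discrete.comp
            (measurable_afterJump x t)).stronglyMeasurable).measurable
        have hHi : Integrable H (jumpLaw J x) :=
          integrable_of_abs_le hHm ⟨C, fun q => abs_integral_le_of_abs_le fun u => hC _⟩
        have hH : ∀ q ∈ {q : ℝ≥0 × E | s < q.1},
            inner q = (∏ i ∈ I, g i x) * (H (q.1 - s, q.2) - p x) := by
          intro q (hq : s < q.1)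
          have e1 : ∀ u, F (q, u) = (∏ i ∈ I, g i x) * (f (afterJump x (q.1 - s, q.2) u t)
              - p x) := by
            intro u
            simp only [F]
            congr 1
            · refine Finset.prod_congr rfl fun i hi => ?_
              rw [afterJump, if_pos (lt_of_le_of_lt (hr i hi) hq)]
            · have e2 : afterJump x q u s = x := by rw [afterJump, if_pos hq]
              have e3 : afterJump x q u (s + t) = afterJump x (q.1 - s, q.2) u t := by
                rw [afterJump, afterJump]
                simp only [lt_tsub_iff_left]
                split_ifs with h
                · rfl
                · congr 1
                  rw [tsub_tsub_eq_add_tsub_of_le (le_of_lt hq), add_comm]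
              rw [e2, e3]
          change ∫ u, F (q, u) ∂(noiseLaw J) = _
          simp_rw [e1]
          have hi : Integrable (fun u => f (afterJump x (q.1 - s, q.2) u t)) (noiseLaw J) :=
            integrable_of_abs_le (Measurable.of_discrete.comp ((measurable_afterJump x t).comp
              measurable_prodMk_left)) ⟨C, fun u => hC _⟩
          rw [integral_const_mul, integral_sub hi (integrable_const _)]
          simp [H]
        rw [setIntegral_congr_fun (measurableSet_lt_jump s) hH, integral_const_mul]
        have hm : Measurable fun q : ℝ≥0 × E => (q.1 - s, q.2) := by fun_prop
        have e4 := integral_map (μ := (jumpLaw J x).restrict {q | s < q.1}) hm.aemeasurable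
          (f := fun q => H q - p x) (hHm.sub_const _).aestronglyMeasurable
        rw [← e4, jumpLaw_map_sub, integral_smul_measure, integral_sub hHi (integrable_const _),
          ← transition_eq_afterJump hV hJV hstep t ⟨C, hC⟩ x]
        simp [hp]
      have hsplit : d I r s x = ∫ q in {q | q.1 ≤ s}, inner q ∂(jumpLaw J x) := by
        have h1 := integral_add_compl (μ := jumpLaw J x) (f := inner) (measurableSet_lt_jump s)
          (integrable_of_abs_le hinner ⟨_, hinnerb⟩)
        rw [hlate, zero_add] at h1
        rw [hd, ← h1]
        congr 2
        ext q
        simp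
      rw [hsplit]
      refine (enorm_integral_le_lintegral_enorm _).trans (setLIntegral_mono' 
        (measurableSet_jump_le s) fun q (hq : q.1 ≤ s) => ?_)
      -- Times before the first jump see the starting state `x`; the others are kept and measured
      -- from the jump.
      let I' := I.filter fun i => q.1 ≤ r i
      let r' : ι → ℝ≥0 := fun i => r i - q.1
      have e1 : inner q = (∏ i ∈ I.filter (fun i => ¬ q.1 ≤ r i), g i x)
          * d I' r' (s - q.1) q.2 := by
        rw [← integral_const_mul]
        refine integral_congr_ae (Eventually.of_forall fun u => ?_)
        simp only [F]
        rw [← Finset.prod_filter_mul_prod_filter_not I (fun i => q.1 ≤ r i)]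
        have e2 : ∏ i ∈ I.filter (fun i => q.1 ≤ r i), g i (afterJump x q u (r i))
            = ∏ i ∈ I', g i (noisePath q.2 u (r' i)) := by
          refine Finset.prod_congr rfl fun i hi => ?_
          rw [afterJump, if_neg (not_lt.2 (Finset.mem_filter.1 hi).2)]
        have e3 : ∏ i ∈ I.filter (fun i => ¬ q.1 ≤ r i), g i (afterJump x q u (r i))
            = ∏ i ∈ I.filter (fun i => ¬ q.1 ≤ r i), g i x := by
          refine Finset.prod_congr rfl fun i hi => ?_
          rw [afterJump, if_pos (not_le.1 (Finset.mem_filter.1 hi).2)]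
        have e4 : afterJump x q u (s + t) = noisePath q.2 u (s - q.1 + t) := by
          rw [afterJump, if_neg (not_lt.2 (hq.trans le_self_add)), tsub_add_eq_add_tsub hq]
        have e5 : afterJump x q u s = noisePath q.2 u (s - q.1) := by
          rw [afterJump, if_neg (not_lt.2 hq)]
        rw [e2, e3, e4, e5]
        ring
      have hr' : ∀ i ∈ I', r' i ≤ s - q.1 := fun i hi =>
        tsub_le_tsub_right (hr i (Finset.mem_filter.1 hi).1) _
      rw [e1, enorm_mul]
      have e6 : ‖∏ i ∈ I.filter (fun i => ¬ q.1 ≤ r i), g i x‖ₑ ≤ 1 := by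
        rw [← ofReal_norm, ← ENNReal.ofReal_one]
        exact ENNReal.ofReal_le_ofReal (hprod _ fun _ => x)
      calc _ ≤ 1 * ‖d I' r' (s - q.1) q.2‖ₑ := by gcongr
        _ ≤ b (s - q.1) q.2 := by
          rw [one_mul]
          exact le_iSup_of_le I' (le_iSup_of_le r' (le_iSup_of_le hr' le_rfl))
  have h1 : ‖d I r s x‖ₑ ≤ b s x := le_iSup_of_le I (le_iSup_of_le r (le_iSup_of_le hr le_rfl))
  rw [key] at h1
  simpa using h1

theorem isMarkovFamily_chainLaw : IsMarkovFamily StepPath.eval (chainLaw J) := by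
  classical
  refine IsMarkovFamily.of_isPiSystem measurable_eval Measurable.of_discrete inferInstance ?_
    MeasurableSpace.isPiSystem_measurableSet MeasurableSpace.generateFrom_measurableSet.symm
    MeasurableSet.univ ?_
  · intro x
    have h1 : ∀ᵐ u ∂(noiseLaw J), 0 < (u 0 x).1 := by
      have h2 : ∀ᵐ z ∂((jumpLaw J x).prod (noiseLaw J)), 0 < z.1.1 :=
        Measure.quasiMeasurePreserving_fst.ae (jumpLaw_ae_pos J x)
      rw [← noiseLaw_map] at h2
      exact ae_of_ae_map (measurable_head_tail x).aemeasurable h2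
    have hm : MeasurableSet {ω : StepPath E | ω.eval 0 = x} :=
      measurable_eval 0 (measurableSet_singleton x)
    refine (ae_map_iff (measurable_noiseStepPath x).aemeasurable hm).2 ?_
    filter_upwards [h1, ae_nonExplosive hV hJV hstep x] with u h1 hu
    rw [eval_noiseStepPath, if_pos hu, noisePath_eq_afterJump hu, afterJump, if_pos h1]
  · intro x s t I B B₀ hI hB hB₀
    let g : ℝ≥0 → E → ℝ := fun r => (B r).indicator 1
    let f : E → ℝ := B₀.indicator 1
    have hg : ∀ r y, |g r y| ≤ 1 := fun r y => by by_cases h : y ∈ B r <;> simp [g, h]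
    have hf : ∀ y, |f y| ≤ 1 := fun y => by by_cases h : y ∈ B₀ <;> simp [f, h]
    set p := transition StepPath.eval (chainLaw J) t f with hp
    have hp1 : ∀ y, |p y| ≤ 1 := abs_transition_le inferInstance t hf
    have hpp : ∀ y, p y = (chainLaw J y).real (StepPath.eval t ⁻¹' B₀) := fun y => by
      rw [← integral_indicator_one (measurable_eval t hB₀)]
      rfl
    set A : Set (StepPath E) := ⋂ r ∈ I, StepPath.eval r ⁻¹' B r with hA
    have hAm : MeasurableSet A := Finset.measurableSet_biInter I fun r hr =>
      measurable_eval r (hB r hr)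
    have hAi : ∀ ω : StepPath E, A.indicator (1 : StepPath E → ℝ) ω
        = ∏ r ∈ I, g r (ω.eval r) := by
      intro ω
      by_cases hω : ω ∈ A
      · rw [Set.indicator_of_mem hω]
        refine (Finset.prod_eq_one fun r hr => ?_).symm
        exact Set.indicator_of_mem (s := B r) (a := ω.eval r) (Set.mem_iInter₂.1 hω r hr) 1
      · rw [Set.indicator_of_notMem hω]
        simp only [hA, Set.mem_iInter, not_forall] at hω
        obtain ⟨r, hr, hω⟩ := hω
        exact (Finset.prod_eq_zero hr
          (Set.indicator_of_notMem (s := B r) (a := ω.eval r) hω 1)).symm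
    have hgm : ∀ (h : E → ℝ) r, Measurable fun ω : StepPath E => h (ω.eval r) := fun h r =>
      Measurable.of_discrete.comp (measurable_eval r)
    have hAgm : Measurable fun ω : StepPath E => ∏ r ∈ I, g r (ω.eval r) :=
      Finset.measurable_prod I fun r _ => hgm (g r) r
    have key := integral_noise_markov hV hJV hstep hg ⟨1, hf⟩ t I id s hI x
    rw [← integral_chainLaw hV hJV hstep x
      (Φ := fun ω => (∏ r ∈ I, g r (ω.eval r)) * (f (ω.eval (s + t)) - p (ω.eval s)))
      (hAgm.mul ((hgm f _).sub (hgm p _))) (fun u hu => by simp only [hu, id, hp])] at key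
    simp_rw [← hAi] at key
    have e1 : ∀ ω : StepPath E, A.indicator (1 : StepPath E → ℝ) ω
        * (f (ω.eval (s + t)) - p (ω.eval s))
        = (A ∩ StepPath.eval (s + t) ⁻¹' B₀).indicator 1 ω
          - A.indicator (fun ω => p (ω.eval s)) ω := by
      intro ω
      by_cases h1 : ω ∈ A
      · by_cases h2 : ω.eval (s + t) ∈ B₀ <;> simp [f, h1, h2]
      · simp [h1]
    simp_rw [e1] at key
    have hpi : Integrable (fun ω : StepPath E => p (ω.eval s)) (chainLaw J x) :=
      integrable_of_abs_le (hgm p s) ⟨1, fun ω => hp1 _⟩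
    have hm2 : MeasurableSet (A ∩ StepPath.eval (s + t) ⁻¹' B₀) :=
      hAm.inter (measurable_eval (s + t) hB₀)
    have hi1 : Integrable ((A ∩ StepPath.eval (s + t) ⁻¹' B₀).indicator (1 : StepPath E → ℝ))
      (chainLaw J x) := (integrable_const (1 : ℝ)).indicator hm2
    rw [integral_sub hi1 (hpi.indicator hAm),
      integral_indicator_one hm2, integral_indicator hAm, sub_eq_zero] at key
    have e2 : ∫⁻ ω in A, chainLaw J (ω.eval s) (StepPath.eval t ⁻¹' B₀) ∂(chainLaw J x)
        = ENNReal.ofReal (∫ ω in A, p (ω.eval s) ∂(chainLaw J x)) := by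
      rw [ofReal_integral_eq_lintegral_ofReal hpi.integrableOn
        (Eventually.of_forall fun ω => measureReal_nonneg.trans_eq (hpp _).symm)]
      refine lintegral_congr fun ω => ?_
      rw [hpp, ofReal_measureReal]
    rw [e2, ← key, ofReal_measureReal]

/-- Only paths with a jump by time `t` contribute, and their probability `1 - exp (-q t)` is at most
`q t ≤ V x * t`. -/
lemma abs_transition_sub_le {f : E → ℝ} {C : ℝ} (hf : ∀ y, |f y| ≤ C) (t : ℝ≥0) (x : E) :
    |transition StepPath.eval (chainLaw J) t f x - f x| ≤ 2 * C * (V x * t) := by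
  have hC0 : 0 ≤ C := (abs_nonneg _).trans (hf x)
  have hHm : Measurable fun q : ℝ≥0 × E => ∫ u, f (afterJump x q u t) ∂(noiseLaw J) :=
    (StronglyMeasurable.integral_prod_right (f := fun q u => f (afterJump x q u t))
      (Measurable.of_discrete.comp (measurable_afterJump x t)).stronglyMeasurable).measurable
  have hHb : ∀ q : ℝ≥0 × E, |∫ u, f (afterJump x q u t) ∂(noiseLaw J)| ≤ C := fun q =>
    abs_integral_le_of_abs_le fun u => hf _
  have hHi := integrable_of_abs_le (μ := jumpLaw J x) hHm ⟨C, hHb⟩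
  have h1 : transition StepPath.eval (chainLaw J) t f x - f x
      = ∫ q in {q | q.1 ≤ t}, (∫ u, f (afterJump x q u t) ∂(noiseLaw J) - f x) ∂(jumpLaw J x) := by
    rw [transition_eq_afterJump hV hJV hstep t ⟨C, hf⟩]
    have h2 := integral_sub (μ := jumpLaw J x) hHi (integrable_const (f x))
    simp only [integral_const, probReal_univ, smul_eq_mul, one_mul] at h2
    rw [← h2, ← integral_indicator (measurableSet_jump_le t)]
    refine integral_congr_ae (Eventually.of_forall fun q => ?_)
    by_cases hq : q.1 ≤ t
    · simp [hq]
    · rw [Set.indicator_of_notMem (by exact hq)]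
      simp [afterJump, not_le.1 hq]
  rw [h1, ← Real.norm_eq_abs]
  refine (norm_setIntegral_le_of_norm_le_const (C := 2 * C) (measure_lt_top _ _)
    (fun q _ => ?_)).trans ?_
  · refine (abs_sub _ _).trans ?_
    linarith [hHb q, hf x]
  · rw [jumpLaw_real_le]
    refine mul_le_mul_of_nonneg_left ?_ (by positivity)
    have := Real.add_one_le_exp (-((J x).real Set.univ * t))
    nlinarith [hJV x, t.coe_nonneg]

/-- To first order there is at most one jump. The state right after the first jump gives the main
term, whose quotient by `t` converges to the jump integral; later motion changes the result by an
error of second order in `t`. -/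
lemma chainLaw_generator {f : E → ℝ} (hf : ∃ C, ∀ y, |f y| ≤ C) (x : E) :
    Tendsto (fun t : ℝ≥0 => (transition StepPath.eval (chainLaw J) t f x - f x) / (t : ℝ))
      (𝓝[>] 0) (𝓝 (∫ y, (f y - f x) ∂(J x))) := by
  obtain ⟨C, hC⟩ := hf
  have hC0 : 0 ≤ C := (abs_nonneg _).trans (hC x)
  have hVx := hV x
  have hq := rate_pos J x
  have := isProbabilityMeasure_expLaw hq
  set q := (J x).real Set.univ with hqdef
  set m := ∫ y, f y ∂((J x Set.univ)⁻¹ • J x) with hm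
  have hHm : ∀ t, Measurable fun q : ℝ≥0 × E => ∫ u, f (afterJump x q u t) ∂(noiseLaw J) :=
    fun t => (StronglyMeasurable.integral_prod_right (f := fun q u => f (afterJump x q u t))
      (Measurable.of_discrete.comp (measurable_afterJump x t)).stronglyMeasurable).measurable
  have hHi : ∀ t, Integrable (fun q : ℝ≥0 × E => ∫ u, f (afterJump x q u t) ∂(noiseLaw J))
      (jumpLaw J x) := fun t => integrable_of_abs_le (hHm t)
        ⟨C, fun q => abs_integral_le_of_abs_le fun u => hC _⟩
  have hgen : ∫ y, (f y - f x) ∂(J x) = q * (m - f x) := by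
    rw [integral_sub (integrable_discrete ⟨C, hC⟩) (integrable_const _), hm,
      integral_smul_measure, ENNReal.toReal_inv, ← measureReal_def, ← hqdef]
    simp only [integral_const, smul_eq_mul, ← hqdef]
    field_simp
  -- The state after the first jump has `V` at most `V x + 1`, so `abs_transition_sub_le` bounds the
  -- subsequent change by `2 * C * (V x + 1) * t`; the last factor is the probability of a jump by
  -- time `t`.
  have herr : ∀ t : ℝ≥0, |transition StepPath.eval (chainLaw J) t f x - f x
      - (1 - Real.exp (-(q * t))) * (m - f x)|
      ≤ 2 * C * ((V x + 1) * t) * (1 - Real.exp (-(q * t))) := by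
    intro t
    have h1 : transition StepPath.eval (chainLaw J) t f x - f x
        - (1 - Real.exp (-(q * t))) * (m - f x)
        = ∫ z in {z | z.1 ≤ t}, (∫ u, f (afterJump x z u t) ∂(noiseLaw J) - f z.2)
          ∂(jumpLaw J x) := by
      have e1 : (1 - Real.exp (-(q * t))) * (m - f x)
          = ∫ z in {z | z.1 ≤ t}, (f z.2 - f x) ∂(jumpLaw J x) := by
        have h2 : {z : ℝ≥0 × E | z.1 ≤ t} = Set.Iic t ×ˢ Set.univ := by ext; simp
        have h3 := jumpLaw_real_le J x t
        rw [h2, jumpLaw, measureReal_prod_prod] at h3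
        simp only [probReal_univ, mul_one] at h3
        rw [h2, jumpLaw, ← Measure.restrict_prod_eq_prod_univ]
        have h4 := integral_prod_mul (μ := (expLaw q).restrict (Set.Iic t))
          (ν := (J x Set.univ)⁻¹ • J x) (fun _ => (1 : ℝ)) (fun y => f y - f x)
        simp only [one_mul, integral_const, smul_eq_mul, mul_one, measureReal_restrict_apply_univ]
          at h4
        rw [h4, h3, integral_sub (integrable_discrete ⟨C, hC⟩) (integrable_const _)]
        simp [hm, hqdef]
      have e2 : transition StepPath.eval (chainLaw J) t f x - f x
          = ∫ z in {z | z.1 ≤ t}, (∫ u, f (afterJump x z u t) ∂(noiseLaw J) - f x)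
            ∂(jumpLaw J x) := by
        rw [transition_eq_afterJump hV hJV hstep t ⟨C, hC⟩]
        have h2 := integral_sub (μ := jumpLaw J x) (hHi t) (integrable_const (f x))
        simp only [integral_const, probReal_univ, smul_eq_mul, one_mul] at h2
        rw [← h2, ← integral_indicator (measurableSet_jump_le t)]
        refine integral_congr_ae (Eventually.of_forall fun z => ?_)
        by_cases hz : z.1 ≤ t
        · simp [hz]
        · rw [Set.indicator_of_notMem (by exact hz)]
          simp [afterJump, not_le.1 hz]
      have hf2 : Integrable (fun z : ℝ≥0 × E => f z.2) (jumpLaw J x) :=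
        integrable_of_abs_le (Measurable.of_discrete.comp measurable_snd) ⟨C, fun z => hC _⟩
      have hi1 : Integrable (fun z : ℝ≥0 × E => ∫ u, f (afterJump x z u t) ∂(noiseLaw J) - f x)
        ((jumpLaw J x).restrict {z | z.1 ≤ t}) := (hHi t).integrableOn.sub (integrable_const _)
      have hi2 : Integrable (fun z : ℝ≥0 × E => f z.2 - f x)
        ((jumpLaw J x).restrict {z | z.1 ≤ t}) := hf2.integrableOn.sub (integrable_const _)
      rw [e1, e2, ← integral_sub hi1 hi2]
      refine integral_congr_ae (Eventually.of_forall fun z => ?_)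
      simp only
      ring
    rw [h1, ← jumpLaw_real_le, ← Real.norm_eq_abs]
    refine norm_setIntegral_le_of_norm_le_const_ae (measure_lt_top _ _) ?_
    refine (ae_restrict_iff' (measurableSet_jump_le t)).2 ?_
    filter_upwards [jumpLaw_ae_snd J x (hstep x)] with z hz (hzt : z.1 ≤ t)
    rw [integral_afterJump hV hJV hstep hzt]
    refine (abs_transition_sub_le hV hJV hstep hC _ _).trans ?_
    have h2 : ((t - z.1 : ℝ≥0) : ℝ) ≤ t := NNReal.coe_le_coe.2 tsub_le_self
    have := hV z.2
    gcongr
  have hexp : Tendsto (fun t : ℝ≥0 => (1 - Real.exp (-(q * t))) / (t : ℝ)) (𝓝[>] 0) (𝓝 q) := by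
    have h1 : HasDerivAt (fun t : ℝ => 1 - Real.exp (-(q * t))) q 0 := by
      have := ((((hasDerivAt_id (0 : ℝ)).const_mul q).neg).exp).const_sub 1
      refine this.congr_deriv ?_
      simp
    have h2 := (hasDerivAt_iff_tendsto_slope.1 h1)
    have h3 : Tendsto (fun t : ℝ≥0 => (t : ℝ)) (𝓝[>] 0) (𝓝[≠] 0) := by
      refine tendsto_nhdsWithin_iff.2 ⟨(NNReal.continuous_coe.tendsto' 0 0 rfl).mono_left
        nhdsWithin_le_nhds, ?_⟩
      filter_upwards [self_mem_nhdsWithin] with t ht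
      simpa using ne_of_gt ht
    refine (h2.comp h3).congr fun t => ?_
    simp [slope_def_field]
  have hexp0 : Tendsto (fun t : ℝ≥0 => 2 * C * (V x + 1) * (1 - Real.exp (-(q * t))))
      (𝓝[>] 0) (𝓝 0) := by
    have : Continuous fun t : ℝ≥0 => 2 * C * (V x + 1) * (1 - Real.exp (-(q * t))) := by fun_prop
    exact (this.tendsto' 0 0 (by simp)).mono_left nhdsWithin_le_nhds
  rw [hgen]
  have hmain := hexp.mul_const (m - f x)
  refine hmain.congr_dist ?_
  refine squeeze_zero' (Eventually.of_forall fun _ => dist_nonneg) ?_ hexp0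
  filter_upwards [self_mem_nhdsWithin] with t ht
  have ht0 : (0 : ℝ) < t := by exact_mod_cast ht
  rw [dist_comm, Real.dist_eq]
  have e : (transition StepPath.eval (chainLaw J) t f x - f x) / (t : ℝ)
      - (1 - Real.exp (-(q * t))) / (t : ℝ) * (m - f x)
      = (transition StepPath.eval (chainLaw J) t f x - f x
        - (1 - Real.exp (-(q * t))) * (m - f x)) / t := by
    field_simp
  rw [e, abs_div, abs_of_pos ht0, div_le_iff₀ ht0]
  refine (herr t).trans_eq ?_
  ring

end ChainLaw

/-- A generator with locally bounded rates defines a Markov process. -/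
theorem exists_generates {E : Type*} [MeasurableSpace E] [DiscreteMeasurableSpace E] [Countable E]
    {G : (E → ℝ) → E → ℝ} {J : E → Measure E} [∀ x, IsFiniteMeasure (J x)] {V : E → ℝ}
    (hV : ∀ x, 0 < V x) (hJV : ∀ x, (J x).real Set.univ ≤ V x)
    (hstep : ∀ x, ∀ᵐ y ∂(J x), V y ≤ V x + 1)
    (hG : ∀ f, (∃ C, ∀ y, |f y| ≤ C) → ∀ x, G f x = ∫ y, (f y - f x) ∂(J x)) :
    ∃ P, Generates G P := by
  -- A fictitious jump from `x` to `x` at rate `1` leaves the generator unchanged and makes all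
  -- rates positive, so that absorbing states are covered by the construction.
  let J' : E → Measure E := fun x => J x + Measure.dirac x
  let V' : E → ℝ := fun x => V x + 1
  have hV' : ∀ x, 0 < V' x := fun x => by have := hV x; positivity
  have hJV' : ∀ x, (J' x).real Set.univ ≤ V' x := fun x => by
    have := hJV x
    simp only [J', V']
    rw [measureReal_add_apply]
    simpa using this
  have hstep' : ∀ x, ∀ᵐ y ∂(J' x), V' y ≤ V' x + 1 := fun x => by
    simp only [J', ae_add_measure_iff]
    refine ⟨?_, ?_⟩
    · filter_upwards [hstep x] with y hy
      simp only [V']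
      linarith
    · rw [ae_dirac_eq]
      simp
  have : ∀ x, NeZero (J' x) := fun x => ⟨fun h => by
    have := congrArg (fun μ : Measure E => μ {x}) h
    simp [J'] at this⟩
  refine ⟨chainLaw J', ⟨isMarkovFamily_chainLaw hV' hJV' hstep', fun f hf x => ?_⟩, ?_⟩
  · have h := chainLaw_generator hV' hJV' hstep' hf x
    obtain ⟨C, hC⟩ := hf
    have hi : ∀ (μ : Measure E) [IsFiniteMeasure μ], Integrable (fun y => f y - f x) μ :=
      fun μ _ => (integrable_discrete ⟨C, hC⟩).sub (integrable_const _)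
    rwa [integral_add_measure (hi _) (hi _), integral_dirac, sub_self, add_zero,
      ← hG f ⟨C, hC⟩] at h
  · intro P' h'
    refine h'.unique ⟨isMarkovFamily_chainLaw hV' hJV' hstep', fun f hf x => ?_⟩ hV hJV hstep hG
    have h := chainLaw_generator hV' hJV' hstep' hf x
    obtain ⟨C, hC⟩ := hf
    have hi : ∀ (μ : Measure E) [IsFiniteMeasure μ], Integrable (fun y => f y - f x) μ :=
      fun μ _ => (integrable_discrete ⟨C, hC⟩).sub (integrable_const _)
    rwa [integral_add_measure (hi _) (hi _), integral_dirac, sub_self, add_zero,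
      ← hG f ⟨C, hC⟩] at h

end Sandpile

namespace Sandpile

/-! ### Heights and avalanches -/

lemma one_lt_two' : one < two := by decide

lemma one_ne_two : one ≠ two := one_lt_two'.ne

lemma eq_one_or_two (h : Height) : h = one ∨ h = two := by
  obtain ⟨n, h1, h2⟩ := h
  interval_cases n
  · exact Or.inl rfl
  · exact Or.inr rfl

lemma ne_two_iff {h : Height} : h ≠ two ↔ h = one := by
  rcases eq_one_or_two h with rfl | rfl
  · simp [one_ne_two]
  · simp [one_ne_two.symm]

lemma ne_one_iff {h : Height} : h ≠ one ↔ h = two := by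
  rcases eq_one_or_two h with rfl | rfl
  · simp [one_ne_two]
  · simp [one_ne_two.symm]

lemma one_le (h : Height) : one ≤ h := by
  rcases eq_one_or_two h with rfl | rfl
  · exact le_rfl
  · exact one_lt_two'.le

lemma le_two (h : Height) : h ≤ two := by
  rcases eq_one_or_two h with rfl | rfl
  · exact one_lt_two'.le
  · exact le_rfl

lemma eq_two_of_le {h h' : Height} (hh : h ≤ h') (h2 : h = two) : h' = two :=
  le_antisymm (le_two _) (h2 ▸ hh)

lemma eq_one_of_le {h h' : Height} (hh : h ≤ h') (h1 : h' = one) : h = one :=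
  le_antisymm (h1 ▸ hh) (one_le _)

lemma height_le_iff {h h' : Height} : h ≤ h' ↔ (h = two → h' = two) := by
  rcases eq_one_or_two h with rfl | rfl
  · simp [one_le, one_ne_two]
  · exact ⟨fun hh h2 => eq_two_of_le hh h2, fun hh => (hh rfl).ge⟩

lemma config_le_iff {ξ η : Config} : ξ ≤ η ↔ ∀ j, ξ j = two → η j = two := by
  simp only [Pi.le_def, height_le_iff]

/-- `(a, b)` is the maximal interval of critical sites of `η` around `i`. -/
structure IsGap (η : Config) (a b i : ℤ) : Prop where
  left : η a = one
  right : η b = one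
  lt_left : a < i
  lt_right : i < b
  between : ∀ j, a < j → j < b → η j = two

namespace IsGap

variable {η : Config} {a b i : ℤ}

lemma kPlus_eq (h : IsGap η a b i) : kPlus i η = ((b - i).toNat : ℕ∞) := by
  have h1 := h.lt_right
  have h2 := h.lt_left
  refine le_antisymm (iInf₂_le _ ?_) (le_iInf₂ fun j hj => ?_)
  · change η (i + ((b - i).toNat : ℤ)) = one
    rw [Int.toNat_of_nonneg (by omega), add_sub_cancel]
    exact h.right
  · norm_cast
    by_contra hlt
    have := h.between (i + j) (by omega) (by omega)
    exact one_ne_two (hj.symm.trans this)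

lemma kMinus_eq (h : IsGap η a b i) : kMinus i η = ((i - a).toNat : ℕ∞) := by
  have h1 := h.lt_right
  have h2 := h.lt_left
  refine le_antisymm (iInf₂_le _ ?_) (le_iInf₂ fun j hj => ?_)
  · change 0 < (i - a).toNat ∧ η (i - ((i - a).toNat : ℤ)) = one
    refine ⟨by omega, ?_⟩
    rw [Int.toNat_of_nonneg (by omega), sub_sub_cancel]
    exact h.left
  · norm_cast
    by_contra hlt
    have := hj.1
    have := h.between (i - j) (by omega) (by omega)
    exact one_ne_two (hj.2.symm.trans this)

lemma reflect_eq (h : IsGap η a b i) : reflect i η = a + b - i := by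
  have h1 := h.lt_right
  have h2 := h.lt_left
  rw [reflect, h.kPlus_eq, h.kMinus_eq, ENat.toNat_natCast, ENat.toNat_natCast]
  omega

lemma eq_two (h : IsGap η a b i) : η i = two := h.between i h.lt_left h.lt_right

/-- The ends of the gap are filled and the mirror image of `i` is emptied. The mirror image lies
strictly between the ends, so the three updates do not interfere. -/
lemma topple_apply (h : IsGap η a b i) (j : ℤ) :
    topple i η j = if j = a + b - i then one else if j = a ∨ j = b then two else η j := by
  have h1 := h.lt_right
  have h2 := h.lt_left
  have h3 : ¬ η i = one := by rw [h.eq_two]; exact one_ne_two.symm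
  have e1 : i + ((b - i).toNat : ℤ) = b := by omega
  have e2 : i - ((i - a).toNat : ℤ) = a := by omega
  rw [topple, if_neg h3, if_pos (by simp [h.kPlus_eq, h.kMinus_eq]), h.reflect_eq, h.kPlus_eq,
    h.kMinus_eq, ENat.toNat_natCast, ENat.toNat_natCast, e1, e2]
  simp only [Function.update_apply]
  split_ifs <;> simp_all

lemma symm (h : IsGap η a b i) : IsGap η a b (a + b - i) where
  left := h.left
  right := h.right
  lt_left := by linarith [h.lt_right]
  lt_right := by linarith [h.lt_left]
  between := h.between

lemma topple_eq_two_of_mem (h : IsGap η a b i) {j : ℤ} (ha : a ≤ j) (hb : j ≤ b)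
    (hj : j ≠ a + b - i) : topple i η j = two := by
  rw [h.topple_apply, if_neg hj]
  split_ifs with h1
  · rfl
  · push Not at h1
    exact h.between j (lt_of_le_of_ne ha (Ne.symm h1.1)) (lt_of_le_of_ne hb h1.2)

lemma topple_eq_two (h : IsGap η a b i) {j : ℤ} (hj : j ≠ a + b - i) (h2 : η j = two) :
    topple i η j = two := by
  rw [h.topple_apply, if_neg hj, h2]
  simp

end IsGap

lemma topple_of_eq_one {η : Config} {i : ℤ} (h : η i = one) :
    topple i η = Function.update η i two := by
  rw [topple, if_pos h]

lemma exists_isGap {η : Config} {i : ℤ} (hi : η i = two) (hl : ∃ n : ℕ, η (i - n) = one)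
    (hr : ∃ n : ℕ, η (i + n) = one) : ∃ a b, IsGap η a b i := by
  classical
  have hl0 : Nat.find hl ≠ 0 := fun h => by
    have := Nat.find_spec hl
    rw [h] at this
    simp [hi, one_ne_two.symm] at this
  have hr0 : Nat.find hr ≠ 0 := fun h => by
    have := Nat.find_spec hr
    rw [h] at this
    simp [hi, one_ne_two.symm] at this
  refine ⟨i - Nat.find hl, i + Nat.find hr, Nat.find_spec hl, Nat.find_spec hr, by omega,
    by omega, fun j h1 h2 => ?_⟩
  rcases le_total i j with hij | hij
  · have := Nat.find_min hr (m := (j - i).toNat) (by omega)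
    rwa [Int.toNat_of_nonneg (by omega), add_sub_cancel, ← ne_eq, ne_one_iff] at this
  · have := Nat.find_min hl (m := (i - j).toNat) (by omega)
    rwa [Int.toNat_of_nonneg (by omega), sub_sub_cancel, ← ne_eq, ne_one_iff] at this

/-! ### Avalanches on finite configurations and their compatibility with the order -/

namespace FinConfig

variable (η : FinConfig)

lemma exists_isGap {i : ℤ} (hi : η.1 i = two) : ∃ a b, IsGap η.1 a b i := by
  have key : ∀ g : ℕ → ℤ, Function.Injective g → ∃ n, η.1 (g n) = one := by
    intro g hg
    by_contra! h
    have : Set.range g ⊆ critical η.1 := by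
      rintro _ ⟨n, rfl⟩
      exact ne_one_iff.1 (h n)
    exact Set.infinite_range_of_injective hg (η.2.subset this)
  exact Sandpile.exists_isGap hi (key (fun n => i - n) fun m n h => by simpa using h)
    (key (fun n => i + n) fun m n h => by simpa using h)

lemma reflect_eq_two {i : ℤ} (hi : η.1 i = two) : η.1 (reflect i η.1) = two := by
  obtain ⟨a, b, h⟩ := η.exists_isGap hi
  rw [h.reflect_eq]
  exact h.symm.eq_two

/-- A critical site and its mirror image lie in the same gap. -/
lemma reflect_reflect {i : ℤ} (hi : η.1 i = two) : reflect (reflect i η.1) η.1 = i := by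
  obtain ⟨a, b, h⟩ := η.exists_isGap hi
  rw [h.reflect_eq, h.symm.reflect_eq]
  ring

/-- The set of critical sites. -/
noncomputable def crit : Finset ℤ := η.2.toFinset

lemma mem_crit {i : ℤ} : i ∈ η.crit ↔ η.1 i = two := by simp [crit, critical]

lemma crit_injective : Function.Injective crit := by
  intro η ξ h
  refine Subtype.ext (funext fun j => ?_)
  have : η.1 j = two ↔ ξ.1 j = two := by rw [← mem_crit, ← mem_crit, h]
  rcases eq_one_or_two (η.1 j) with h1 | h1
  · rw [h1]
    exact (ne_two_iff.1 fun h2 => one_ne_two (h1.symm.trans (this.2 h2))).symm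
  · rw [h1, this.1 h1]

instance : Countable FinConfig := crit_injective.countable

/-- A birth adds one critical site; an avalanche fills two sites and empties one. This is the growth
bound on `V` behind non-explosion. -/
lemma card_crit_toppleFin_le (i : ℤ) : (toppleFin i η).crit.card ≤ η.crit.card + 1 := by
  rcases eq_one_or_two (η.1 i) with hi | hi
  · refine (Finset.card_le_card (t := insert i η.crit) fun j hj => ?_).trans
      (Finset.card_insert_le _ _)
    replace hj : topple i η.1 j = two := (mem_crit _).1 hj
    rw [topple_of_eq_one hi, Function.update_apply] at hj
    rw [Finset.mem_insert, mem_crit]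
    by_cases h : j = i
    · exact Or.inl h
    · rw [if_neg h] at hj
      exact Or.inr hj
  · obtain ⟨a, b, h⟩ := η.exists_isGap hi
    have hk : a + b - i ∈ η.crit := η.mem_crit.2 h.symm.eq_two
    have h1 : (toppleFin i η).crit ⊆ insert a (insert b (η.crit.erase (a + b - i))) := by
      intro j hj
      have hj' : topple i η.1 j = two := (mem_crit _).1 hj
      rw [h.topple_apply] at hj'
      rw [Finset.mem_insert, Finset.mem_insert, Finset.mem_erase, mem_crit]
      split_ifs at hj' with h1 h2
      · exact absurd hj' one_ne_two
      · tauto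
      · exact Or.inr (Or.inr ⟨h1, hj'⟩)
    have h2 := Finset.card_le_card h1
    have h3 := Finset.card_insert_le a (insert b (η.crit.erase (a + b - i)))
    have h4 := Finset.card_insert_le b (η.crit.erase (a + b - i))
    have h5 := Finset.card_erase_add_one hk
    omega

variable {η} {ξ : FinConfig}

lemma le_iff : ξ ≤ η ↔ ∀ j, ξ.1 j = two → η.1 j = two := config_le_iff (ξ := ξ.1) (η := η.1)

/-- An avalanche lowers `η` only at the mirror image of `i`, where `ξ` is already `1`. A birth
lowers nothing, so the hypothesis is only an implication. -/
lemma le_toppleFin {i : ℤ} (h : η.1 i = two → ξ.1 (reflect i η.1) = one) (hle : ξ ≤ η) :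
    ξ ≤ toppleFin i η := by
  rw [le_iff] at hle ⊢
  intro j hj
  change topple i η.1 j = two
  rcases eq_one_or_two (η.1 i) with hi | hi
  · rw [topple_of_eq_one hi, Function.update_apply, hle j hj]
    simp
  · obtain ⟨a, b, hg⟩ := η.exists_isGap hi
    refine hg.topple_eq_two (fun h' => ?_) (hle j hj)
    rw [hg.reflect_eq, ← h'] at h
    exact one_ne_two ((h hi).symm.trans hj)

lemma toppleFin_le {i : ℤ} (hi : η.1 i = two) (hi' : ξ.1 i = one) (hle : ξ ≤ η) :
    toppleFin i ξ ≤ η := by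
  rw [le_iff] at hle ⊢
  intro j hj
  have hj' : topple i ξ.1 j = two := hj
  rw [topple_of_eq_one hi', Function.update_apply] at hj'
  split_ifs at hj' with h
  · rw [h, hi]
  · exact hle j hj'

lemma toppleFin_le_toppleFin {i : ℤ} (hi : η.1 i = one) (hle : ξ ≤ η) :
    toppleFin i ξ ≤ toppleFin i η := by
  have hi' : ξ.1 i = one := eq_one_of_le (hle i) hi
  refine toppleFin_le ?_ hi' (le_toppleFin (fun h => absurd (hi.symm.trans h) one_ne_two) hle)
  change topple i η.1 i = two
  rw [topple_of_eq_one hi, Function.update_self]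

/-- Both avalanches empty the same site. Since `ξ ≤ η`, the gap of `ξ` around this site is contained
in the gap of `η`, so the ends filled in `ξ` lie in the closed gap of `η`; there the toppled `η` is
critical everywhere except at the common hole. -/
lemma toppleFin_reflect_le {i : ℤ} (hi : η.1 i = two) (hk : ξ.1 (reflect i η.1) = two)
    (hle : ξ ≤ η) : toppleFin (reflect (reflect i η.1) ξ.1) ξ ≤ toppleFin i η := by
  obtain ⟨a, b, hg⟩ := η.exists_isGap hi
  obtain ⟨a', b', hg'⟩ := ξ.exists_isGap hk
  rw [hg.reflect_eq] at hg' hk ⊢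
  rw [hg'.reflect_eq]
  rw [le_iff] at hle ⊢
  intro j hj
  have hj' : topple (a' + b' - (a + b - i)) ξ.1 j = two := hj
  rw [hg'.symm.topple_apply] at hj'
  change topple i η.1 j = two
  have hk1 := hg.symm.lt_left
  have hk2 := hg.symm.lt_right
  have hk1' := hg'.lt_left
  have hk2' := hg'.lt_right
  have ha : a ≤ a' := by
    by_contra! h
    have := hle a (hg'.between a h (by omega))
    exact one_ne_two (hg.left.symm.trans this)
  have hb : b' ≤ b := by
    by_contra! h
    have := hle b (hg'.between b (by omega) h)
    exact one_ne_two (hg.right.symm.trans this)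
  split_ifs at hj' with h1 h2
  · exact absurd hj' one_ne_two
  · exact hg.topple_eq_two_of_mem (by omega) (by omega) (by omega)
  · exact hg.topple_eq_two (by omega) (hle j hj')

/-- The avalanches of `ξ ≤ η` correspond to those avalanches of `η` whose partner is finite. -/
lemma sum_partner (hle : ξ ≤ η) (h : ℤ → ℝ) :
    ∑ i ∈ η.crit with ξ.1 (reflect i η.1) = two, h (reflect (reflect i η.1) ξ.1)
      = ∑ j ∈ ξ.crit, h j := by
  rw [le_iff] at hle
  -- The correspondence is a composition of two involutive reflections; its inverse composes them in
  -- the opposite order.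
  refine Finset.sum_nbij' (fun i => reflect (reflect i η.1) ξ.1)
    (fun j => reflect (reflect j ξ.1) η.1) ?_ ?_ ?_ ?_ ?_
  · intro i hi
    exact ξ.mem_crit.2 (ξ.reflect_eq_two (Finset.mem_filter.1 hi).2)
  · intro j hj
    have hj := ξ.mem_crit.1 hj
    have h1 := hle _ (ξ.reflect_eq_two hj)
    refine Finset.mem_filter.2 ⟨η.mem_crit.2 (η.reflect_eq_two h1), ?_⟩
    rw [η.reflect_reflect h1]
    exact ξ.reflect_eq_two hj
  · intro i hi
    rw [Finset.mem_filter, mem_crit] at hi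
    rw [ξ.reflect_reflect hi.2, η.reflect_reflect hi.1]
  · intro j hj
    have hj := ξ.mem_crit.1 hj
    have h1 := hle _ (ξ.reflect_eq_two hj)
    rw [η.reflect_reflect h1, ξ.reflect_reflect hj]
  · intro i _
    rfl

lemma tsum_ite_eq (η : FinConfig) {p : ℤ → Prop} [DecidablePred p] (hp : ∀ i, p i → η.1 i = two)
    (h : ℤ → ℝ) : ∑' i, (if p i then h i else 0) = ∑ i ∈ η.crit with p i, h i := by
  rw [tsum_eq_sum (s := η.crit), Finset.sum_filter]
  intro i hi
  rw [if_neg fun h => hi (η.mem_crit.2 (hp i h))]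

end FinConfig

lemma partner_of_two {i : ℤ} {η ξ : FinConfig} (h : ξ.1 (reflect i η.1) = two) :
    toppleExt (partner i η ξ) ξ = toppleFin (reflect (reflect i η.1) ξ.1) ξ := by
  rw [partner, if_pos h]
  rfl

lemma partner_of_one {i : ℤ} {η ξ : FinConfig} (h : ξ.1 (reflect i η.1) = one) :
    toppleExt (partner i η ξ) ξ = ξ := by
  rw [partner, if_neg (by rw [h]; exact one_ne_two)]
  rfl

end Sandpile

namespace Sandpile

/-! ### Generators with finitely many transitions -/

section JumpMeasure

variable {E : Type*} [MeasurableSpace E] [DiscreteMeasurableSpace E]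

/-- The measure which puts mass `1` on each element of a multiset. -/
noncomputable def diracSum (M : Multiset E) : Measure E := (M.map Measure.dirac).sum

lemma diracSum_cons (y : E) (M : Multiset E) :
    diracSum (y ::ₘ M) = Measure.dirac y + diracSum M := by simp [diracSum]

instance (M : Multiset E) : IsFiniteMeasure (diracSum M) := by
  induction M using Multiset.induction with
  | empty => simp only [diracSum, Multiset.map_zero, Multiset.sum_zero]; infer_instance
  | cons y M ih => rw [diracSum_cons]; infer_instance

lemma diracSum_real_univ (M : Multiset E) : (diracSum M).real Set.univ = M.card := by
  induction M using Multiset.induction with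
  | empty => simp [diracSum]
  | cons y M ih => rw [diracSum_cons, measureReal_add_apply, ih]; simp [add_comm]

lemma ae_diracSum (M : Multiset E) {p : E → Prop} (h : ∀ y ∈ M, p y) :
    ∀ᵐ y ∂(diracSum M), p y := by
  induction M using Multiset.induction with
  | empty => simp [diracSum]
  | cons y M ih =>
    rw [diracSum_cons, ae_add_measure_iff]
    refine ⟨?_, ih fun z hz => h z (Multiset.mem_cons_of_mem hz)⟩
    rw [ae_dirac_eq]
    exact h y (Multiset.mem_cons_self y M)

lemma integral_diracSum (M : Multiset E) {f : E → ℝ} (hf : ∃ C, ∀ y, |f y| ≤ C) :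
    ∫ y, f y ∂(diracSum M) = (M.map f).sum := by
  induction M using Multiset.induction with
  | empty => simp [diracSum]
  | cons y M ih =>
    rw [diracSum_cons, integral_add_measure (integrable_discrete hf) (integrable_discrete hf), ih]
    simp

/-- The generator `G` has the transitions `x → y` at rate `1` for `y` in the multiset `M x`, and
`V` increases at most by `1` in each transition and dominates the total rate. -/
structure IsJumpGenerator (G : (E → ℝ) → E → ℝ) (M : E → Multiset E) (V : E → ℝ) : Prop where
  pos : ∀ x, 0 < V x
  card_le : ∀ x, ((M x).card : ℝ) ≤ V x
  step : ∀ x, ∀ y ∈ M x, V y ≤ V x + 1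
  eq : ∀ f x, G f x = ((M x).map fun y => f y - f x).sum

namespace IsJumpGenerator

variable {G : (E → ℝ) → E → ℝ} {M : E → Multiset E} {V : E → ℝ}

lemma eq_integral (h : IsJumpGenerator G M V) {f : E → ℝ} (hf : ∃ C, ∀ y, |f y| ≤ C) (x : E) :
    G f x = ∫ y, (f y - f x) ∂(diracSum (M x)) := by
  obtain ⟨C, hC⟩ := hf
  rw [h.eq, integral_diracSum]
  exact ⟨C + C, fun y => (abs_sub _ _).trans (add_le_add (hC _) (hC _))⟩

lemma card_le' (h : IsJumpGenerator G M V) (x : E) : (diracSum (M x)).real Set.univ ≤ V x := by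
  rw [diracSum_real_univ]
  exact h.card_le x

theorem exists_generates [Countable E] (h : IsJumpGenerator G M V) : ∃ P, Generates G P :=
  Sandpile.exists_generates (J := fun x => diracSum (M x)) h.pos h.card_le'
    (fun x => ae_diracSum _ (h.step x)) fun _ hf x => h.eq_integral hf x

variable {P : E → Measure (StepPath E)} {D : Set E}

theorem ae_mem (h : IsJumpGenerator G M V) (hP : IsChainWithGenerator G P)
    (hD : ∀ x ∈ D, ∀ y ∈ M x, y ∈ D) {x : E} (hx : x ∈ D) (t : ℝ≥0) :
    ∀ᵐ ω ∂(P x), ω.eval t ∈ D :=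
  hP.ae_mem (J := fun x => diracSum (M x)) h.pos h.card_le'
    (fun x => ae_diracSum _ (h.step x)) (fun x hx => ae_diracSum _ (hD x hx))
    (fun _ hf x _ => h.eq_integral hf x) hx t

theorem map_eq (h : IsJumpGenerator G M V) (hP : IsChainWithGenerator G P)
    (hD : ∀ x ∈ D, ∀ y ∈ M x, y ∈ D)
    {E' : Type*} [MeasurableSpace E'] [DiscreteMeasurableSpace E']
    {G' : (E' → ℝ) → E' → ℝ} {P' : E' → Measure (StepPath E')} (hP' : IsChainWithGenerator G' P')
    {π : E → E'} (hG' : ∀ f, ∀ x ∈ D, G (f ∘ π) x = G' f (π x)) {x : E} (hx : x ∈ D) :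
    (P x).map (StepPath.map π) = P' (π x) :=
  hP.map_eq (J := fun x => diracSum (M x)) hP' h.pos h.card_le'
    (fun x => ae_diracSum _ (h.step x)) (fun x hx => ae_diracSum _ (hD x hx))
    (fun _ hf x _ => h.eq_integral hf x) (fun f hf x hx => by
      exact (hG' f x hx).symm.trans (h.eq_integral (f := f ∘ π) (hf.imp fun C hC y => hC _) x)) hx

end IsJumpGenerator

/-- By right-continuity the value at `t` persists on an interval to the right of `t`, which contains
a point of the dense sequence. This upgrades countably many almost sure statements to all times. -/
lemma StepPath.exists_dense_mem {E : Type*} {D : Set E} {ω : StepPath E}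
    (h : ∀ n, ω.eval (TopologicalSpace.denseSeq ℝ≥0 n) ∈ D) (t : ℝ≥0) : ω.eval t ∈ D := by
  obtain ⟨u, hu, hsub⟩ := mem_nhdsGT_iff_exists_Ioo_subset.1 (ω.2.1 t)
  obtain ⟨_, ⟨hy, ⟨n, rfl⟩⟩⟩ := (TopologicalSpace.denseRange_denseSeq ℝ≥0).inter_open_nonempty _
    isOpen_Ioo (Set.nonempty_Ioo.2 hu)
  have h1 : ω.1 (TopologicalSpace.denseSeq ℝ≥0 n) = ω.1 t := hsub hy
  have h2 := h n
  rw [StepPath.eval, h1] at h2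
  exact h2

end JumpMeasure

lemma sum_map_val {ι E : Type*} (s : Finset ι) (t : ι → E) (g : E → ℝ) :
    ((s.val.map t).map g).sum = ∑ i ∈ s, g (t i) := by
  rw [Multiset.map_map]
  rfl

/-! ### The generators of the sandpile processes -/

/-- The transitions of `L_a`. -/
noncomputable def movesA (η : FinConfig) : Multiset FinConfig :=
  η.crit.val.map fun i => toppleFin i η

/-- The births in `[-n,n]`. -/
noncomputable def births (n : ℕ) (η : FinConfig) : Multiset FinConfig :=
  ((Finset.Icc (-(n : ℤ)) n).filter fun i => η.1 i = one).val.map fun i => toppleFin i η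

lemma genA_eq (f : FinConfig → ℝ) (η : FinConfig) :
    genA f η = ∑ i ∈ η.crit, (f (toppleFin i η) - f η) := by
  rw [genA, η.tsum_ite_eq (p := fun i => η.1 i = two) (fun _ h => h)
    (fun i => f (toppleFin i η) - f η), Finset.filter_true_of_mem fun i hi => η.mem_crit.1 hi]

lemma gen_eq (n : ℕ) (f : FinConfig → ℝ) (η : FinConfig) :
    gen n f η = ∑ i ∈ η.crit, (f (toppleFin i η) - f η)
      + ∑ i ∈ Finset.Icc (-(n : ℤ)) n with η.1 i = one, (f (toppleFin i η) - f η) := by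
  rw [gen, Finset.sum_filter, ← genA_eq]
  rfl

lemma isJumpGenerator_genA :
    IsJumpGenerator genA movesA fun η => (η.crit.card : ℝ) + 1 where
  pos _ := by positivity
  card_le η := by simp [movesA]
  step η ξ hξ := by
    obtain ⟨i, -, rfl⟩ := Multiset.mem_map.1 hξ
    have := η.card_crit_toppleFin_le i
    norm_cast
    omega
  eq f η := by rw [genA_eq, movesA, sum_map_val]

lemma card_Icc_neg (n : ℕ) (p : ℤ → Prop) [DecidablePred p] :
    ((Finset.Icc (-(n : ℤ)) n).filter fun i => p i).card ≤ 2 * n + 1 := by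
  refine (Finset.card_filter_le _ _).trans ?_
  rw [Int.card_Icc]
  omega

/-- In `V` the number of critical sites accounts for the avalanches and `2 * n + 1` for the possible
births in `[-n,n]`. -/
lemma isJumpGenerator_gen (n : ℕ) : IsJumpGenerator (gen n) (fun η => movesA η + births n η)
    fun η => (η.crit.card : ℝ) + (2 * n + 1) where
  pos _ := by positivity
  card_le η := by
    have := card_Icc_neg n fun i => η.1 i = one
    simp only [Multiset.card_add, movesA, births, Multiset.card_map, Finset.card_val]
    norm_cast
    omega
  step η ξ hξ := by
    have : ∃ i, toppleFin i η = ξ := by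
      rcases Multiset.mem_add.1 hξ with h | h
      all_goals
        obtain ⟨i, -, rfl⟩ := Multiset.mem_map.1 h
        exact ⟨i, rfl⟩
    obtain ⟨i, rfl⟩ := this
    have := η.card_crit_toppleFin_le i
    norm_cast
    omega
  eq f η := by
    rw [gen_eq, Multiset.map_add, Multiset.sum_add, movesA, births, sum_map_val, sum_map_val]

/-! ### The coupling generators -/

/-- The transitions of `L_a^c`. -/
noncomputable def movesAC (p : FinConfig × FinConfig) : Multiset (FinConfig × FinConfig) :=
  p.1.crit.val.map fun i => (toppleFin i p.1, toppleExt (partner i p.1 p.2) p.2)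

/-- The transitions of `L^{c,(n)}`. -/
noncomputable def movesC (n : ℕ) (p : FinConfig × FinConfig) : Multiset (FinConfig × FinConfig) :=
  (p.1.crit.filter fun i => p.2.1 (reflect i p.1.1) = two).val.map
    (fun i => (toppleFin i p.1, toppleExt (partner i p.1 p.2) p.2))
  + ((Finset.Icc (-(n : ℤ)) n).filter fun i => p.1.1 i = two ∧ p.2.1 i = one).val.map
    (fun i => (p.1, toppleFin i p.2))
  + ((Finset.Icc (-(n : ℤ)) n).filter fun i => p.1.1 i = one ∧ p.2.1 i = one).val.map
    (fun i => (toppleFin i p.1, toppleFin i p.2))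
  + (p.1.crit.filter fun i => p.2.1 (reflect i p.1.1) = one).val.map
    (fun i => (toppleFin i p.1, p.2))

/-- The additional transitions of `L^{c,n+1,n}`. -/
noncomputable def movesExtra (n : ℕ) (p : FinConfig × FinConfig) :
    Multiset (FinConfig × FinConfig) :=
  (({-(n : ℤ) - 1, (n : ℤ) + 1} : Finset ℤ).filter fun i => p.1.1 i = one ∧ p.2.1 i = one).val.map
    (fun i => (toppleFin i p.1, p.2))

lemma genAC_eq (f : FinConfig × FinConfig → ℝ) (p : FinConfig × FinConfig) :
    genAC f p = ∑ i ∈ p.1.crit, (f (toppleFin i p.1, toppleExt (partner i p.1 p.2) p.2) - f p) := by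
  rw [genAC, p.1.tsum_ite_eq (p := fun i => p.1.1 i = two) (fun _ h => h)
    (fun i => f (toppleFin i p.1, toppleExt (partner i p.1 p.2) p.2) - f p),
    Finset.filter_true_of_mem fun i hi => p.1.mem_crit.1 hi]

lemma tsum_two_eq (p : FinConfig × FinConfig) (h : Height) (g : ℤ → ℝ) :
    (∑' i : ℤ, if p.1.1 i = two ∧ p.2.1 (reflect i p.1.1) = h then g i else 0)
      = ∑ i ∈ p.1.crit with p.2.1 (reflect i p.1.1) = h, g i := by
  rw [p.1.tsum_ite_eq (p := fun i => p.1.1 i = two ∧ p.2.1 (reflect i p.1.1) = h)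
    (fun _ h => h.1) g]
  refine Finset.sum_congr (Finset.filter_congr fun i hi => ?_) fun _ _ => rfl
  exact and_iff_right (p.1.mem_crit.1 hi)

lemma genC_eq (n : ℕ) (f : FinConfig × FinConfig → ℝ) (p : FinConfig × FinConfig) :
    genC n f p
      = ∑ i ∈ p.1.crit with p.2.1 (reflect i p.1.1) = two,
          (f (toppleFin i p.1, toppleExt (partner i p.1 p.2) p.2) - f p)
      + ∑ i ∈ Finset.Icc (-(n : ℤ)) n with p.1.1 i = two ∧ p.2.1 i = one,
          (f (p.1, toppleFin i p.2) - f p)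
      + ∑ i ∈ Finset.Icc (-(n : ℤ)) n with p.1.1 i = one ∧ p.2.1 i = one,
          (f (toppleFin i p.1, toppleFin i p.2) - f p)
      + ∑ i ∈ p.1.crit with p.2.1 (reflect i p.1.1) = one, (f (toppleFin i p.1, p.2) - f p) := by
  rw [genC, tsum_two_eq p two fun i =>
    f (toppleFin i p.1, toppleExt (partner i p.1 p.2) p.2) - f p,
    tsum_two_eq p one fun i => f (toppleFin i p.1, p.2) - f p]
  simp only [Finset.sum_filter]

lemma genCSucc_eq (n : ℕ) (f : FinConfig × FinConfig → ℝ) (p : FinConfig × FinConfig) :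
    genCSucc n f p = genC n f p
      + ∑ i ∈ ({-(n : ℤ) - 1, (n : ℤ) + 1} : Finset ℤ) with p.1.1 i = one ∧ p.2.1 i = one,
          (f (toppleFin i p.1, p.2) - f p) := by
  rw [genCSucc, genC, Finset.sum_filter]
  ring

lemma isJumpGenerator_genAC :
    IsJumpGenerator genAC movesAC fun p => (p.1.crit.card : ℝ) + 1 where
  pos _ := by positivity
  card_le p := by simp [movesAC]
  step p p' hp' := by
    obtain ⟨i, -, rfl⟩ := Multiset.mem_map.1 hp'
    have := p.1.card_crit_toppleFin_le i
    norm_cast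
    simp only
    omega
  eq f p := by rw [genAC_eq, movesAC, sum_map_val]

lemma movesC_fst {n : ℕ} {p p' : FinConfig × FinConfig} (h : p' ∈ movesC n p) :
    p'.1.crit.card ≤ p.1.crit.card + 1 := by
  simp only [movesC, Multiset.mem_add, Multiset.mem_map] at h
  rcases h with ((⟨i, -, rfl⟩ | ⟨i, -, rfl⟩) | ⟨i, -, rfl⟩) | ⟨i, -, rfl⟩
  · exact p.1.card_crit_toppleFin_le i
  · exact Nat.le_succ _
  · exact p.1.card_crit_toppleFin_le i
  · exact p.1.card_crit_toppleFin_le i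

lemma card_movesC (n : ℕ) (p : FinConfig × FinConfig) :
    (movesC n p).card ≤ p.1.crit.card + (4 * n + 2) := by
  have h1 := card_Icc_neg n fun i => p.1.1 i = two ∧ p.2.1 i = one
  have h2 := card_Icc_neg n fun i => p.1.1 i = one ∧ p.2.1 i = one
  have h3 := Finset.card_filter_add_card_filter_not (s := p.1.crit)
    fun i => p.2.1 (reflect i p.1.1) = two
  simp only [movesC, Multiset.card_add, Multiset.card_map, Finset.card_val]
  simp only [← ne_eq, ne_two_iff] at h3
  omega

/-- Every coupled transition is indexed by a critical site of the first configuration or by a birth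
site, so `V` need not involve the second configuration and no order is assumed. The constant allows
for two families of at most `2 * n + 1` births each and leaves room for the two extra births of
`genCSucc`. -/
lemma isJumpGenerator_genC (n : ℕ) :
    IsJumpGenerator (genC n) (movesC n) fun p => (p.1.crit.card : ℝ) + (4 * n + 4) where
  pos _ := by positivity
  card_le p := by
    have := card_movesC n p
    norm_cast
    omega
  step p p' hp' := by
    have := movesC_fst hp'
    norm_cast
    omega
  eq f p := by simp only [genC_eq, movesC, Multiset.map_add, Multiset.sum_add, sum_map_val]

lemma isJumpGenerator_genCSucc (n : ℕ) :
    IsJumpGenerator (genCSucc n) (fun p => movesC n p + movesExtra n p)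
      fun p => (p.1.crit.card : ℝ) + (4 * n + 4) where
  pos _ := by positivity
  card_le p := by
    have h1 := card_movesC n p
    have h2 : (movesExtra n p).card ≤ 2 := by
      rw [movesExtra, Multiset.card_map, Finset.card_val]
      exact (Finset.card_filter_le _ _).trans Finset.card_le_two
    rw [Multiset.card_add]
    norm_cast
    omega
  step p p' hp' := by
    have : p'.1.crit.card ≤ p.1.crit.card + 1 := by
      rcases Multiset.mem_add.1 hp' with h | h
      · exact movesC_fst h
      · obtain ⟨i, -, rfl⟩ := Multiset.mem_map.1 h
        exact p.1.card_crit_toppleFin_le i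
    norm_cast
    omega
  eq f p := by
    rw [genCSucc_eq, (isJumpGenerator_genC n).eq, Multiset.map_add, Multiset.sum_add, movesExtra,
      sum_map_val]

/-! ### Ordered pairs -/

/-- The ordered pairs of configurations. -/
def orderedPairs : Set (FinConfig × FinConfig) := {p | p.2 ≤ p.1}

lemma toppleExt_partner_le {i : ℤ} {η ξ : FinConfig} (hi : η.1 i = two) (hle : ξ ≤ η) :
    toppleExt (partner i η ξ) ξ ≤ toppleFin i η := by
  rcases eq_one_or_two (ξ.1 (reflect i η.1)) with h | h
  · rw [partner_of_one h]
    exact FinConfig.le_toppleFin (fun _ => h) hle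
  · rw [partner_of_two h]
    exact FinConfig.toppleFin_reflect_le hi h hle

lemma movesAC_mem {p : FinConfig × FinConfig} (hp : p ∈ orderedPairs)
    {p' : FinConfig × FinConfig} (h : p' ∈ movesAC p) : p' ∈ orderedPairs := by
  obtain ⟨i, hi, rfl⟩ := Multiset.mem_map.1 h
  exact toppleExt_partner_le (p.1.mem_crit.1 hi) hp

lemma movesC_mem {n : ℕ} {p : FinConfig × FinConfig} (hp : p ∈ orderedPairs)
    {p' : FinConfig × FinConfig} (h : p' ∈ movesC n p) : p' ∈ orderedPairs := by
  simp only [movesC, Multiset.mem_add, Multiset.mem_map, Finset.mem_val, Finset.mem_filter] at h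
  rcases h with ((⟨i, hi, rfl⟩ | ⟨i, hi, rfl⟩) | ⟨i, hi, rfl⟩) | ⟨i, hi, rfl⟩
  · exact toppleExt_partner_le (p.1.mem_crit.1 hi.1) hp
  · exact FinConfig.toppleFin_le hi.2.1 hi.2.2 hp
  · exact FinConfig.toppleFin_le_toppleFin hi.2.1 hp
  · exact FinConfig.le_toppleFin (fun _ => hi.2) hp

lemma movesExtra_mem {n : ℕ} {p : FinConfig × FinConfig} (hp : p ∈ orderedPairs)
    {p' : FinConfig × FinConfig} (h : p' ∈ movesExtra n p) : p' ∈ orderedPairs := by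
  obtain ⟨i, hi, rfl⟩ := Multiset.mem_map.1 h
  rw [Finset.mem_val, Finset.mem_filter] at hi
  exact FinConfig.le_toppleFin (fun h => absurd (hi.2.1.symm.trans h) one_ne_two) hp

lemma genAC_fst (f : FinConfig → ℝ) (p : FinConfig × FinConfig) :
    genAC (f ∘ Prod.fst) p = genA f p.1 := by
  rw [genAC_eq, genA_eq]
  rfl

lemma sum_partner_eq (f : FinConfig → ℝ) {p : FinConfig × FinConfig} (hp : p ∈ orderedPairs) :
    ∑ i ∈ p.1.crit with p.2.1 (reflect i p.1.1) = two,
      (f (toppleExt (partner i p.1 p.2) p.2) - f p.2)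
      = ∑ i ∈ p.2.crit, (f (toppleFin i p.2) - f p.2) := by
  rw [← FinConfig.sum_partner hp]
  refine Finset.sum_congr rfl fun i hi => ?_
  rw [partner_of_two (Finset.mem_filter.1 hi).2]

/-- Avalanches with infinite partner are invisible in the second coordinate; the others run through
the critical sites of the second configuration exactly once. -/
lemma genAC_snd (f : FinConfig → ℝ) {p : FinConfig × FinConfig} (hp : p ∈ orderedPairs) :
    genAC (f ∘ Prod.snd) p = genA f p.2 := by
  rw [genAC_eq, genA_eq, ← sum_partner_eq f hp, Finset.sum_filter]
  refine Finset.sum_congr rfl fun i hi => ?_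
  split_ifs with h
  · rfl
  · simp [partner_of_one (ne_two_iff.1 h)]

lemma sum_crit_split (p : FinConfig × FinConfig) (g : ℤ → ℝ) :
    ∑ i ∈ p.1.crit with p.2.1 (reflect i p.1.1) = two, g i
      + ∑ i ∈ p.1.crit with p.2.1 (reflect i p.1.1) = one, g i = ∑ i ∈ p.1.crit, g i := by
  rw [← Finset.sum_filter_add_sum_filter_not p.1.crit
    (fun i => p.2.1 (reflect i p.1.1) = two) g]
  congr 2
  exact Finset.filter_congr fun i _ => ne_two_iff.symm

lemma filter_one_one {p : FinConfig × FinConfig} (hp : p ∈ orderedPairs) (s : Finset ℤ) :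
    s.filter (fun i => p.1.1 i = one ∧ p.2.1 i = one) = s.filter fun i => p.1.1 i = one :=
  Finset.filter_congr fun i _ => ⟨fun h => h.1, fun h => ⟨h, eq_one_of_le (hp i) h⟩⟩

lemma genC_fst (n : ℕ) (f : FinConfig → ℝ) {p : FinConfig × FinConfig} (hp : p ∈ orderedPairs) :
    genC n (f ∘ Prod.fst) p = gen n f p.1 := by
  rw [genC_eq, gen_eq, ← sum_crit_split p, filter_one_one hp]
  simp only [Function.comp_apply, sub_self, Finset.sum_const_zero]
  ring

/-- The births of the second configuration are split by the height of the first one: at a site which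
is critical there the second configuration moves alone, otherwise both move. -/
lemma genC_snd (n : ℕ) (f : FinConfig → ℝ) {p : FinConfig × FinConfig} (hp : p ∈ orderedPairs) :
    genC n (f ∘ Prod.snd) p = gen n f p.2 := by
  rw [genC_eq, gen_eq, ← sum_partner_eq f hp]
  simp only [Function.comp_apply, sub_self, Finset.sum_const_zero, add_zero]
  rw [add_assoc, ← Finset.sum_filter_add_sum_filter_not
    (Finset.filter (fun i => p.2.1 i = one) (Finset.Icc (-(n : ℤ)) n)) (fun i => p.1.1 i = two)]
  rw [Finset.filter_filter, Finset.filter_filter]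
  congr 3
  · exact Finset.filter_congr fun i _ => and_comm
  · exact Finset.filter_congr fun i _ => by rw [← ne_eq, ne_two_iff, and_comm]

/-- The two extra sites complete `[-n,n]` to `[-(n+1),n+1]`, and for ordered pairs a `1` in the
larger configuration forces a `1` in the smaller one. -/
lemma genCSucc_fst (n : ℕ) (f : FinConfig → ℝ) {p : FinConfig × FinConfig}
    (hp : p ∈ orderedPairs) : genCSucc n (f ∘ Prod.fst) p = gen (n + 1) f p.1 := by
  rw [genCSucc_eq, genC_fst n f hp, gen_eq, gen_eq, filter_one_one hp, add_assoc]
  congr 1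
  have h : Finset.Icc (-((n + 1 : ℕ) : ℤ)) ((n + 1 : ℕ) : ℤ)
      = Finset.Icc (-(n : ℤ)) n ∪ {-(n : ℤ) - 1, (n : ℤ) + 1} := by
    ext i
    simp only [Finset.mem_union, Finset.mem_Icc, Finset.mem_insert, Finset.mem_singleton]
    omega
  rw [h, Finset.filter_union, Finset.sum_union]
  · rfl
  · refine Finset.disjoint_filter_filter (Finset.disjoint_left.2 fun i hi hi' => ?_)
    simp only [Finset.mem_Icc, Finset.mem_insert, Finset.mem_singleton] at hi hi'
    omega

lemma genCSucc_snd (n : ℕ) (f : FinConfig → ℝ) {p : FinConfig × FinConfig}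
    (hp : p ∈ orderedPairs) : genCSucc n (f ∘ Prod.snd) p = gen n f p.2 := by
  rw [genCSucc_eq, genC_snd n f hp]
  simp

/-- The ordered pairs are closed under all transitions, and on them the coupling generator is
intertwined with the marginal generators by the two projections, so the path laws of the coordinates
are identified by `IsJumpGenerator.map_eq`. -/
lemma isOrderedCoupling {G : (FinConfig × FinConfig → ℝ) → FinConfig × FinConfig → ℝ}
    {M : FinConfig × FinConfig → Multiset (FinConfig × FinConfig)} {V : FinConfig × FinConfig → ℝ}
    (h : IsJumpGenerator G M V) (hD : ∀ p ∈ orderedPairs, ∀ p' ∈ M p, p' ∈ orderedPairs)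
    {G₁ G₂ : (FinConfig → ℝ) → FinConfig → ℝ}
    (h1 : ∀ f, ∀ p ∈ orderedPairs, G (f ∘ Prod.fst) p = G₁ f p.1)
    (h2 : ∀ f, ∀ p ∈ orderedPairs, G (f ∘ Prod.snd) p = G₂ f p.2)
    {P : FinConfig × FinConfig → Measure (StepPath (FinConfig × FinConfig))}
    {P₁ P₂ : FinConfig → Measure (StepPath FinConfig)} (hP : IsChainWithGenerator G P)
    (hP₁ : IsChainWithGenerator G₁ P₁) (hP₂ : IsChainWithGenerator G₂ P₂) :
    IsOrderedCoupling P P₁ P₂ := by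
  intro η ξ hle
  have hx : (η, ξ) ∈ orderedPairs := hle
  refine ⟨h.map_eq hP hD hP₁ h1 hx, h.map_eq hP hD hP₂ h2 hx, ?_⟩
  have := ae_all_iff.2 fun n => h.ae_mem hP hD hx (TopologicalSpace.denseSeq ℝ≥0 n)
  filter_upwards [this] with ω hω t
  exact StepPath.exists_dense_mem hω t

/-- An increasing functional of the path has ordered expectations. -/
lemma IsOrderedCoupling.integral_le
    {P : FinConfig × FinConfig → Measure (StepPath (FinConfig × FinConfig))}
    {P₁ P₂ : FinConfig → Measure (StepPath FinConfig)} (h : IsOrderedCoupling P P₁ P₂)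
    (hP : ∀ p, IsProbabilityMeasure (P p)) {H : StepPath FinConfig → ℝ} (hH : Measurable H)
    (hb : ∃ C, ∀ ω, |H ω| ≤ C)
    (hmono : ∀ ω ω' : StepPath FinConfig, (∀ t, ω.eval t ≤ ω'.eval t) → H ω ≤ H ω')
    {η ξ : FinConfig} (hle : ξ ≤ η) : ∫ ω, H ω ∂(P₂ ξ) ≤ ∫ ω, H ω ∂(P₁ η) := by
  obtain ⟨h1, h2, h3⟩ := h η ξ hle
  have := hP (η, ξ)
  have m1 : Measurable (StepPath.map Prod.fst : StepPath (FinConfig × FinConfig) → _) :=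
    measurable_stepPath_map measurable_fst
  have m2 : Measurable (StepPath.map Prod.snd : StepPath (FinConfig × FinConfig) → _) :=
    measurable_stepPath_map measurable_snd
  rw [← h1, ← h2, integral_map m1.aemeasurable hH.aestronglyMeasurable,
    integral_map m2.aemeasurable hH.aestronglyMeasurable]
  refine integral_mono_ae (integrable_of_abs_le (hH.comp m2) (hb.imp fun C hC ω => hC _))
    (integrable_of_abs_le (hH.comp m1) (hb.imp fun C hC ω => hC _)) ?_
  filter_upwards [h3] with ω hω
  exact hmono _ _ hω

lemma IsOrderedCoupling.transition_le
    {P : FinConfig × FinConfig → Measure (StepPath (FinConfig × FinConfig))}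
    {P₁ P₂ : FinConfig → Measure (StepPath FinConfig)} (h : IsOrderedCoupling P P₁ P₂)
    (hP : ∀ p, IsProbabilityMeasure (P p)) (t : ℝ≥0) {f : FinConfig → ℝ} (hf : Monotone f)
    (hb : ∃ C, ∀ η, |f η| ≤ C) {η ξ : FinConfig} (hle : ξ ≤ η) :
    transition StepPath.eval P₂ t f ξ ≤ transition StepPath.eval P₁ t f η :=
  h.integral_le hP (Measurable.of_discrete.comp (measurable_eval t))
    (hb.imp fun _ hC _ => hC _) (fun _ _ hω => hf (hω t)) hle

lemma IsOrderedCoupling.monotone_process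
    {P : FinConfig × FinConfig → Measure (StepPath (FinConfig × FinConfig))}
    {P₁ : FinConfig → Measure (StepPath FinConfig)} (h : IsOrderedCoupling P P₁ P₁)
    (hP : ∀ p, IsProbabilityMeasure (P p)) (hP₁ : ∀ η, IsProbabilityMeasure (P₁ η)) :
    IsMonotoneProcess P₁ := fun t _ hf hb =>
  ⟨fun _ _ hle => h.transition_le hP t hf hb hle,
    hb.imp fun _ hC => abs_transition_le hP₁ t hC⟩

end Sandpile

namespace Sandpile

noncomputable section

/-! ### Monotone extension from `Ω_f` to `Ω` -/

lemma IncreasesTo.le {u : ℕ → FinConfig} {η : Config} (h : IncreasesTo u η) (k : ℕ) :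
    (u k).1 ≤ η :=
  Monotone.ge_of_tendsto (f := fun k => (u k).1) (fun _ _ hij => h.1 hij) h.2 k

lemma IncreasesTo.eventually_eqOn {u : ℕ → FinConfig} {η : Config} (h : IncreasesTo u η)
    (A : Finset ℤ) : ∀ᶠ k in atTop, ∀ x ∈ A, (u k).1 x = η x := by
  refine (Finset.eventually_all A).2 fun x _ => ?_
  have := (tendsto_pi_nhds.1 h.2) x
  rwa [nhds_discrete, tendsto_pure] at this

/-- A configuration in `Ω_f` has finitely many critical sites, and on these the sequence eventually
agrees with its limit. This is what makes limits from below independent of the sequence. -/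
lemma IncreasesTo.eventually_ge {u : ℕ → FinConfig} {η : Config} (h : IncreasesTo u η)
    {ξ : FinConfig} (hξ : ξ.1 ≤ η) : ∀ᶠ k in atTop, ξ ≤ u k := by
  filter_upwards [h.eventually_eqOn ξ.crit] with k hk
  refine FinConfig.le_iff.2 fun j hj => ?_
  rw [hk j ((FinConfig.mem_crit ξ).2 hj)]
  exact eq_two_of_le (hξ j) hj

/-- The configuration `η` with all sites outside `[-n,n]` set to `1`. -/
def trunc (n : ℕ) (η : Config) : FinConfig :=
  ⟨fun x => if |x| ≤ n then η x else one, (Set.finite_Icc (-(n : ℤ)) n).subset fun x hx => by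
    by_contra hx'
    rw [Set.mem_Icc, ← abs_le] at hx'
    exact one_ne_two (by simpa [critical, hx'] using hx)⟩

lemma trunc_apply (n : ℕ) (η : Config) (x : ℤ) :
    (trunc n η).1 x = if |x| ≤ n then η x else one := rfl

lemma trunc_le (n : ℕ) (η : Config) : (trunc n η).1 ≤ η := fun x => by
  rw [trunc_apply]
  split_ifs
  · exact le_rfl
  · exact one_le _

lemma trunc_mono_left {m n : ℕ} (h : m ≤ n) (η : Config) : trunc m η ≤ trunc n η := fun x => by
  rw [trunc_apply, trunc_apply]
  split_ifs with h1 h2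
  · exact le_rfl
  · exact absurd (h1.trans (by exact_mod_cast h)) h2
  · exact one_le _
  · exact le_rfl

lemma trunc_mono_right (n : ℕ) {η ξ : Config} (h : ξ ≤ η) : trunc n ξ ≤ trunc n η := fun x => by
  rw [trunc_apply, trunc_apply]
  split_ifs
  · exact h x
  · exact le_rfl

lemma increasesTo_trunc (η : Config) : IncreasesTo (fun n => trunc n η) η := by
  refine ⟨fun m n h => trunc_mono_left h η, tendsto_pi_nhds.2 fun x => ?_⟩
  refine tendsto_const_nhds.congr' ?_
  filter_upwards [eventually_ge_atTop x.natAbs] with n hn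
  rw [trunc_apply, if_pos (by rw [Int.abs_eq_natAbs]; exact_mod_cast hn)]

/-- The bottom element of `Ω_f`. -/
def allOne : FinConfig := ⟨fun _ => one, by simp [critical, one_ne_two]⟩

lemma allOne_le (η : Config) : allOne.1 ≤ η := fun _ => one_le _

/-- The extension of a monotone function on `Ω_f` to `Ω` by its suprema from below. -/
def extend (g : FinConfig → ℝ) (η : Config) : ℝ := ⨆ ξ : {ξ : FinConfig // ξ.1 ≤ η}, g ξ

section extend

variable {g g' : FinConfig → ℝ} {η : Config}

instance (η : Config) : Nonempty {ξ : FinConfig // ξ.1 ≤ η} := ⟨⟨allOne, allOne_le η⟩⟩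

lemma le_extend (hb : ∃ C, ∀ ξ, |g ξ| ≤ C) {ξ : FinConfig} (h : ξ.1 ≤ η) : g ξ ≤ extend g η :=
  le_ciSup (f := fun ξ : {ξ : FinConfig // ξ.1 ≤ η} => g ξ)
    (hb.elim fun C hC => ⟨C, by rintro _ ⟨ξ, rfl⟩; exact (le_abs_self _).trans (hC _)⟩) ⟨ξ, h⟩

lemma extend_le {c : ℝ} (h : ∀ ξ : FinConfig, ξ.1 ≤ η → g ξ ≤ c) : extend g η ≤ c :=
  ciSup_le fun ξ => h ξ.1 ξ.2

lemma exists_lt_of_lt_extend {c : ℝ} (h : c < extend g η) :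
    ∃ ξ : FinConfig, ξ.1 ≤ η ∧ c < g ξ := by
  obtain ⟨ξ, hξ⟩ := exists_lt_of_lt_ciSup h
  exact ⟨ξ.1, ξ.2, hξ⟩

lemma extend_coe (hg : Monotone g) (hb : ∃ C, ∀ ξ, |g ξ| ≤ C) (ξ : FinConfig) :
    extend g ξ.1 = g ξ :=
  le_antisymm (extend_le fun _ h => hg h) (le_extend hb le_rfl)

lemma extend_mono (hb : ∃ C, ∀ ξ, |g ξ| ≤ C) : Monotone (extend g) := fun _ _ h =>
  extend_le fun _ hξ => le_extend hb (hξ.trans h)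

lemma abs_extend_le {C : ℝ} (hb : ∀ ξ, |g ξ| ≤ C) (η : Config) : |extend g η| ≤ C :=
  abs_le.2 ⟨(abs_le.1 (hb allOne)).1.trans (le_extend ⟨C, hb⟩ (allOne_le η)),
    extend_le fun ξ _ => (abs_le.1 (hb ξ)).2⟩

lemma isOpen_setOf_ge (ξ : FinConfig) : IsOpen {η : Config | ξ.1 ≤ η} := by
  have : {η : Config | ξ.1 ≤ η} = ⋂ x ∈ ξ.crit, (fun η : Config => η x) ⁻¹' {two} := by
    ext η
    simp only [Set.mem_ofPred_eq, config_le_iff, Set.mem_iInter, FinConfig.mem_crit,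
      Set.mem_preimage, Set.mem_singleton_iff]
  rw [this]
  exact isOpen_biInter_finset fun x _ => (isOpen_discrete _).preimage (continuous_apply x)

/-- Lying above a fixed element of `Ω_f` constrains finitely many coordinates and is an open
condition. -/
lemma lowerSemicontinuous_extend (hb : ∃ C, ∀ ξ, |g ξ| ≤ C) :
    LowerSemicontinuous (extend g) := by
  intro η c hc
  obtain ⟨ξ, hξ, h⟩ := exists_lt_of_lt_extend hc
  filter_upwards [(isOpen_setOf_ge ξ).mem_nhds hξ] with η' hη'
  exact h.trans_le (le_extend hb hη')

lemma monotoneClass_extend (hb : ∃ C, ∀ ξ, |g ξ| ≤ C) : MonotoneClass (extend g) :=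
  ⟨extend_mono hb, (lowerSemicontinuous_extend hb).measurable, hb.imp fun _ hC => abs_extend_le hC⟩

/-- Every competitor in the supremum is eventually overtaken by the sequence, which itself consists
of competitors. -/
lemma tendsto_extend (hg : Monotone g) (hb : ∃ C, ∀ ξ, |g ξ| ≤ C) {u : ℕ → FinConfig}
    (hu : IncreasesTo u η) : Tendsto (fun k => g (u k)) atTop (𝓝 (extend g η)) := by
  refine tendsto_order.2 ⟨fun c hc => ?_, fun c hc => ?_⟩
  · obtain ⟨ξ, hξ, h⟩ := exists_lt_of_lt_extend hc
    filter_upwards [hu.eventually_ge hξ] with k hk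
    exact h.trans_le (hg hk)
  · exact Eventually.of_forall fun k => (le_extend hb (hu.le k)).trans_lt hc

lemma extend_le_extend (hb : ∃ C, ∀ ξ, |g' ξ| ≤ C) (h : ∀ ξ, g ξ ≤ g' ξ) (η : Config) :
    extend g η ≤ extend g' η :=
  extend_le fun ξ hξ => (h ξ).trans (le_extend hb hξ)

lemma extend_eq_of_tendsto (hg : Monotone g) (hb : ∃ C, ∀ ξ, |g ξ| ≤ C) {f : ℝ}
    (h : Tendsto (fun n => g (trunc n η)) atTop (𝓝 f)) : extend g η = f :=
  tendsto_nhds_unique (tendsto_extend hg hb (increasesTo_trunc η)) h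

/-- Along truncations, lower semicontinuity bounds the limit from below and monotonicity bounds it
from above. -/
lemma extend_of_lowerSemicontinuous {f : Config → ℝ} (hf : MonotoneClass f)
    (hl : LowerSemicontinuous f) : extend (fun ξ => f ξ.1) = f := by
  funext η
  refine extend_eq_of_tendsto (fun _ _ h => hf.mono h) (hf.bounded.imp fun C hC ξ => hC _) ?_
  refine tendsto_order.2 ⟨fun c hc => ?_, fun c hc => ?_⟩
  · exact (increasesTo_trunc η).2.eventually (hl η c hc)
  · exact Eventually.of_forall fun k => (hf.mono (trunc_le k η)).trans_lt hc

lemma extend_linear (hg : Monotone g) (hb : ∃ C, ∀ ξ, |g ξ| ≤ C) (hg' : Monotone g')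
    (hb' : ∃ C, ∀ ξ, |g' ξ| ≤ C) {a b : ℝ} (ha : 0 ≤ a) (hb0 : 0 ≤ b) (η : Config) :
    extend (fun ξ => a * g ξ + b * g' ξ) η = a * extend g η + b * extend g' η := by
  refine extend_eq_of_tendsto ?_ ?_ (((tendsto_extend hg hb (increasesTo_trunc η)).const_mul a).add
    ((tendsto_extend hg' hb' (increasesTo_trunc η)).const_mul b))
  · exact (hg.const_mul ha).add (hg'.const_mul hb0)
  · obtain ⟨C, hC⟩ := hb
    obtain ⟨C', hC'⟩ := hb'
    refine ⟨a * C + b * C', fun ξ => (abs_add_le _ _).trans ?_⟩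
    rw [abs_mul, abs_mul, abs_of_nonneg ha, abs_of_nonneg hb0]
    gcongr
    · exact hC ξ
    · exact hC' ξ

/-- The suprema over `n` and over configurations below `η` commute. -/
lemma tendsto_extend_of_monotone {g : ℕ → FinConfig → ℝ} {G : FinConfig → ℝ}
    (hm : ∀ n ξ, g n ξ ≤ g (n + 1) ξ) (hb : ∃ C, ∀ n ξ, |g n ξ| ≤ C)
    (hG : ∀ ξ, Tendsto (fun n => g n ξ) atTop (𝓝 (G ξ))) (η : Config) :
    Tendsto (fun n => extend (g n) η) atTop (𝓝 (extend G η)) := by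
  obtain ⟨C, hC⟩ := hb
  have hle : ∀ n ξ, g n ξ ≤ G ξ := fun n ξ =>
    (monotone_nat_of_le_succ fun n => hm n ξ).ge_of_tendsto (hG ξ) n
  have hGC : ∀ ξ, |G ξ| ≤ C := fun ξ =>
    le_of_tendsto (hG ξ).abs (Eventually.of_forall fun n => hC n ξ)
  refine tendsto_order.2 ⟨fun c hc => ?_, fun c hc => ?_⟩
  · obtain ⟨ξ, hξ, h⟩ := exists_lt_of_lt_extend hc
    filter_upwards [(hG ξ).eventually_const_lt h] with n hn
    exact hn.trans_le (le_extend ⟨C, hC n⟩ hξ)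
  · exact Eventually.of_forall fun n => (extend_le_extend ⟨C, hGC⟩ (hle n) η).trans_lt hc

end extend

lemma MonotoneClass.mono_coe {f : Config → ℝ} (hf : MonotoneClass f) :
    Monotone fun ξ : FinConfig => f ξ.1 := fun _ _ h => hf.mono h

lemma MonotoneClass.bounded_coe {f : Config → ℝ} (hf : MonotoneClass f) :
    ∃ C, ∀ ξ : FinConfig, |f ξ.1| ≤ C := hf.bounded.imp fun _ hC ξ => hC ξ.1

/-! ### Semigroups on monotone functions -/

/-- A Markov semigroup on the bounded monotone functions on `Ω_f`. -/
structure IsMonotoneSemigroup (R : ℝ≥0 → (FinConfig → ℝ) → FinConfig → ℝ) : Prop where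
  mono : ∀ t f, Monotone f → (∃ C, ∀ ξ, |f ξ| ≤ C) → Monotone (R t f)
  abs_le : ∀ t f C, Monotone f → (∀ ξ, |f ξ| ≤ C) → ∀ ξ, |R t f ξ| ≤ C
  zero : ∀ f, Monotone f → (∃ C, ∀ ξ, |f ξ| ≤ C) → R 0 f = f
  unit : ∀ t, R t (fun _ => 1) = fun _ => 1
  order : ∀ t f g, Monotone f → Monotone g → (∃ C, ∀ ξ, |f ξ| ≤ C) → (∃ C, ∀ ξ, |g ξ| ≤ C) →
    (∀ ξ, f ξ ≤ g ξ) → ∀ ξ, R t f ξ ≤ R t g ξ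
  linear : ∀ t f g, Monotone f → Monotone g → (∃ C, ∀ ξ, |f ξ| ≤ C) → (∃ C, ∀ ξ, |g ξ| ≤ C) →
    ∀ a b : ℝ, 0 ≤ a → 0 ≤ b → R t (fun ξ => a * f ξ + b * g ξ) = fun ξ => a * R t f ξ + b * R t g ξ
  semigroup : ∀ s t f, Monotone f → (∃ C, ∀ ξ, |f ξ| ≤ C) → R (s + t) f = R s (R t f)

lemma IsMonotoneSemigroup.bounded {R : ℝ≥0 → (FinConfig → ℝ) → FinConfig → ℝ}
    (h : IsMonotoneSemigroup R) (t : ℝ≥0) {f : FinConfig → ℝ} (hf : Monotone f)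
    (hb : ∃ C, ∀ ξ, |f ξ| ≤ C) : ∃ C, ∀ ξ, |R t f ξ| ≤ C :=
  hb.imp fun C hC => h.abs_le t f C hf hC

theorem IsMonotoneSemigroup.isMarkovSemigroup {R : ℝ≥0 → (FinConfig → ℝ) → FinConfig → ℝ}
    (h : IsMonotoneSemigroup R) :
    IsMarkovSemigroup fun t f => extend (R t fun ξ => f ξ.1) where
  maps t f hf := monotoneClass_extend (h.bounded t hf.mono_coe hf.bounded_coe)
  zero f hf hl := by
    rw [h.zero _ hf.mono_coe hf.bounded_coe, extend_of_lowerSemicontinuous hf hl]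
  unit t := by
    rw [h.unit]
    exact funext fun η => ciSup_const
  nonneg t f hf h0 η := by
    refine le_trans ?_ (le_extend (h.bounded t hf.mono_coe hf.bounded_coe) (allOne_le η))
    -- With both coefficients zero, linearity says that the semigroup maps `0` to `0`; nonnegativity
    -- then follows from the order property.
    have h1 := h.linear t (fun ξ => f ξ.1) (fun ξ => f ξ.1) hf.mono_coe hf.mono_coe hf.bounded_coe
      hf.bounded_coe 0 0 le_rfl le_rfl
    simp only [zero_mul, add_zero] at h1
    have h2 := h.order t (fun _ => 0) (fun ξ => f ξ.1) monotone_const hf.mono_coe ⟨0, by simp⟩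
      hf.bounded_coe (fun ξ => h0 _) allOne
    rwa [h1] at h2
  order t f g hf hg hle η :=
    extend_le_extend (h.bounded t hg.mono_coe hg.bounded_coe) (h.order t _ _ hf.mono_coe
      hg.mono_coe hf.bounded_coe hg.bounded_coe fun ξ => hle ξ.1) η
  linear t f g hf hg a b ha hb := by
    funext η
    rw [h.linear t _ _ hf.mono_coe hg.mono_coe hf.bounded_coe hg.bounded_coe a b ha hb]
    exact extend_linear (h.mono t _ hf.mono_coe hf.bounded_coe)
      (h.bounded t hf.mono_coe hf.bounded_coe) (h.mono t _ hg.mono_coe hg.bounded_coe)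
      (h.bounded t hg.mono_coe hg.bounded_coe) ha hb η
  semigroup s t f hf := by
    rw [h.semigroup s t _ hf.mono_coe hf.bounded_coe]
    -- On `Ω_f` the extension returns the original function, so extending and restricting between
    -- the two steps has no effect.
    simp only [extend_coe (h.mono t _ hf.mono_coe hf.bounded_coe)
      (h.bounded t hf.mono_coe hf.bounded_coe)]

/-- A sequence of Markov chains on `Ω_f` whose laws are stochastically increasing in the starting
point and in the index. -/
structure IsMonotoneFamily (P : ℕ → FinConfig → Measure (StepPath FinConfig)) : Prop where
  family : ∀ n, IsMarkovFamily StepPath.eval (P n)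
  integral_le : ∀ n (H : StepPath FinConfig → ℝ), Measurable H → (∃ C, ∀ ω, |H ω| ≤ C) →
    (∀ ω ω' : StepPath FinConfig, (∀ t, ω.eval t ≤ ω'.eval t) → H ω ≤ H ω') →
    ∀ {η ξ : FinConfig}, ξ ≤ η → ∫ ω, H ω ∂(P n ξ) ≤ ∫ ω, H ω ∂(P n η)
  integral_le_succ : ∀ n (H : StepPath FinConfig → ℝ), Measurable H → (∃ C, ∀ ω, |H ω| ≤ C) →
    (∀ ω ω' : StepPath FinConfig, (∀ t, ω.eval t ≤ ω'.eval t) → H ω ≤ H ω') →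
    ∀ η : FinConfig, ∫ ω, H ω ∂(P n η) ≤ ∫ ω, H ω ∂(P (n + 1) η)

namespace IsMonotoneFamily

variable {P : ℕ → FinConfig → Measure (StepPath FinConfig)} {f : FinConfig → ℝ}

lemma transition_mono (h : IsMonotoneFamily P) (n : ℕ) (t : ℝ≥0) (hf : Monotone f)
    (hb : ∃ C, ∀ ξ, |f ξ| ≤ C) : Monotone (transition StepPath.eval (P n) t f) := fun _ _ hle =>
  h.integral_le n _ (Measurable.of_discrete.comp (measurable_eval t))
    (hb.imp fun _ hC _ => hC _) (fun _ _ hω => hf (hω t)) hle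

lemma transition_le_succ (h : IsMonotoneFamily P) (n : ℕ) (t : ℝ≥0) (hf : Monotone f)
    (hb : ∃ C, ∀ ξ, |f ξ| ≤ C) (ξ : FinConfig) :
    transition StepPath.eval (P n) t f ξ ≤ transition StepPath.eval (P (n + 1)) t f ξ :=
  h.integral_le_succ n _ (Measurable.of_discrete.comp (measurable_eval t))
    (hb.imp fun _ hC _ => hC _) (fun _ _ hω => hf (hω t)) ξ

lemma transition_le_transition (h : IsMonotoneFamily P) (n : ℕ) (t : ℝ≥0) {f g : FinConfig → ℝ}
    (hf : ∃ C, ∀ ξ, |f ξ| ≤ C) (hg : ∃ C, ∀ ξ, |g ξ| ≤ C) (hle : ∀ ξ, f ξ ≤ g ξ) (ξ : FinConfig) :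
    transition StepPath.eval (P n) t f ξ ≤ transition StepPath.eval (P n) t g ξ := by
  have := (h.family n).prob ξ
  exact integral_mono
    (integrable_of_abs_le (Measurable.of_discrete.comp (measurable_eval t))
      (hf.imp fun _ hC _ => hC _))
    (integrable_of_abs_le (Measurable.of_discrete.comp (measurable_eval t))
      (hg.imp fun _ hC _ => hC _)) fun ω => hle _

lemma transition_linear (h : IsMonotoneFamily P) (n : ℕ) (t : ℝ≥0) {f g : FinConfig → ℝ}
    (hf : ∃ C, ∀ ξ, |f ξ| ≤ C) (hg : ∃ C, ∀ ξ, |g ξ| ≤ C) (a b : ℝ) (ξ : FinConfig) :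
    transition StepPath.eval (P n) t (fun ξ => a * f ξ + b * g ξ) ξ
      = a * transition StepPath.eval (P n) t f ξ + b * transition StepPath.eval (P n) t g ξ := by
  have := (h.family n).prob ξ
  have h1 : Integrable (fun ω => f (StepPath.eval t ω)) (P n ξ) :=
    integrable_of_abs_le (Measurable.of_discrete.comp (measurable_eval t))
      (hf.imp fun _ hC _ => hC _)
  have h2 : Integrable (fun ω => g (StepPath.eval t ω)) (P n ξ) :=
    integrable_of_abs_le (Measurable.of_discrete.comp (measurable_eval t))
      (hg.imp fun _ hC _ => hC _)
  simp only [transition]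
  rw [integral_add (h1.const_mul a) (h2.const_mul b), integral_const_mul, integral_const_mul]

lemma transition_one (h : IsMonotoneFamily P) (n : ℕ) (t : ℝ≥0) (ξ : FinConfig) :
    transition StepPath.eval (P n) t (fun _ => 1) ξ = 1 := by
  have := (h.family n).prob ξ
  simp [transition]

theorem isMonotoneSemigroup_transition (h : IsMonotoneFamily P) (n : ℕ) :
    IsMonotoneSemigroup (transition StepPath.eval (P n)) where
  mono t _ hf hb := h.transition_mono n t hf hb
  abs_le t _ _ _ hC := abs_transition_le (h.family n).prob t hC
  zero f _ _ := funext ((h.family n).transition_zero f)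
  unit t := funext (h.transition_one n t)
  order t _ _ _ _ hf hg hle := h.transition_le_transition n t hf hg hle
  linear t _ _ _ _ hf hg a b _ _ := funext (h.transition_linear n t hf hg a b)
  semigroup s t _ _ hb :=
    funext ((h.family n).transition_add measurable_eval s t Measurable.of_discrete hb)

end IsMonotoneFamily

/-- The supremum of the semigroups of the chains `P n`. -/
def supTransition (P : ℕ → FinConfig → Measure (StepPath FinConfig)) (t : ℝ≥0)
    (f : FinConfig → ℝ) (ξ : FinConfig) : ℝ := ⨆ n, transition StepPath.eval (P n) t f ξ

namespace IsMonotoneFamily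

variable {P : ℕ → FinConfig → Measure (StepPath FinConfig)} {f : FinConfig → ℝ}

lemma tendsto_supTransition (h : IsMonotoneFamily P) (t : ℝ≥0) (hf : Monotone f)
    (hb : ∃ C, ∀ ξ, |f ξ| ≤ C) (ξ : FinConfig) :
    Tendsto (fun n => transition StepPath.eval (P n) t f ξ) atTop (𝓝 (supTransition P t f ξ)) := by
  refine tendsto_atTop_ciSup (monotone_nat_of_le_succ fun n => h.transition_le_succ n t hf hb ξ) ?_
  obtain ⟨C, hC⟩ := hb
  refine ⟨C, ?_⟩
  rintro _ ⟨n, rfl⟩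
  exact (le_abs_self _).trans (abs_transition_le (h.family n).prob t hC ξ)

lemma transition_le_supTransition (h : IsMonotoneFamily P) (n : ℕ) (t : ℝ≥0) (hf : Monotone f)
    (hb : ∃ C, ∀ ξ, |f ξ| ≤ C) (ξ : FinConfig) :
    transition StepPath.eval (P n) t f ξ ≤ supTransition P t f ξ :=
  (monotone_nat_of_le_succ fun n => h.transition_le_succ n t hf hb ξ).ge_of_tendsto
    (h.tendsto_supTransition t hf hb ξ) n

lemma supTransition_mono (h : IsMonotoneFamily P) (t : ℝ≥0) (hf : Monotone f)
    (hb : ∃ C, ∀ ξ, |f ξ| ≤ C) : Monotone (supTransition P t f) := fun ξ η hle =>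
  le_of_tendsto_of_tendsto' (h.tendsto_supTransition t hf hb ξ) (h.tendsto_supTransition t hf hb η)
    fun n => h.transition_mono n t hf hb hle

lemma abs_supTransition_le (h : IsMonotoneFamily P) (t : ℝ≥0) (hf : Monotone f) {C : ℝ}
    (hC : ∀ ξ, |f ξ| ≤ C) (ξ : FinConfig) : |supTransition P t f ξ| ≤ C :=
  le_of_tendsto (h.tendsto_supTransition t hf ⟨C, hC⟩ ξ).abs
    (Eventually.of_forall fun n => abs_transition_le (h.family n).prob t hC ξ)

lemma tendsto_transition_transition (h : IsMonotoneFamily P) (n : ℕ) (s t : ℝ≥0)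
    (hf : Monotone f) (hb : ∃ C, ∀ ξ, |f ξ| ≤ C) (ξ : FinConfig) :
    Tendsto (fun m => transition StepPath.eval (P n) s (transition StepPath.eval (P m) t f) ξ)
      atTop (𝓝 (transition StepPath.eval (P n) s (supTransition P t f) ξ)) := by
  obtain ⟨C, hC⟩ := hb
  have := (h.family n).prob ξ
  refine tendsto_integral_of_dominated_convergence (fun _ => C)
    (fun m => ((Measurable.of_discrete (f := transition StepPath.eval (P m) t f)).comp
      (measurable_eval s)).aestronglyMeasurable)
    (integrable_const C)
    (fun m => Eventually.of_forall fun ω => abs_transition_le (h.family m).prob t hC _)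
    (Eventually.of_forall fun ω => h.tendsto_supTransition t hf ⟨C, hC⟩ _)

theorem isMonotoneSemigroup_supTransition (h : IsMonotoneFamily P) :
    IsMonotoneSemigroup (supTransition P) where
  mono t _ hf hb := h.supTransition_mono t hf hb
  abs_le t _ _ hf hC := h.abs_supTransition_le t hf hC
  zero f hf hb := funext fun ξ => tendsto_nhds_unique (h.tendsto_supTransition 0 hf hb ξ) <| by
    simp only [(h.family _).transition_zero]
    exact tendsto_const_nhds
  unit t := funext fun ξ => tendsto_nhds_unique
    (h.tendsto_supTransition t monotone_const ⟨1, by simp⟩ ξ) <| by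
      simp only [h.transition_one]
      exact tendsto_const_nhds
  order t _ _ hf hg hfb hgb hle ξ :=
    le_of_tendsto_of_tendsto' (h.tendsto_supTransition t hf hfb ξ)
      (h.tendsto_supTransition t hg hgb ξ)
      fun n => h.transition_le_transition n t hfb hgb hle ξ
  linear t f g hf hg hfb hgb a b ha hb := by
    funext ξ
    have hbd : ∃ C, ∀ ξ, |a * f ξ + b * g ξ| ≤ C := by
      obtain ⟨C, hC⟩ := hfb
      obtain ⟨C', hC'⟩ := hgb
      refine ⟨a * C + b * C', fun ξ => (abs_add_le _ _).trans ?_⟩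
      rw [abs_mul, abs_mul, abs_of_nonneg ha, abs_of_nonneg hb]
      gcongr
      · exact hC ξ
      · exact hC' ξ
    refine tendsto_nhds_unique (h.tendsto_supTransition t
      ((hf.const_mul ha).add (hg.const_mul hb)) hbd ξ) ?_
    simp only [h.transition_linear _ t hfb hgb]
    exact ((h.tendsto_supTransition t hf hfb ξ).const_mul a).add
      ((h.tendsto_supTransition t hg hgb ξ).const_mul b)
  semigroup s t f hf hb := by
    funext ξ
    have hm := h.supTransition_mono t hf hb
    have hmb : ∃ C, ∀ ξ, |supTransition P t f ξ| ≤ C :=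
      hb.imp fun C hC => h.abs_supTransition_le t hf hC
    have hnb : ∀ n, ∃ C, ∀ ξ, |transition StepPath.eval (P n) t f ξ| ≤ C := fun n =>
      hb.imp fun C hC => abs_transition_le (h.family n).prob t hC
    -- For `≤`, each `S_n(s+t) = S_n(s) S_n(t)` lies below `S(s) S(t)`. For `≥`, `S_n(s) S(t)` is
    -- the limit of `S_n(s) S_m(t)` as `m → ∞`, and for `m ≥ n` this is at most `S_m(s) S_m(t) =
    -- S_m(s+t)`.
    refine le_antisymm ?_ ?_
    · refine le_of_tendsto_of_tendsto' (h.tendsto_supTransition (s + t) hf hb ξ)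
        (h.tendsto_supTransition s hm hmb ξ) fun n => ?_
      rw [(h.family n).transition_add measurable_eval s t Measurable.of_discrete hb]
      exact h.transition_le_transition n s (hnb n) hmb (h.transition_le_supTransition n t hf hb) ξ
    · refine le_of_tendsto' (h.tendsto_supTransition s hm hmb ξ) fun n => ?_
      refine le_of_tendsto (h.tendsto_transition_transition n s t hf hb ξ) ?_
      filter_upwards [eventually_ge_atTop n] with m hmn
      have h1 := monotone_nat_of_le_succ (fun k => h.transition_le_succ k s
        (h.transition_mono m t hf hb) (hnb m) ξ) hmn
      refine h1.trans ?_
      rw [← (h.family m).transition_add measurable_eval s t Measurable.of_discrete hb]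
      exact h.transition_le_supTransition m (s + t) hf hb ξ

end IsMonotoneFamily

end

end Sandpile

namespace Sandpile

noncomputable section

/-! ### Limits of laws on a product of finite spaces -/

section CylinderLimit

variable {ι : Type*}

lemma isClosed_of_mem_measurableCylinders {S : Set (ι → Height)}
    (h : S ∈ measurableCylinders fun _ : ι => Height) : IsClosed S := by
  obtain ⟨s, T, -, rfl⟩ := (mem_measurableCylinders S).1 h
  exact IsClosed.cylinder s (isClosed_discrete T)

/-- The limit of a sequence along a fixed nonprincipal ultrafilter. -/
def ultraLim (a : ℕ → ENNReal) : ENNReal := ((hyperfilter ℕ).map a).lim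

lemma tendsto_ultraLim (a : ℕ → ENNReal) :
    Tendsto a (hyperfilter ℕ : Filter ℕ) (𝓝 (ultraLim a)) :=
  Ultrafilter.le_nhds_lim ((hyperfilter ℕ).map a)

/-- The limit of the measures `μ n` along an ultrafilter, as a content on cylinders. -/
def cylinderLimit (μ : ℕ → Measure (ι → Height)) :
    AddContent ENNReal (measurableCylinders fun _ : ι => Height) :=
  isSetRing_measurableCylinders.addContent_of_union (fun S => ultraLim fun n => μ n S)
    (tendsto_nhds_unique (tendsto_ultraLim fun n => μ n ∅) (by simp))
    (fun {S T} _ hT hd => tendsto_nhds_unique (tendsto_ultraLim fun n => μ n (S ∪ T))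
      (((tendsto_ultraLim fun n => μ n S).add (tendsto_ultraLim fun n => μ n T)).congr fun n =>
        (measure_union hd (MeasurableSet.of_mem_measurableCylinders hT)).symm))

lemma tendsto_cylinderLimit (μ : ℕ → Measure (ι → Height)) (S : Set (ι → Height)) :
    Tendsto (fun n => μ n S) (hyperfilter ℕ : Filter ℕ) (𝓝 (cylinderLimit μ S)) :=
  tendsto_ultraLim fun n => μ n S

/-- Cylinders are closed in a compact space, so a decreasing sequence of cylinders with empty
intersection is eventually empty. Hence every finite content on cylinders is continuous at the empty
set. -/
lemma cylinderLimit_isSigmaSubadditive (μ : ℕ → Measure (ι → Height))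
    [∀ n, IsProbabilityMeasure (μ n)] : (cylinderLimit μ).IsSigmaSubadditive := by
  refine isSigmaSubadditive_of_addContent_iUnion_eq_tsum isSetRing_measurableCylinders
    fun f hf hU hd => addContent_iUnion_eq_sum_of_tendsto_zero isSetRing_measurableCylinders _
      (fun S _ => ?_) (fun s hs hanti hempty => ?_) hf hU hd
  · refine ne_top_of_le_ne_top ENNReal.one_ne_top
      (le_of_tendsto (tendsto_cylinderLimit μ S) (Eventually.of_forall fun n => prob_le_one))
  · have : ∃ n, s n = ∅ := by
      by_contra! hne
      have := IsCompact.nonempty_iInter_of_sequence_nonempty_isCompact_isClosed s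
        (fun n => hanti n.le_succ) hne
        (isClosed_of_mem_measurableCylinders (hs 0)).isCompact
        (fun n => isClosed_of_mem_measurableCylinders (hs n))
      rw [hempty] at this
      exact this.ne_empty rfl
    obtain ⟨n, hn⟩ := this
    refine tendsto_const_nhds.congr' ?_
    filter_upwards [eventually_ge_atTop n] with m hm
    rw [Set.subset_eq_empty (hanti hm) hn, addContent_empty]

theorem exists_measure_tendsto_cylinder (μ : ℕ → Measure (ι → Height))
    [∀ n, IsProbabilityMeasure (μ n)] : ∃ ν : Measure (ι → Height), IsProbabilityMeasure ν ∧
      ∀ S ∈ measurableCylinders fun _ : ι => Height,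
        Tendsto (fun n => μ n S) (hyperfilter ℕ) (𝓝 (ν S)) := by
  have hgen : (MeasurableSpace.pi : MeasurableSpace (ι → Height))
      = MeasurableSpace.generateFrom (measurableCylinders fun _ : ι => Height) :=
    generateFrom_measurableCylinders.symm
  have hν := fun {S} (hS : S ∈ measurableCylinders fun _ : ι => Height) =>
    (cylinderLimit μ).measure_eq isSetSemiring_measurableCylinders hgen
      (cylinderLimit_isSigmaSubadditive μ) hS
  refine ⟨(cylinderLimit μ).measure isSetSemiring_measurableCylinders hgen.le
    (cylinderLimit_isSigmaSubadditive μ), ⟨?_⟩, fun S hS => ?_⟩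
  · rw [hν (univ_mem_measurableCylinders _)]
    refine tendsto_nhds_unique (tendsto_cylinderLimit μ Set.univ) ?_
    simp only [measure_univ]
    exact tendsto_const_nhds
  · rw [hν hS]
    exact tendsto_cylinderLimit μ S

end CylinderLimit

/-- A functional of paths in `Ω` which depends on finitely many space-time coordinates. -/
def IsLocalFunctional (H : (ℝ≥0 → Config) → ℝ) : Prop :=
  ∃ J : Finset (ℝ≥0 × ℤ), ∀ ω ω', (∀ p ∈ J, ω p.1 p.2 = ω' p.1 p.2) → H ω = H ω'

lemma measurable_apply_apply (t : ℝ≥0) (x : ℤ) :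
    Measurable fun ω : ℝ≥0 → Config => ω t x :=
  (measurable_pi_apply x).comp (measurable_pi_apply t)

lemma IsLocalFunctional.exists_eq {H : (ℝ≥0 → Config) → ℝ} (hH : IsLocalFunctional H) :
    ∃ (J : Finset (ℝ≥0 × ℤ)) (h : (J → Height) → ℝ), ∀ ω, H ω = h fun p => ω p.1.1 p.1.2 := by
  classical
  obtain ⟨J, hJ⟩ := hH
  refine ⟨J, fun y => H fun t x => if hp : (t, x) ∈ J then y ⟨(t, x), hp⟩ else one, fun ω =>
    hJ _ _ fun p hp => ?_⟩
  rw [dif_pos hp]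

lemma IsLocalFunctional.measurable {H : (ℝ≥0 → Config) → ℝ} (hH : IsLocalFunctional H) :
    Measurable H := by
  obtain ⟨J, h, hh⟩ := hH.exists_eq
  rw [funext hh]
  exact (measurable_of_finite h).comp (measurable_pi_iff.2 fun p => measurable_apply_apply _ _)

/-- Space-time points serve as a single index set because each coordinate then takes values in the
finite set of heights. The expectation of a local functional is a finite linear combination of
cylinder probabilities, so it converges with them. -/
theorem exists_measure_tendsto_local (μ : ℕ → Measure (ℝ≥0 → Config))
    [∀ n, IsProbabilityMeasure (μ n)] : ∃ Q : Measure (ℝ≥0 → Config), IsProbabilityMeasure Q ∧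
      ∀ H, IsLocalFunctional H →
        Tendsto (fun n => ∫ ω, H ω ∂(μ n)) (hyperfilter ℕ) (𝓝 (∫ ω, H ω ∂Q)) := by
  have hU : Measurable fun (ω : ℝ≥0 → Config) (p : ℝ≥0 × ℤ) => ω p.1 p.2 :=
    measurable_pi_iff.2 fun p => measurable_apply_apply _ _
  have hV : Measurable fun (w : ℝ≥0 × ℤ → Height) (t : ℝ≥0) (x : ℤ) => w (t, x) :=
    measurable_pi_iff.2 fun t => measurable_pi_iff.2 fun x => measurable_pi_apply _
  have : ∀ n, IsProbabilityMeasure ((μ n).map fun ω (p : ℝ≥0 × ℤ) => ω p.1 p.2) := fun n =>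
    Measure.isProbabilityMeasure_map hU.aemeasurable
  obtain ⟨ν, hν, hlim⟩ := exists_measure_tendsto_cylinder
    fun n => (μ n).map fun ω (p : ℝ≥0 × ℤ) => ω p.1 p.2
  refine ⟨ν.map fun w t x => w (t, x), Measure.isProbabilityMeasure_map hV.aemeasurable,
    fun H hH => ?_⟩
  obtain ⟨J, h, hh⟩ := hH.exists_eq
  have hR : Measurable (J.restrict : (ℝ≥0 × ℤ → Height) → _) := Finset.measurable_restrict J
  have key : ∀ (ρ : Measure (ℝ≥0 × ℤ → Height)) [IsProbabilityMeasure ρ],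
      ∫ w, h (J.restrict w) ∂ρ = ∑ y, ρ.real (cylinder J {y}) * h y := fun ρ _ => by
    have : IsProbabilityMeasure (ρ.map J.restrict) :=
      Measure.isProbabilityMeasure_map hR.aemeasurable
    rw [← integral_map (f := h) hR.aemeasurable (measurable_of_finite h).aestronglyMeasurable,
      integral_fintype (Integrable.of_finite)]
    refine Finset.sum_congr rfl fun y _ => ?_
    rw [map_measureReal_apply hR (measurableSet_singleton y), smul_eq_mul]
    rfl
  have h1 : ∀ n, ∫ ω, H ω ∂(μ n)
      = ∑ y, ((μ n).map fun ω (p : ℝ≥0 × ℤ) => ω p.1 p.2).real (cylinder J {y}) * h y := fun n => by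
    rw [← key, integral_map (f := fun w => h (J.restrict w)) hU.aemeasurable
      ((measurable_of_finite h).comp hR).aestronglyMeasurable, funext hh]
    rfl
  have h2 : ∫ ω, H ω ∂(ν.map fun w t x => w (t, x)) = ∑ y, ν.real (cylinder J {y}) * h y := by
    rw [← key, integral_map hV.aemeasurable hH.measurable.aestronglyMeasurable, funext hh]
    rfl
  rw [funext h1, h2]
  refine tendsto_finsetSum _ fun y _ => Tendsto.mul_const _ ?_
  exact (ENNReal.tendsto_toReal (measure_ne_top _ _)).comp
    (hlim _ (cylinder_mem_measurableCylinders _ _ (measurableSet_singleton y)))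

end

end Sandpile

namespace Sandpile

noncomputable section

/-! ### Increasing events -/

/-- The configurations which are critical at all sites in `A`. -/
def upSet (A : Finset ℤ) : Set Config := {η | ∀ x ∈ A, η x = two}

lemma isUpperSet_upSet (A : Finset ℤ) : IsUpperSet (upSet A) := fun _ _ h hη x hx =>
  eq_two_of_le (h x) (hη x hx)

lemma isOpen_upSet (A : Finset ℤ) : IsOpen (upSet A) := by
  have : upSet A = ⋂ x ∈ A, (fun η : Config => η x) ⁻¹' {two} := by
    ext η
    simp [upSet]
  rw [this]
  exact isOpen_biInter_finset fun x _ => (isOpen_discrete _).preimage (continuous_apply x)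

/-- The events that all sites in a finite set are critical. -/
def upSets : Set (Set Config) := Set.range upSet

lemma isPiSystem_upSets : IsPiSystem upSets := by
  classical
  rintro _ ⟨A, rfl⟩ _ ⟨B, rfl⟩ -
  refine ⟨A ∪ B, ?_⟩
  ext η
  simp only [upSet, Finset.mem_union, or_imp, forall_and, Set.mem_ofPred_eq, Set.mem_inter_iff]

lemma univ_mem_upSets : Set.univ ∈ upSets := ⟨∅, by simp [upSet]⟩

/-- Each coordinate has only two values, and the event of height `1` is the complement of an
increasing one. Laws on `Ω` are thus determined by increasing cylinder events. -/
lemma measurableSpace_config_eq :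
    (inferInstance : MeasurableSpace Config) = MeasurableSpace.generateFrom upSets := by
  refine le_antisymm (iSup_le fun x => ?_) (MeasurableSpace.generateFrom_le ?_)
  · rw [← measurable_iff_comap_le]
    have h2 : MeasurableSet[MeasurableSpace.generateFrom upSets]
        ((fun η : Config => η x) ⁻¹' {two}) :=
      MeasurableSpace.measurableSet_generateFrom ⟨{x}, by ext; simp [upSet]⟩
    refine @measurable_to_countable' _ _ _ _ (MeasurableSpace.generateFrom upSets) _ fun y => ?_
    rcases eq_one_or_two y with rfl | rfl
    · have : (fun η : Config => η x) ⁻¹' {one} = ((fun η : Config => η x) ⁻¹' {two})ᶜ := by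
        ext η
        simpa using ne_two_iff.symm
      rw [this]
      exact h2.compl
    · exact h2
  · rintro _ ⟨A, rfl⟩
    exact (isOpen_upSet A).measurableSet

lemma monotone_indicator_one {α : Type*} [Preorder α] {S : Set α} (h : IsUpperSet S) :
    Monotone (S.indicator fun _ => (1 : ℝ)) := by
  classical
  intro a b hab
  simp only [Set.indicator_apply]
  split_ifs with h1 h2
  · exact le_rfl
  · exact absurd (h hab h1) h2
  · exact zero_le_one
  · exact le_rfl

lemma abs_indicator_one_le {α : Type*} (S : Set α) (a : α) :
    |S.indicator (fun _ => (1 : ℝ)) a| ≤ 1 := by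
  classical
  rw [Set.indicator_apply]
  split_ifs <;> simp

lemma indicator_one_nonneg {α : Type*} (S : Set α) (a : α) :
    0 ≤ S.indicator (fun _ => (1 : ℝ)) a := Set.indicator_nonneg (fun _ _ => zero_le_one) a

lemma monotoneClass_upSet (A : Finset ℤ) : MonotoneClass ((upSet A).indicator fun _ => 1) :=
  ⟨monotone_indicator_one (isUpperSet_upSet A),
    measurable_const.indicator (isOpen_upSet A).measurableSet, 1, abs_indicator_one_le _⟩

lemma lowerSemicontinuous_upSet (A : Finset ℤ) :
    LowerSemicontinuous ((upSet A).indicator fun _ => (1 : ℝ)) :=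
  (isOpen_upSet A).lowerSemicontinuous_indicator zero_le_one

/-- The paths which, at each time `r` in `I`, are critical at all sites in `A r`. -/
def upPaths (I : Finset ℝ≥0) (A : ℝ≥0 → Finset ℤ) : Set (ℝ≥0 → Config) :=
  ⋂ r ∈ I, coord r ⁻¹' upSet (A r)

lemma mem_upPaths {I : Finset ℝ≥0} {A : ℝ≥0 → Finset ℤ} {ω : ℝ≥0 → Config} :
    ω ∈ upPaths I A ↔ ∀ r ∈ I, ∀ x ∈ A r, ω r x = two := by
  simp [upPaths, coord, upSet]

lemma isUpperSet_upPaths (I : Finset ℝ≥0) (A : ℝ≥0 → Finset ℤ) : IsUpperSet (upPaths I A) := by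
  intro ω ω' h hω
  rw [mem_upPaths] at hω ⊢
  exact fun r hr x hx => eq_two_of_le (h r x) (hω r hr x hx)

lemma measurable_coord (t : ℝ≥0) : Measurable (coord t) := measurable_pi_apply t

lemma measurableSet_upPaths (I : Finset ℝ≥0) (A : ℝ≥0 → Finset ℤ) :
    MeasurableSet (upPaths I A) :=
  Finset.measurableSet_biInter _ fun r _ => measurable_coord r (isOpen_upSet _).measurableSet

lemma IsLocalFunctional.mul {H K : (ℝ≥0 → Config) → ℝ} (hH : IsLocalFunctional H)
    (hK : IsLocalFunctional K) : IsLocalFunctional fun ω => H ω * K ω := by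
  classical
  obtain ⟨J, hJ⟩ := hH
  obtain ⟨J', hJ'⟩ := hK
  refine ⟨J ∪ J', fun ω ω' h => ?_⟩
  change H ω * K ω = H ω' * K ω'
  rw [hJ ω ω' fun p hp => h p (Finset.mem_union_left _ hp),
    hJ' ω ω' fun p hp => h p (Finset.mem_union_right _ hp)]

lemma isLocalFunctional_upPaths (I : Finset ℝ≥0) (A : ℝ≥0 → Finset ℤ) :
    IsLocalFunctional ((upPaths I A).indicator fun _ => 1) := by
  classical
  refine ⟨I ×ˢ I.biUnion A, fun ω ω' h => ?_⟩
  have : ω ∈ upPaths I A ↔ ω' ∈ upPaths I A := by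
    rw [mem_upPaths, mem_upPaths]
    refine forall₂_congr fun r hr => forall₂_congr fun x hx => ?_
    rw [h (r, x) (Finset.mem_product.2 ⟨hr, Finset.mem_biUnion.2 ⟨r, hr, hx⟩⟩)]
  simp only [Set.indicator_apply, this]

lemma isLocalFunctional_trunc (G : FinConfig → ℝ) (k : ℕ) (s : ℝ≥0) :
    IsLocalFunctional fun ω => G (trunc k (ω s)) := by
  refine ⟨{s} ×ˢ Finset.Icc (-(k : ℤ)) k, fun ω ω' h => congrArg G
    (Subtype.ext (funext fun x => ?_))⟩
  rw [trunc_apply, trunc_apply]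
  split_ifs with hx
  · exact h (s, x) (by simpa using abs_le.1 hx)
  · rfl

/-! ### Limit laws -/

/-- A step path in `Ω_f` as a path in `Ω`. -/
def configPath (ω : StepPath FinConfig) : ℝ≥0 → Config := fun t => (ω.eval t).1

lemma measurable_configPath : Measurable configPath :=
  measurable_pi_iff.2 fun t => Measurable.of_discrete.comp (measurable_eval t)

/-- Bounded measurable increasing functionals of the path. -/
structure IsIncreasingFunctional (H : StepPath FinConfig → ℝ) : Prop where
  measurable : Measurable H
  bounded : ∃ C, ∀ ω, |H ω| ≤ C
  mono : ∀ ω ω' : StepPath FinConfig, (∀ t, ω.eval t ≤ ω'.eval t) → H ω ≤ H ω'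

/-- The supremum over the chains `P n` of the expectations of a functional. -/
def supIntegral (P : ℕ → FinConfig → Measure (StepPath FinConfig)) (H : StepPath FinConfig → ℝ)
    (ξ : FinConfig) : ℝ := ⨆ n, ∫ ω, H ω ∂(P n ξ)

namespace IsMonotoneFamily

variable {P : ℕ → FinConfig → Measure (StepPath FinConfig)} {H : StepPath FinConfig → ℝ}

lemma integral_le_integral (h : IsMonotoneFamily P) {m n : ℕ} (hmn : m ≤ n)
    (hH : IsIncreasingFunctional H) {η ξ : FinConfig} (hle : ξ ≤ η) :
    ∫ ω, H ω ∂(P m ξ) ≤ ∫ ω, H ω ∂(P n η) :=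
  (h.integral_le m H hH.1 hH.2 hH.3 hle).trans
    (monotone_nat_of_le_succ (f := fun k => ∫ ω, H ω ∂(P k η))
      (fun k => h.integral_le_succ k H hH.1 hH.2 hH.3 η) hmn)

lemma integral_le_supIntegral (h : IsMonotoneFamily P) (hH : IsIncreasingFunctional H) (n : ℕ)
    (ξ : FinConfig) : ∫ ω, H ω ∂(P n ξ) ≤ supIntegral P H ξ := by
  obtain ⟨C, hC⟩ := hH.bounded
  refine le_ciSup (f := fun n => ∫ ω, H ω ∂(P n ξ)) ⟨C, ?_⟩ n
  rintro _ ⟨m, rfl⟩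
  have := (h.family m).prob ξ
  exact (le_abs_self _).trans (abs_integral_le_of_abs_le hC)

lemma abs_supIntegral_le (h : IsMonotoneFamily P) (hH : IsIncreasingFunctional H) {C : ℝ}
    (hC : ∀ ω, |H ω| ≤ C) (ξ : FinConfig) : |supIntegral P H ξ| ≤ C := by
  have := fun n => (h.family n).prob ξ
  exact abs_le.2 ⟨(abs_le.1 (abs_integral_le_of_abs_le (μ := P 0 ξ) hC)).1.trans
    (h.integral_le_supIntegral hH 0 ξ),
    ciSup_le fun n => (abs_le.1 (abs_integral_le_of_abs_le (μ := P n ξ) hC)).2⟩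

lemma bounded_supIntegral (h : IsMonotoneFamily P) (hH : IsIncreasingFunctional H) :
    ∃ C, ∀ ξ, |supIntegral P H ξ| ≤ C := hH.bounded.imp fun _ hC => h.abs_supIntegral_le hH hC

lemma exists_lt_integral {c : ℝ} {η : Config} (hc : c < extend (supIntegral P H) η) :
    ∃ n, ∃ ξ : FinConfig, ξ.1 ≤ η ∧ c < ∫ ω, H ω ∂(P n ξ) := by
  obtain ⟨ξ, hξ, h1⟩ := exists_lt_of_lt_extend hc
  obtain ⟨n, hn⟩ := exists_lt_of_lt_ciSup h1
  exact ⟨n, ξ, hξ, hn⟩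

lemma integral_le_extend (h : IsMonotoneFamily P) (hH : IsIncreasingFunctional H) (n : ℕ)
    {ξ : FinConfig} {η : Config} (hξ : ξ.1 ≤ η) :
    ∫ ω, H ω ∂(P n ξ) ≤ extend (supIntegral P H) η :=
  (h.integral_le_supIntegral hH n ξ).trans (le_extend (h.bounded_supIntegral hH) hξ)

/-- The expectations increase in `n` and in the starting point, so the joint supremum is reached
along the diagonal. -/
lemma tendsto_integral_trunc (h : IsMonotoneFamily P) (hH : IsIncreasingFunctional H)
    (η : Config) : Tendsto (fun n => ∫ ω, H ω ∂(P n (trunc n η))) atTop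
      (𝓝 (extend (supIntegral P H) η)) := by
  refine tendsto_order.2 ⟨fun c hc => ?_, fun c hc => Eventually.of_forall fun n =>
    (h.integral_le_extend hH n (trunc_le n η)).trans_lt hc⟩
  obtain ⟨n, ξ, hξ, hn⟩ := exists_lt_integral hc
  filter_upwards [eventually_ge_atTop n, (increasesTo_trunc η).eventually_ge hξ] with m hm hm'
  exact hn.trans_le (h.integral_le_integral hm hH hm')

end IsMonotoneFamily

/-- `Q` is the limit of the laws of the chains `P n` started from configurations below `η`. -/
structure IsLimitLaw (P : ℕ → FinConfig → Measure (StepPath FinConfig)) (η : Config)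
    (Q : Measure (ℝ≥0 → Config)) : Prop where
  prob : IsProbabilityMeasure Q
  integral_eq : ∀ H : (ℝ≥0 → Config) → ℝ, IsLocalFunctional H → Monotone H →
    ∫ ω, H ω ∂Q = extend (supIntegral P (H ∘ configPath)) η

lemma IsLocalFunctional.bounded {H : (ℝ≥0 → Config) → ℝ} (hH : IsLocalFunctional H) :
    ∃ C, ∀ ω, |H ω| ≤ C := by
  obtain ⟨J, h, hh⟩ := hH.exists_eq
  obtain ⟨C, hC⟩ := (Set.finite_range fun y => |h y|).bddAbove
  exact ⟨C, fun ω => by rw [hh]; exact hC ⟨_, rfl⟩⟩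

lemma isIncreasingFunctional_comp {H : (ℝ≥0 → Config) → ℝ} (hm : Measurable H)
    (hb : ∃ C, ∀ ω, |H ω| ≤ C) (hmono : Monotone H) : IsIncreasingFunctional (H ∘ configPath) :=
  ⟨hm.comp measurable_configPath, hb.imp fun _ hC _ => hC _, fun _ _ hω => hmono hω⟩

/-- The law is an ultrafilter limit along the diagonal `n ↦ P n (trunc n η)`. On increasing local
functionals the ordinary limit exists, so the choice of the ultrafilter plays no role there. -/
theorem IsMonotoneFamily.exists_isLimitLaw {P : ℕ → FinConfig → Measure (StepPath FinConfig)}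
    (h : IsMonotoneFamily P) (η : Config) : ∃ Q, IsLimitLaw P η Q := by
  have : ∀ n, IsProbabilityMeasure ((P n (trunc n η)).map configPath) := fun n =>
    have := (h.family n).prob (trunc n η)
    Measure.isProbabilityMeasure_map measurable_configPath.aemeasurable
  obtain ⟨Q, hQ, hlim⟩ := exists_measure_tendsto_local fun n => (P n (trunc n η)).map configPath
  refine ⟨Q, hQ, fun H hH hmono => tendsto_nhds_unique (hlim H hH) ?_⟩
  have hm := hH.measurable
  simp only [integral_map measurable_configPath.aemeasurable hm.aestronglyMeasurable]
  exact (h.tendsto_integral_trunc (isIncreasingFunctional_comp hm hH.bounded hmono) η).mono_left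
    Nat.hyperfilter_le_atTop

/-- The law of the sandpile process started from `η`. -/
def limitLaw (P : ℕ → FinConfig → Measure (StepPath FinConfig)) (η : Config) :
    Measure (ℝ≥0 → Config) :=
  Classical.epsilon (IsLimitLaw P η)

lemma IsMonotoneFamily.isLimitLaw {P : ℕ → FinConfig → Measure (StepPath FinConfig)}
    (h : IsMonotoneFamily P) (η : Config) : IsLimitLaw P η (limitLaw P η) :=
  Classical.epsilon_spec (h.exists_isLimitLaw η)

section Limit

variable {P : ℕ → FinConfig → Measure (StepPath FinConfig)} {η : Config}
  {Q : Measure (ℝ≥0 → Config)}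

/-- The defining identity is extended from local functionals to limits of them from below, as the
Markov property involves functions of the whole configuration at time `s`. A chain which nearly
attains the supremum gives one inequality by dominated convergence, and `K k ≤ H` gives the other.
-/
lemma IsLimitLaw.integral_eq_of_tendsto (hQ : IsLimitLaw P η Q) (h : IsMonotoneFamily P)
    {H : (ℝ≥0 → Config) → ℝ} {K : ℕ → (ℝ≥0 → Config) → ℝ} (hK : ∀ k, IsLocalFunctional (K k))
    (hKm : ∀ k, Monotone (K k)) {C : ℝ} (hC : ∀ k ω, |K k ω| ≤ C) (hle : ∀ k ω, K k ω ≤ H ω)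
    (hlim : ∀ ω, Tendsto (fun k => K k ω) atTop (𝓝 (H ω))) :
    ∫ ω, H ω ∂Q = extend (supIntegral P (H ∘ configPath)) η := by
  have := hQ.prob
  have hHC : ∀ ω, |H ω| ≤ C := fun ω =>
    le_of_tendsto (hlim ω).abs (Eventually.of_forall fun k => hC k ω)
  have hHm : Measurable H :=
    measurable_of_tendsto_metrizable (fun k => (hK k).measurable) (tendsto_pi_nhds.2 hlim)
  have hHmono : Monotone H := fun ω ω' hω =>
    le_of_tendsto_of_tendsto' (hlim ω) (hlim ω') fun k => hKm k hω
  have hHi := isIncreasingFunctional_comp hHm ⟨C, hHC⟩ hHmono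
  have hKi := fun k => isIncreasingFunctional_comp (hK k).measurable ⟨C, hC k⟩ (hKm k)
  have h1 : Tendsto (fun k => ∫ ω, K k ω ∂Q) atTop (𝓝 (∫ ω, H ω ∂Q)) :=
    tendsto_integral_of_dominated_convergence (fun _ => C)
      (fun k => (hK k).measurable.aestronglyMeasurable) (integrable_const C)
      (fun k => Eventually.of_forall (hC k)) (Eventually.of_forall hlim)
  refine tendsto_nhds_unique h1 ?_
  simp only [fun k => hQ.integral_eq (K k) (hK k) (hKm k)]
  refine tendsto_order.2 ⟨fun c hc => ?_, fun c hc => Eventually.of_forall fun k => ?_⟩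
  · obtain ⟨n, ξ, hξ, hn⟩ := IsMonotoneFamily.exists_lt_integral hc
    have := (h.family n).prob ξ
    have h2 : Tendsto (fun k => ∫ ω, (K k ∘ configPath) ω ∂(P n ξ)) atTop
        (𝓝 (∫ ω, (H ∘ configPath) ω ∂(P n ξ))) :=
      tendsto_integral_of_dominated_convergence (fun _ => C)
        (fun k => (hKi k).measurable.aestronglyMeasurable) (integrable_const C)
        (fun k => Eventually.of_forall fun ω => hC k _) (Eventually.of_forall fun ω => hlim _)
    filter_upwards [h2.eventually_const_lt hn] with k hk
    exact hk.trans_le (h.integral_le_extend (hKi k) n hξ)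
  · refine lt_of_le_of_lt (extend_le fun ξ hξ => ciSup_le fun n => ?_) hc
    have := (h.family n).prob ξ
    refine le_trans (integral_mono ?_ ?_ fun ω => hle k _) (h.integral_le_extend hHi n hξ)
    · exact integrable_of_abs_le (hKi k).measurable (hKi k).bounded
    · exact integrable_of_abs_le hHi.measurable hHi.bounded

/-- The functions `G (trunc k (ω s))` are local and converge from below to `extend G (ω s)`.
Nonnegativity of `G` keeps the products with the indicator increasing. -/
theorem IsLimitLaw.integral_indicator_mul (hQ : IsLimitLaw P η Q) (h : IsMonotoneFamily P)
    (I : Finset ℝ≥0) (A : ℝ≥0 → Finset ℤ) {G : FinConfig → ℝ} (hG : Monotone G)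
    (hb : ∃ C, ∀ ξ, |G ξ| ≤ C) (h0 : ∀ ξ, 0 ≤ G ξ) (s : ℝ≥0) :
    ∫ ω, (upPaths I A).indicator (fun _ => 1) ω * extend G (ω s) ∂Q
      = extend (supIntegral P fun ω =>
          (upPaths I A).indicator (fun _ => 1) (configPath ω) * G (ω.eval s)) η := by
  obtain ⟨C, hC⟩ := hb
  have hi := fun ω => indicator_one_nonneg (upPaths I A) ω
  have := hQ.integral_eq_of_tendsto h
    (H := fun ω => (upPaths I A).indicator (fun _ => 1) ω * extend G (ω s))
    (K := fun k ω => (upPaths I A).indicator (fun _ => 1) ω * G (trunc k (ω s))) (C := C)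
    (fun k => (isLocalFunctional_upPaths I A).mul (isLocalFunctional_trunc G k s))
    (fun k ω ω' hω => mul_le_mul (monotone_indicator_one (isUpperSet_upPaths I A) hω)
      (hG (trunc_mono_right k (hω s))) (h0 _) (hi _))
    (fun k ω => by
      rw [abs_mul, ← one_mul C]
      exact mul_le_mul (abs_indicator_one_le _ _) (hC _) (abs_nonneg _) zero_le_one)
    (fun k ω => mul_le_mul_of_nonneg_left (le_extend ⟨C, hC⟩ (trunc_le _ _)) (hi _))
    (fun ω => (tendsto_extend hG ⟨C, hC⟩ (increasesTo_trunc _)).const_mul _)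
  rw [this]
  congr 2
  funext ω
  simp only [Function.comp_apply]
  rw [show configPath ω s = (ω.eval s).1 from rfl, extend_coe hG ⟨C, hC⟩]

end Limit

end

end Sandpile

namespace Sandpile

noncomputable section

/-! ### The limit process -/

lemma coord_generates : (inferInstance : MeasurableSpace (ℝ≥0 → Config))
    = ⨆ t, MeasurableSpace.comap (coord t) inferInstance := rfl

/-- The semigroup of the limit process. -/
def limitSemigroup (P : ℕ → FinConfig → Measure (StepPath FinConfig)) (t : ℝ≥0)
    (f : Config → ℝ) : Config → ℝ := extend (supTransition P t fun ξ => f ξ.1)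

namespace IsMonotoneFamily

variable {P : ℕ → FinConfig → Measure (StepPath FinConfig)}

lemma isMarkovSemigroup_limitSemigroup (h : IsMonotoneFamily P) :
    IsMarkovSemigroup (limitSemigroup P) :=
  h.isMonotoneSemigroup_supTransition.isMarkovSemigroup

lemma transition_limitLaw_of_nonneg (h : IsMonotoneFamily P) {f : Config → ℝ}
    (hf : MonotoneClass f) (hl : LowerSemicontinuous f) (h0 : ∀ η, 0 ≤ f η) (t : ℝ≥0)
    (η : Config) : transition coord (limitLaw P) t f η = limitSemigroup P t f η := by
  have := (h.isLimitLaw η).integral_indicator_mul h ∅ (fun _ => ∅) hf.mono_coe hf.bounded_coe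
    (fun ξ => h0 ξ.1) t
  simp only [upPaths, Finset.notMem_empty, Set.iInter_of_empty, Set.iInter_univ,
    Set.indicator_univ, one_mul, extend_of_lowerSemicontinuous hf hl] at this
  exact this

lemma monotoneClass_const (c : ℝ) : MonotoneClass fun _ => c :=
  ⟨monotone_const, measurable_const, |c|, fun _ => le_rfl⟩

/-- Adding a bound `C` of `f` makes the function nonnegative; both sides are additive and fix
constants. -/
theorem transition_limitLaw (h : IsMonotoneFamily P) {f : Config → ℝ}
    (hf : MonotoneClass f) (hl : LowerSemicontinuous f) (t : ℝ≥0) (η : Config) :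
    limitSemigroup P t f η = transition coord (limitLaw P) t f η := by
  obtain ⟨C, hC⟩ := hf.bounded
  have hC0 : 0 ≤ C := (abs_nonneg _).trans (hC η)
  have := (h.isLimitLaw η).prob
  have hlin := congrFun (h.isMarkovSemigroup_limitSemigroup.linear t f (fun _ => 1) hf
    (monotoneClass_const 1) 1 C zero_le_one hC0) η
  have hsum : MonotoneClass fun η => 1 * f η + C * 1 := by
    refine ⟨(hf.mono.const_mul zero_le_one).add monotone_const,
      (hf.measurable.const_mul 1).add measurable_const, C + C, fun η => ?_⟩
    rw [one_mul, mul_one]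
    exact (abs_add_le _ _).trans (add_le_add (hC η) (abs_of_nonneg hC0).le)
  have hls : LowerSemicontinuous fun η => 1 * f η + C * 1 := by
    simp only [one_mul, mul_one]
    exact hl.add lowerSemicontinuous_const
  rw [← h.transition_limitLaw_of_nonneg hsum hls
    (fun η => by linarith [(abs_le.1 (hC η)).1]) t η, h.isMarkovSemigroup_limitSemigroup.unit t]
    at hlin
  simp only [transition, one_mul, mul_one] at hlin ⊢
  have hi : Integrable (fun ω => f (coord t ω)) (limitLaw P η) :=
    integrable_of_abs_le (hf.measurable.comp (measurable_coord t))
      (hf.bounded.imp fun _ hC _ => hC _)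
  rw [integral_add hi (integrable_const C), integral_const] at hlin
  simp only [probReal_univ, smul_eq_mul, one_mul] at hlin
  linarith

lemma measure_upPaths_eq (h : IsMonotoneFamily P) (I : Finset ℝ≥0) (A : ℝ≥0 → Finset ℤ)
    (η : Config) : limitLaw P η (upPaths I A) = ENNReal.ofReal (extend (supIntegral P
      ((upPaths I A).indicator (fun _ => 1) ∘ configPath)) η) := by
  have := (h.isLimitLaw η).prob
  rw [← (h.isLimitLaw η).integral_eq _ (isLocalFunctional_upPaths I A)
    (monotone_indicator_one (isUpperSet_upPaths I A)),
    integral_indicator_const _ (measurableSet_upPaths I A), smul_eq_mul, mul_one,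
    ofReal_measureReal]

lemma exists_upPaths {I : Finset ℝ≥0} {B : ℝ≥0 → Set Config} (hB : ∀ r ∈ I, B r ∈ upSets) :
    ∃ A, ⋂ r ∈ I, coord r ⁻¹' B r = upPaths I A := by
  choose! A hA using hB
  refine ⟨A, Set.iInter₂_congr fun r hr => ?_⟩
  rw [hA r hr]

/-- On the π-system of increasing cylinder events the probability is a lower semicontinuous function
of the starting configuration. -/
lemma measurable_limitLaw (h : IsMonotoneFamily P) : Measurable (limitLaw P) := by
  have := fun η => (h.isLimitLaw η).prob
  refine Measurable.measure_of_isPiSystem_of_isProbabilityMeasure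
    (S := piiUnionInter (fun t => {A | ∃ B ∈ upSets, coord t ⁻¹' B = A}) Set.univ) ?_
    (IsMarkovFamily.isPiSystem_coord isPiSystem_upSets Set.univ coord) ?_
  · rw [IsMarkovFamily.generateFrom_coord measurableSpace_config_eq]
    simp only [Set.mem_univ, iSup_pos]
    rfl
  · rintro _ ⟨I, -, F, hF, rfl⟩
    have : ∀ r ∈ I, ∃ B ∈ upSets, coord r ⁻¹' B = F r := hF
    choose! B hB hBF using this
    rw [Set.iInter₂_congr fun r hr => (hBF r hr).symm]
    obtain ⟨A, hA⟩ := exists_upPaths hB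
    rw [hA]
    simp only [h.measure_upPaths_eq]
    refine ENNReal.measurable_ofReal.comp (lowerSemicontinuous_extend
      (h.bounded_supIntegral ?_)).measurable
    exact isIncreasingFunctional_comp (isLocalFunctional_upPaths I A).measurable
      ⟨1, abs_indicator_one_le _⟩ (monotone_indicator_one (isUpperSet_upPaths I A))

/-- `S(0)` fixes the indicator of height `2` at `x`, so the height at `x` at time `0` is almost
surely that of `η`; there are countably many sites. -/
lemma ae_coord_zero (h : IsMonotoneFamily P) (η : Config) :
    ∀ᵐ ω ∂(limitLaw P η), coord 0 ω = η := by
  have := (h.isLimitLaw η).prob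
  have hx : ∀ x, ∀ᵐ ω ∂(limitLaw P η), coord 0 ω x = η x := by
    intro x
    have h1 := h.transition_limitLaw (monotoneClass_upSet {x}) (lowerSemicontinuous_upSet {x}) 0 η
    rw [h.isMarkovSemigroup_limitSemigroup.zero _ (monotoneClass_upSet {x})
      (lowerSemicontinuous_upSet {x})] at h1
    have hm : MeasurableSet (coord 0 ⁻¹' upSet {x}) :=
      measurable_coord 0 (isOpen_upSet _).measurableSet
    have h2 : transition coord (limitLaw P) 0 ((upSet {x}).indicator fun _ => 1) η
        = (limitLaw P η).real (coord 0 ⁻¹' upSet {x}) := by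
      rw [← mul_one ((limitLaw P η).real _), ← smul_eq_mul, ← integral_indicator_const _ hm]
      rfl
    rw [h2] at h1
    rcases eq_one_or_two (η x) with hη | hη
    · have : η ∉ upSet {x} := by simp [upSet, hη, one_ne_two]
      rw [Set.indicator_of_notMem this] at h1
      have h3 : limitLaw P η (coord 0 ⁻¹' upSet {x}) = 0 := (measureReal_eq_zero_iff).1 h1.symm
      filter_upwards [measure_eq_zero_iff_ae_notMem.1 h3] with ω hω
      rw [hη, ← ne_two_iff]
      simpa [upSet] using hω
    · have : η ∈ upSet {x} := by simp [upSet, hη]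
      rw [Set.indicator_of_mem this] at h1
      have h3 : limitLaw P η (coord 0 ⁻¹' upSet {x}) = 1 := by
        rw [← ofReal_measureReal, ← h1, ENNReal.ofReal_one]
      filter_upwards [(mem_ae_iff_prob_eq_one hm).2 h3] with ω hω
      rw [hη]
      exact hω x (Finset.mem_singleton_self x)
  filter_upwards [ae_all_iff.2 hx] with ω hω
  exact funext hω

/-- The Markov property of the chains, in the limit. -/
lemma supIntegral_mul_eq (h : IsMonotoneFamily P) {s : ℝ≥0} (t : ℝ≥0)
    {Φ : StepPath FinConfig → ℝ} (hΦ : Measurable[past StepPath.eval s] Φ)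
    (hΦi : IsIncreasingFunctional Φ) (hΦ0 : ∀ ω, 0 ≤ Φ ω) {f : FinConfig → ℝ} (hf : Monotone f)
    (hb : ∃ C, ∀ ξ, |f ξ| ≤ C) (hf0 : ∀ ξ, 0 ≤ f ξ) :
    supIntegral P (fun ω => Φ ω * f (ω.eval (s + t)))
      = supIntegral P fun ω => Φ ω * supTransition P t f (ω.eval s) := by
  have hpos : ∀ n ξ, 0 ≤ transition StepPath.eval (P n) t f ξ := fun n ξ =>
    integral_nonneg fun ω => hf0 _
  have hsup0 : ∀ ξ, 0 ≤ supTransition P t f ξ := fun ξ =>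
    (hpos 0 ξ).trans (h.transition_le_supTransition 0 t hf hb ξ)
  have hinc : ∀ (g : FinConfig → ℝ) (r : ℝ≥0), Monotone g → (∃ C, ∀ ξ, |g ξ| ≤ C) →
      (∀ ξ, 0 ≤ g ξ) → IsIncreasingFunctional fun ω => Φ ω * g (ω.eval r) := by
    intro g r hg ⟨C, hC⟩ hg0
    obtain ⟨D, hD⟩ := hΦi.bounded
    refine ⟨hΦi.measurable.mul (Measurable.of_discrete.comp (measurable_eval r)),
      ⟨D * C, fun ω => ?_⟩, fun ω ω' hω => mul_le_mul (hΦi.mono _ _ hω) (hg (hω r)) (hg0 _) (hΦ0 _)⟩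
    rw [abs_mul]
    exact mul_le_mul (hD _) (hC _) (abs_nonneg _) ((abs_nonneg _).trans (hD ω))
  have hbn : ∀ n, ∃ C, ∀ ξ, |transition StepPath.eval (P n) t f ξ| ≤ C := fun n =>
    hb.imp fun C hC => abs_transition_le (h.family n).prob t hC
  have hbs : ∃ C, ∀ ξ, |supTransition P t f ξ| ≤ C :=
    hb.imp fun C hC => h.abs_supTransition_le t hf hC
  have hif := hinc f (s + t) hf hb hf0
  have hin := fun n => hinc _ s (h.transition_mono n t hf hb) (hbn n) (hpos n)
  have his := hinc _ s (h.supTransition_mono t hf hb) hbs hsup0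
  have hmk : ∀ n ξ, ∫ ω, Φ ω * f (ω.eval (s + t)) ∂(P n ξ)
      = ∫ ω, Φ ω * transition StepPath.eval (P n) t f (ω.eval s) ∂(P n ξ) := fun n ξ =>
    (h.family n).integral_mul_eq measurable_eval ξ s t hΦ hΦi.bounded Measurable.of_discrete hb
  funext ξ
  refine le_antisymm (ciSup_le fun n => ?_) (ciSup_le fun n => ?_)
  · have := (h.family n).prob ξ
    rw [hmk]
    refine le_trans (integral_mono (integrable_of_abs_le (hin n).1 (hin n).2)
      (integrable_of_abs_le his.1 his.2) fun ω => ?_) (h.integral_le_supIntegral his n ξ)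
    exact mul_le_mul_of_nonneg_left (h.transition_le_supTransition n t hf hb _) (hΦ0 ω)
  · have := (h.family n).prob ξ
    obtain ⟨C, hC⟩ := hb
    obtain ⟨D, hD⟩ := hΦi.bounded
    have hlim : Tendsto
        (fun m => ∫ ω, Φ ω * transition StepPath.eval (P m) t f (ω.eval s) ∂(P n ξ)) atTop
        (𝓝 (∫ ω, Φ ω * supTransition P t f (ω.eval s) ∂(P n ξ))) := by
      refine tendsto_integral_of_dominated_convergence (fun _ => D * C)
        (fun m => (hin m).measurable.aestronglyMeasurable) (integrable_const _)
        (fun m => Eventually.of_forall fun ω => ?_) (Eventually.of_forall fun ω =>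
          (h.tendsto_supTransition t hf ⟨C, hC⟩ _).const_mul _)
      rw [Real.norm_eq_abs, abs_mul]
      exact mul_le_mul (hD _) (abs_transition_le (h.family m).prob t hC _) (abs_nonneg _)
        ((abs_nonneg _).trans (hD ω))
    refine le_of_tendsto hlim ?_
    -- For `m ≥ n` the outer law may be raised from `P n` to `P m`. Then inner and outer index
    -- agree, and the Markov property of `P m` applies.
    filter_upwards [eventually_ge_atTop n] with m hm
    refine (h.integral_le_integral hm (hin m) le_rfl).trans ?_
    rw [← hmk]
    exact h.integral_le_supIntegral hif m ξ

lemma measurable_past_upPaths {I : Finset ℝ≥0} {A : ℝ≥0 → Finset ℤ} {s : ℝ≥0}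
    (hI : ∀ r ∈ I, r ≤ s) : Measurable[past StepPath.eval s]
      ((upPaths I A).indicator (fun _ => (1 : ℝ)) ∘ configPath) := by
  have : (upPaths I A).indicator (fun _ => (1 : ℝ)) ∘ configPath
      = (configPath ⁻¹' upPaths I A).indicator fun _ => 1 := rfl
  rw [this]
  refine Measurable.indicator measurable_const ?_
  simp only [upPaths, Set.preimage_iInter]
  refine Finset.measurableSet_biInter _ fun r hr => ?_
  exact (measurable_past (X := StepPath.eval) (hI r hr))
    (MeasurableSet.of_discrete (s := {ξ : FinConfig | ξ.1 ∈ upSet (A r)}))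

/-- By `integral_indicator_mul`, for `f` at time `s + t` and for `S(t)f` at time `s`, both sides are
suprema of expectations under the chains, and these suprema agree by `supIntegral_mul_eq`. -/
lemma limitLaw_markov (h : IsMonotoneFamily P) (η : Config) (s t : ℝ≥0) {I : Finset ℝ≥0}
    (A : ℝ≥0 → Finset ℤ) (hI : ∀ r ∈ I, r ≤ s) (A₀ : Finset ℤ) :
    limitLaw P η (upPaths I A ∩ coord (s + t) ⁻¹' upSet A₀)
      = ∫⁻ ω in upPaths I A, limitLaw P (coord s ω) (coord t ⁻¹' upSet A₀) ∂(limitLaw P η) := by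
  have hprob := fun η => (h.isLimitLaw η).prob
  set f : Config → ℝ := (upSet A₀).indicator fun _ => 1 with hfdef
  have hf : MonotoneClass f := monotoneClass_upSet A₀
  have hl : LowerSemicontinuous f := lowerSemicontinuous_upSet A₀
  have hf0 : ∀ η, 0 ≤ f η := indicator_one_nonneg _
  have hm : ∀ r, MeasurableSet (coord r ⁻¹' upSet A₀) := fun r =>
    measurable_coord r (isOpen_upSet _).measurableSet
  have hS : MonotoneClass (limitSemigroup P t f) := h.isMarkovSemigroup_limitSemigroup.maps t f hf
  have hS0 := h.isMarkovSemigroup_limitSemigroup.nonneg t f hf hf0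
  have h1 : ∀ ζ, limitLaw P ζ (coord t ⁻¹' upSet A₀)
      = ENNReal.ofReal (limitSemigroup P t f ζ) := fun ζ => by
    rw [h.transition_limitLaw hf hl, ← ofReal_measureReal, ← mul_one ((limitLaw P ζ).real _),
      ← smul_eq_mul, ← integral_indicator_const _ (hm t)]
    rfl
  have hΦm := measurableSet_upPaths I A
  have hR : ∫⁻ ω in upPaths I A, limitLaw P (coord s ω) (coord t ⁻¹' upSet A₀) ∂(limitLaw P η)
      = ENNReal.ofReal (∫ ω, (upPaths I A).indicator (fun _ => 1) ω
          * limitSemigroup P t f (ω s) ∂(limitLaw P η)) := by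
    simp only [h1]
    rw [← ofReal_integral_eq_lintegral_ofReal, ← integral_indicator hΦm]
    · congr 2
      funext ω
      by_cases hω : ω ∈ upPaths I A <;> simp [hω, coord]
    · exact integrable_of_abs_le (hS.measurable.comp (measurable_coord s))
        (hS.bounded.imp fun _ hC _ => hC _)
    · exact Eventually.of_forall fun ω => hS0 _
  have hL : limitLaw P η (upPaths I A ∩ coord (s + t) ⁻¹' upSet A₀)
      = ENNReal.ofReal (∫ ω, (upPaths I A).indicator (fun _ => 1) ω
          * extend (fun ξ => f ξ.1) (ω (s + t)) ∂(limitLaw P η)) := by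
    rw [extend_of_lowerSemicontinuous hf hl, ← ofReal_measureReal,
      ← mul_one ((limitLaw P η).real _), ← smul_eq_mul,
      ← integral_indicator_const _ (hΦm.inter (hm _))]
    congr 2
    funext ω
    rw [hfdef]
    by_cases hω : ω ∈ upPaths I A <;> by_cases hω' : ω (s + t) ∈ upSet A₀ <;>
      simp [hω, hω', coord]
  have hΦi : IsIncreasingFunctional ((upPaths I A).indicator (fun _ => (1 : ℝ)) ∘ configPath) :=
    isIncreasingFunctional_comp (measurable_const.indicator hΦm)
      ⟨1, abs_indicator_one_le _⟩ (monotone_indicator_one (isUpperSet_upPaths I A))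
  have key := h.supIntegral_mul_eq t (measurable_past_upPaths (A := A) hI) hΦi
    (fun ω => indicator_one_nonneg _ _) hf.mono_coe hf.bounded_coe fun ξ => hf0 ξ.1
  rw [hL, hR, (h.isLimitLaw η).integral_indicator_mul h I A hf.mono_coe hf.bounded_coe
    (fun ξ => hf0 ξ.1) (s + t)]
  have hsg := h.isMonotoneSemigroup_supTransition
  have := (h.isLimitLaw η).integral_indicator_mul h I A (hsg.mono t _ hf.mono_coe hf.bounded_coe)
    (hsg.bounded t hf.mono_coe hf.bounded_coe) (fun ξ => by
      rw [← extend_coe (hsg.mono t _ hf.mono_coe hf.bounded_coe)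
        (hsg.bounded t hf.mono_coe hf.bounded_coe)]
      exact hS0 ξ.1) s
  rw [show limitSemigroup P t f = extend (supTransition P t fun ξ => f ξ.1) from rfl, this]
  exact congrArg (fun G => ENNReal.ofReal (extend G η)) key

theorem isMarkovFamily_limitLaw (h : IsMonotoneFamily P) : IsMarkovFamily coord (limitLaw P) := by
  refine IsMarkovFamily.of_isPiSystem measurable_coord h.measurable_limitLaw
    (fun η => (h.isLimitLaw η).prob) h.ae_coord_zero isPiSystem_upSets measurableSpace_config_eq
    univ_mem_upSets fun η s t I B B₀ hI hB hB₀ => ?_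
  obtain ⟨A, hA⟩ := exists_upPaths hB
  obtain ⟨A₀, rfl⟩ := hB₀
  rw [hA]
  exact h.limitLaw_markov η s t A hI A₀

theorem isProcessWithSemigroup (h : IsMonotoneFamily P) :
    IsProcessWithSemigroup (limitSemigroup P) (limitLaw P) :=
  ⟨h.isMarkovFamily_limitLaw, fun _ hf hl t η => h.transition_limitLaw hf hl t η⟩

/-- `S(t)f = S(t)S(0)f` by the semigroup property, and `S(0)f` is lower semicontinuous as an
extension from `Ω_f`. -/
lemma limitSemigroup_eq_transition (h : IsMonotoneFamily P) {f : Config → ℝ}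
    (hf : MonotoneClass f) (t : ℝ≥0) (η : Config) :
    limitSemigroup P t f η = transition coord (limitLaw P) t (limitSemigroup P 0 f) η := by
  have hb := h.isMonotoneSemigroup_supTransition.bounded 0 hf.mono_coe hf.bounded_coe
  have h1 : limitSemigroup P t f = limitSemigroup P t (limitSemigroup P 0 f) := by
    rw [← h.isMarkovSemigroup_limitSemigroup.semigroup t 0 f hf, add_zero]
  rw [h1]
  exact h.transition_limitLaw (monotoneClass_extend hb) (lowerSemicontinuous_extend hb) t η

end IsMonotoneFamily

/-- Indicators of increasing cylinder events are monotone and lower semicontinuous, so `S`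
determines the one-time marginals from every starting point. By the Markov property these determine
the law on path space. -/
theorem IsProcessWithSemigroup.unique {S : ℝ≥0 → (Config → ℝ) → Config → ℝ}
    {Q Q' : Config → Measure (ℝ≥0 → Config)} (h : IsProcessWithSemigroup S Q)
    (h' : IsProcessWithSemigroup S Q') : Q' = Q := by
  funext η
  have hm : ∀ t η, (Q' η).map (coord t) = (Q η).map (coord t) := by
    intro t η
    have := h.family.prob η
    have := h'.family.prob η
    have := Measure.isProbabilityMeasure_map (μ := Q η) (measurable_coord t).aemeasurable
    have := Measure.isProbabilityMeasure_map (μ := Q' η) (measurable_coord t).aemeasurable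
    refine ext_of_generate_finite upSets measurableSpace_config_eq isPiSystem_upSets ?_ (by simp)
    rintro _ ⟨A, rfl⟩
    have hA : MeasurableSet (coord t ⁻¹' upSet A) :=
      measurable_coord t (isOpen_upSet _).measurableSet
    have h1 : ∀ R : Config → Measure (ℝ≥0 → Config),
        transition coord R t ((upSet A).indicator fun _ => 1) η
          = (R η).real (coord t ⁻¹' upSet A) := fun R => by
      rw [← mul_one ((R η).real _), ← smul_eq_mul, ← integral_indicator_const _ hA]
      rfl
    have h2 := (h'.expectation _ (monotoneClass_upSet A) (lowerSemicontinuous_upSet A) t η).symm.trans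
      (h.expectation _ (monotoneClass_upSet A) (lowerSemicontinuous_upSet A) t η)
    rw [h1, h1] at h2
    rw [Measure.map_apply (measurable_coord t) (isOpen_upSet _).measurableSet,
      Measure.map_apply (measurable_coord t) (isOpen_upSet _).measurableSet,
      ← ofReal_measureReal, ← ofReal_measureReal, h2]
  have := h'.family.map_eq measurable_coord h.family measurable_coord measurable_id
    (D := Set.univ) (fun _ _ _ => Eventually.of_forall fun _ => Set.mem_univ _)
    (fun t f hf _ x _ => by
      change ∫ ω, f (coord t ω) ∂(Q' x) = ∫ ω, f (coord t ω) ∂(Q x)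
      rw [← integral_map (measurable_coord t).aemeasurable hf.aestronglyMeasurable, hm,
        integral_map (measurable_coord t).aemeasurable hf.aestronglyMeasurable])
    coord_generates measurable_id (fun _ _ => rfl) (Set.mem_univ η)
  rwa [Measure.map_id] at this

end

end Sandpile

namespace Sandpile

noncomputable section

/-! ### The formal generator -/

/-- Every critical site of `η` lies between two ones. -/
def HasGaps (η : Config) : Prop := ∀ i, η i = two → ∃ a b, IsGap η a b i

lemma FinConfig.hasGaps (η : FinConfig) : HasGaps η.1 := fun _ hi => exists_isGap η hi

lemma InfinitelyManyOnes.exists_lt {η : Config} (h : InfinitelyManyOnes η) (m : ℤ) :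
    ∃ l < m, η l = one := by
  by_contra! hc
  refine h.1 ((Set.finite_Icc m 0).subset fun i hi => ⟨?_, hi.1.le⟩)
  by_contra! hlt
  exact hc i hlt hi.2

lemma InfinitelyManyOnes.exists_gt {η : Config} (h : InfinitelyManyOnes η) (m : ℤ) :
    ∃ r > m, η r = one := by
  by_contra! hc
  refine h.2 ((Set.finite_Icc 0 m).subset fun i hi => ⟨hi.1.le, ?_⟩)
  by_contra! hlt
  exact hc i hlt hi.2

lemma InfinitelyManyOnes.hasGaps {η : Config} (h : InfinitelyManyOnes η) : HasGaps η := by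
  intro i hi
  obtain ⟨l, hl, hl1⟩ := h.exists_lt i
  obtain ⟨r, hr, hr1⟩ := h.exists_gt i
  refine Sandpile.exists_isGap hi ⟨(i - l).toNat, ?_⟩ ⟨(r - i).toNat, ?_⟩
  · rwa [Int.toNat_of_nonneg (by omega), sub_sub_cancel]
  · rwa [Int.toNat_of_nonneg (by omega), add_sub_cancel]

/-- An avalanche started outside an interval with ones at both ends does not enter it. -/
lemma HasGaps.topple_eq_of_notMem {η : Config} (h : HasGaps η) {l r : ℤ} (hl : η l = one)
    (hr : η r = one) {i : ℤ} (hi : i ∉ Set.Icc l r) {x : ℤ} (hlx : l < x) (hxr : x < r) :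
    topple i η x = η x := by
  rw [Set.mem_Icc] at hi
  rcases eq_one_or_two (η i) with h1 | h2
  · rw [topple_of_eq_one h1, Function.update_of_ne]
    omega
  · obtain ⟨a, b, hg⟩ := h i h2
    have hal : ¬ (a < l ∧ l < b) := fun hc => one_ne_two (hl ▸ hg.between l hc.1 hc.2)
    have har : ¬ (a < r ∧ r < b) := fun hc => one_ne_two (hr ▸ hg.between r hc.1 hc.2)
    have := hg.lt_left
    have := hg.lt_right
    rw [hg.topple_apply, if_neg (by omega), if_neg (by omega)]

/-- A gap contains no ones, so a gap which meets `[l,r]` in its interior at `i` stays within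
`[l,r]`; the avalanche from `i` only sees the configuration there. -/
lemma HasGaps.topple_congr {η ζ : Config} (h : HasGaps η) {l r : ℤ} (hl : η l = one)
    (hr : η r = one) (heq : ∀ x ∈ Set.Icc l r, ζ x = η x) {i : ℤ} (hi : i ∈ Set.Icc l r)
    {x : ℤ} (hx : x ∈ Set.Icc l r) : topple i ζ x = topple i η x := by
  rcases eq_one_or_two (η i) with h1 | h2
  · rw [topple_of_eq_one h1, topple_of_eq_one ((heq i hi).trans h1)]
    simp only [Function.update_apply, heq x hx]
  · obtain ⟨a, b, hg⟩ := h i h2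
    have hal : ¬ (a < l ∧ l < b) := fun hc => one_ne_two (hl ▸ hg.between l hc.1 hc.2)
    have har : ¬ (a < r ∧ r < b) := fun hc => one_ne_two (hr ▸ hg.between r hc.1 hc.2)
    have h3 := hg.lt_left
    have h4 := hg.lt_right
    rw [Set.mem_Icc] at hi
    have hg' : IsGap ζ a b i := by
      refine ⟨?_, ?_, h3, h4, fun j hj hj' => ?_⟩
      · rw [heq a ⟨by omega, by omega⟩, hg.left]
      · rw [heq b ⟨by omega, by omega⟩, hg.right]
      · rw [heq j ⟨by omega, by omega⟩, hg.between j hj hj']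
    rw [hg.topple_apply, hg'.topple_apply, heq x hx]

/-- Ones at `l` and `r` on either side of the dependence set confine all relevant topplings to
starting sites in `[l,r]`. The terms depend only on the configuration in `[l,r]`, so the inner limit
is eventually constant, and so is the outer one once `[-n,n]` contains `[l,r]`. -/
theorem tendsto_gen_formalGen {f : Config → ℝ} (hf : IsLocal f) {η : Config}
    (hη : InfinitelyManyOnes η) :
    {i : ℤ | f (topple i η) ≠ f η}.Finite ∧
      ∃ ℓ : ℕ → ℝ,
        (∀ n (u : ℕ → FinConfig), IncreasesTo u η →
          Tendsto (fun k => gen n (fun ξ => f ξ.1) (u k)) atTop (𝓝 (ℓ n))) ∧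
        Tendsto ℓ atTop (𝓝 (formalGen f η)) := by
  obtain ⟨A, hA⟩ := hf
  obtain ⟨m, hm⟩ := A.bddBelow
  obtain ⟨M, hM⟩ := A.bddAbove
  obtain ⟨l, hlm, hl⟩ := hη.exists_lt m
  obtain ⟨r, hrM, hr⟩ := hη.exists_gt M
  have hAl : ∀ x ∈ A, l < x := fun x hx => hlm.trans_le (hm hx)
  have hAr : ∀ x ∈ A, x < r := fun x hx => (hM hx).trans_lt hrM
  set d : ℤ → ℝ := fun i => f (topple i η) - f η with hd
  have hout : ∀ ζ : Config, HasGaps ζ → ζ l = one → ζ r = one → ∀ i ∉ Set.Icc l r,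
      f (topple i ζ) - f ζ = 0 := fun ζ hζ h1 h2 i hi =>
    sub_eq_zero.2 (hA _ _ fun x hx => hζ.topple_eq_of_notMem h1 h2 hi (hAl x hx) (hAr x hx))
  have hd0 : ∀ i ∉ Finset.Icc l r, d i = 0 := fun i hi =>
    hout η hη.hasGaps hl hr i (by simpa using hi)
  refine ⟨(Set.finite_Icc l r).subset fun i hi => ?_, fun n =>
    (∑ i ∈ Finset.Icc l r, if η i = two then d i else 0)
      + ∑ i ∈ Finset.Icc (-(n : ℤ)) n, if η i = one then d i else 0, fun n u hu => ?_, ?_⟩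
  · by_contra hi'
    exact hi (sub_eq_zero.1 (hout η hη.hasGaps hl hr i hi'))
  · refine tendsto_const_nhds.congr' ?_
    filter_upwards [hu.eventually_eqOn (insert l (insert r (Finset.Icc l r)))] with k hk
    have heq : ∀ x ∈ Set.Icc l r, (u k).1 x = η x := fun x hx => hk x (by simp [hx.1, hx.2])
    have hdk : ∀ i, f (toppleFin i (u k)).1 - f (u k).1 = d i := by
      intro i
      by_cases hi : i ∈ Set.Icc l r
      · have hI : ∀ x ∈ A, x ∈ Set.Icc l r := fun x hx => ⟨(hAl x hx).le, (hAr x hx).le⟩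
        rw [hd]
        congr 1
        · exact hA _ _ fun x hx => hη.hasGaps.topple_congr hl hr heq hi (hI x hx)
        · exact hA _ _ fun x hx => heq x (hI x hx)
      · rw [hd0 i (by simpa using hi)]
        exact hout _ (u k).hasGaps ((hk l (by simp)).trans hl) ((hk r (by simp)).trans hr) i hi
    have hite : ∀ (v : Height) i, (if (u k).1 i = v then d i else 0) = if η i = v then d i else 0 := by
      intro v i
      by_cases hi : i ∈ Set.Icc l r
      · rw [heq i hi]
      · rw [hd0 i (by simpa using hi), ite_self, ite_self]
    simp only [gen, hdk, hite]
    rw [tsum_eq_sum (s := Finset.Icc l r)]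
    intro i hi
    rw [hd0 i hi, ite_self]
  · refine tendsto_const_nhds.congr' ?_
    filter_upwards [eventually_ge_atTop (max l.natAbs r.natAbs)] with n hn
    rw [← Finset.sum_subset (s₁ := Finset.Icc l r) (s₂ := Finset.Icc (-(n : ℤ)) n),
      ← Finset.sum_add_distrib, formalGen, tsum_eq_sum (s := Finset.Icc l r) hd0]
    · refine Finset.sum_congr rfl fun i _ => ?_
      rcases eq_one_or_two (η i) with h | h <;> simp [h, one_ne_two, one_ne_two.symm, hd]
    · exact Finset.Icc_subset_Icc (by omega) (by omega)
    · intro i _ hi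
      rw [hd0 i hi, ite_self]

end

end Sandpile

/-! ### The main theorem -/

open Sandpile

theorem mainTheorem3 :
    ∃ (Pa : FinConfig → Measure (StepPath FinConfig))
      (Pac : FinConfig × FinConfig → Measure (StepPath (FinConfig × FinConfig)))
      (P : ℕ → FinConfig → Measure (StepPath FinConfig))
      (Pc Ps : ℕ → FinConfig × FinConfig → Measure (StepPath (FinConfig × FinConfig))),
      -- the avalanche process and its coupling
      (Generates genA Pa ∧ Generates genAC Pac ∧ IsOrderedCoupling Pac Pa Pa ∧
        IsMonotoneProcess Pa) ∧
      -- avalanches together with births in `[-n,n]`, and the coupling of two copies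
      (∀ n, Generates (gen n) (P n) ∧ Generates (genC n) (Pc n) ∧
        IsOrderedCoupling (Pc n) (P n) (P n) ∧ IsMonotoneProcess (P n)) ∧
      -- comparison of the processes with births in `[-(n+1),n+1]` and in `[-n,n]`
      (∀ n, Generates (genCSucc n) (Ps n) ∧ IsOrderedCoupling (Ps n) (P (n + 1)) (P n) ∧
        ∀ (t : ℝ≥0) (f : FinConfig → ℝ), Monotone f → (∃ C, ∀ η, |f η| ≤ C) → ∀ η,
          transition StepPath.eval (P n) t f η ≤ transition StepPath.eval (P (n + 1)) t f η) ∧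
      -- the monotone limits
      ∃ (Sn : ℕ → ℝ≥0 → (Config → ℝ) → Config → ℝ) (S : ℝ≥0 → (Config → ℝ) → Config → ℝ),
        (∀ n t f, MonotoneClass f → ∀ (η : Config) (u : ℕ → FinConfig), IncreasesTo u η →
          Tendsto (fun k => transition StepPath.eval (P n) t (fun ξ => f ξ.1) (u k)) atTop
            (𝓝 (Sn n t f η))) ∧
        (∀ n t f, MonotoneClass f → ∀ η, Sn n t f η ≤ Sn (n + 1) t f η) ∧
        (∀ t f, MonotoneClass f → ∀ η, Tendsto (fun n => Sn n t f η) atTop (𝓝 (S t f η))) ∧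
        -- they form Markov semigroups, and `S` belongs to a unique Markov process
        (∀ n, IsMarkovSemigroup (Sn n)) ∧ IsMarkovSemigroup S ∧
        (∃ Q : Config → Measure (ℝ≥0 → Config), IsProcessWithSemigroup S Q ∧
          (∀ Q', IsProcessWithSemigroup S Q' → Q' = Q) ∧
          ∀ f, MonotoneClass f → ∀ t η, S t f η = transition coord Q t (S 0 f) η) ∧
        -- `L` is the formal generator: the limit of the generators of the approximating processes
        ∀ f, IsLocal f → ∀ η, InfinitelyManyOnes η →
          {i : ℤ | f (topple i η) ≠ f η}.Finite ∧
          ∃ ℓ : ℕ → ℝ,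
            (∀ n (u : ℕ → FinConfig), IncreasesTo u η →
              Tendsto (fun k => gen n (fun ξ => f ξ.1) (u k)) atTop (𝓝 (ℓ n))) ∧
            Tendsto ℓ atTop (𝓝 (formalGen f η)) := by
  obtain ⟨Pa, hPa⟩ := isJumpGenerator_genA.exists_generates
  obtain ⟨Pac, hPac⟩ := isJumpGenerator_genAC.exists_generates
  choose P hP using fun n => (isJumpGenerator_gen n).exists_generates
  choose Pc hPc using fun n => (isJumpGenerator_genC n).exists_generates
  choose Ps hPs using fun n => (isJumpGenerator_genCSucc n).exists_generates
  have hca : IsOrderedCoupling Pac Pa Pa :=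
    isOrderedCoupling isJumpGenerator_genAC (fun p hp p' h => movesAC_mem hp h)
      (fun f p _ => genAC_fst f p) (fun f p hp => genAC_snd f hp) hPac.1 hPa.1 hPa.1
  have hcc : ∀ n, IsOrderedCoupling (Pc n) (P n) (P n) := fun n =>
    isOrderedCoupling (isJumpGenerator_genC n) (fun p hp p' h => movesC_mem hp h)
      (fun f p hp => genC_fst n f hp) (fun f p hp => genC_snd n f hp) (hPc n).1 (hP n).1 (hP n).1
  have hcs : ∀ n, IsOrderedCoupling (Ps n) (P (n + 1)) (P n) := fun n =>
    isOrderedCoupling (isJumpGenerator_genCSucc n)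
      (fun p hp p' h => (Multiset.mem_add.1 h).elim (movesC_mem hp) (movesExtra_mem hp))
      (fun f p hp => genCSucc_fst n f hp) (fun f p hp => genCSucc_snd n f hp) (hPs n).1
      (hP (n + 1)).1 (hP n).1
  -- The limits, the semigroups and the process on `Ω` depend on the chains and their couplings only
  -- through this stochastic monotonicity.
  have h : IsMonotoneFamily P :=
    ⟨fun n => (hP n).1.family,
      fun n _ hH hb hm _ _ hle => (hcc n).integral_le (hPc n).1.family.prob hH hb hm hle,
      fun n _ hH hb hm _ => (hcs n).integral_le (hPs n).1.family.prob hH hb hm le_rfl⟩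
  refine ⟨Pa, Pac, P, Pc, Ps,
    ⟨hPa, hPac, hca, hca.monotone_process hPac.1.family.prob hPa.1.family.prob⟩,
    fun n => ⟨hP n, hPc n, hcc n,
      (hcc n).monotone_process (hPc n).1.family.prob (hP n).1.family.prob⟩,
    fun n => ⟨hPs n, hcs n, fun t f hf hb => h.transition_le_succ n t hf hb⟩,
    fun n t f => extend (transition StepPath.eval (P n) t fun ξ => f ξ.1), limitSemigroup P,
    fun n t f hf η u hu => ?_, fun n t f hf => ?_, fun t f hf η => ?_,
    fun n => (h.isMonotoneSemigroup_transition n).isMarkovSemigroup,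
    h.isMarkovSemigroup_limitSemigroup,
    ⟨limitLaw P, h.isProcessWithSemigroup, fun Q' hQ' => h.isProcessWithSemigroup.unique hQ',
      fun f hf t η => h.limitSemigroup_eq_transition hf t η⟩,
    fun f hf η hη => tendsto_gen_formalGen hf hη⟩
  · exact tendsto_extend (h.transition_mono n t hf.mono_coe hf.bounded_coe)
      ((h.isMonotoneSemigroup_transition n).bounded t hf.mono_coe hf.bounded_coe) hu
  · exact extend_le_extend
      ((h.isMonotoneSemigroup_transition (n + 1)).bounded t hf.mono_coe hf.bounded_coe)
      (h.transition_le_succ n t hf.mono_coe hf.bounded_coe)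
  · obtain ⟨C, hC⟩ := hf.bounded_coe
    exact tendsto_extend_of_monotone (fun n => h.transition_le_succ n t hf.mono_coe ⟨C, hC⟩)
      ⟨C, fun n => abs_transition_le (h.family n).prob t hC⟩
      (h.tendsto_supTransition t hf.mono_coe ⟨C, hC⟩) η
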